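/- Let $C$ be a geometrically irreducible smooth projective curve over a finite field $\mathbb{F}$ with $q$ elements, $\infty$ a closed point of $C$, $A=H^0(C\setminus\{\infty\},\mathcal{O}_C)$ and $K=\operatorname{Frac}(A)$; unlabeled tensor and fibre products are over $\mathbb{F}$. Let $\mathfrak{j}_K$ and $\mathfrak{j}$ be the kernels of the multiplication maps $A\otimes K\to K$ and $A\otimes A\to A$, and let $\tau$ be the endomorphism $a\otimes r\mapsto a\otimes r^q$ of $A\otimes K$. For a submodule $L$ of a module $V$ over a commutative ring and an ideal $J$ of that ring, put $L[J^{-1}]=\{x\in V : J^n x\subseteq L \text{ for some } n\ge 0\}$; for an $A\otimes K$-module $L$ without mention of $V$, the image of $L$ in $V=L\otimes_{A\otimes K}\operatorname{Quot}(A\otimes K)$ is meant. An $A$-motive $\underline{M}=(M,\tau_M)$ over $K$ is a finite locally free $A\otimes K$-module $M$ with an isomorphism $\tau_M:(\tau^*M)[\mathfrak{j}_K^{-1}]\to M[\mathfrak{j}_K^{-1}]$ of $A\otimes K$-modules. Its maximal integral model $M_A$ is the (unique) $A\otimes A$-submodule of $M$ that is maximal among the finitely generated $A\otimes A$-submodules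 $L\subseteq M$ that generate $M$ over $A\otimes K$ and satisfy $\tau_M(\tau^*L)\subseteq L[\mathfrak{j}^{-1}]$ inside $V=M\otimes_{A\otimes K}\operatorname{Quot}(A\otimes K)$. Put $N_A=(M+\tau_M(\tau^*M))\cap M_A[\mathfrak{j}^{-1}]$. On the surface $(\operatorname{Spec}A)\times C$, let $\tau$ be the endomorphism that is the identity on $\operatorname{Spec}A$ and the absolute $q$-Frobenius on $C$, let $\Delta$ be the trace of the diagonal of $C\times C$ (where $\operatorname{Spec}A=C\setminus\{\infty\}$), and let $\infty_A$ be the effective divisor $(\operatorname{Spec}A)\times\{\infty\}$. The open subscheme $(\operatorname{Spec}A)\times(C\setminus\{\infty\})$ is $\operatorname{Spec}(A\otimes A)$. **Proposition.** Every $A$-motive $\underline{M}$ over $K$ has a maximal integral model $M_A$ and admits a $C$-shtuka model, that is, a triple $(\mathcal{N},\mathcal{M},\tau_{\mathcal{M}})$ consisting of (a) a coherent sheaf $\mathcal{N}$ on $(\operatorname{Spec}A)\times C$ with $\mathcal{N}(\operatorname{Spec}A\otimes A)=N_A$; (b) a coherent subsheaf $\mathcal{M}$ of $\mathcal{N}$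 with $\mathcal{M}(\operatorname{Spec}A\otimes A)=M_A$ (inside $N_A$), such that the cokernel of the inclusion $\mathcal{M}\to\mathcal{N}$ is supported at $\Delta$; (c) a morphism $\tau_{\mathcal{M}}:\tau^*\mathcal{M}\to\mathcal{N}(-\infty_A)$ which coincides with $\tau_M:\tau^*M_A\to N_A$ on $\operatorname{Spec}(A\otimes A)$. -/

import Mathlib

open CategoryTheory AlgebraicGeometry Opposite TopologicalSpace
open scoped TensorProduct

universe u

namespace ShtukaModels

section Frobenius

variable {F : Type u} [Field F] {X : Scheme.{u}} (π : X ⟶ Spec (CommRingCat.of F))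

/-- The structure map from the base field to the sections of an `F`-scheme over an open subset. -/
noncomputable def structureHom (V : X.Opens) : F →+* Γ(X, V) :=
  ((Scheme.ΓSpecIso (CommRingCat.of F)).inv ≫ π.appTop ≫
    X.presheaf.map (homOfLE (le_top : V ≤ ⊤)).op).hom

/-- The ring endomorphism `s ↦ s ^ q`, `q = #F`, of the sections over an open subset. -/
noncomputable def frobeniusSections [Fintype F] (V : X.Opens) : Γ(X, V) →+* Γ(X, V) :=
  letI : Algebra F Γ(X, V) := (structureHom π V).toAlgebra
  (FiniteField.frobeniusAlgHom F Γ(X, V)).toRingHom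

@[simp]
theorem frobeniusSections_apply [Fintype F] (V : X.Opens) (s : Γ(X, V)) :
    frobeniusSections π V s = s ^ Fintype.card F := rfl

/-- The absolute `q`-Frobenius of an `F`-scheme: the identity on points and `s ↦ s ^ q` on
sections. -/
noncomputable def absoluteFrobenius [Fintype F] : X ⟶ X where
  base := 𝟙 _
  c := 
    { app := fun V => CommRingCat.ofHom (frobeniusSections π V.unop)
      naturality := fun V W i => by
        ext s
        exact (map_pow (X.presheaf.map i).hom s _).symm }
  prop := fun x => by
    constructor
    intro s hs
    obtain ⟨V, hV, t, rfl⟩ := X.presheaf.exists_germ_eq s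
    erw [PresheafedSpace.stalkMap_germ_apply] at hs
    have h : IsUnit (X.presheaf.germ V x hV (t ^ Fintype.card F)) := hs
    rw [map_pow] at h
    exact (isUnit_pow_iff Fintype.card_ne_zero).mp h

theorem absoluteFrobenius_comp [Fintype F] : absoluteFrobenius π ≫ π = π := by
  apply ext_to_Spec
  ext a
  have h : (a : F) ^ Fintype.card F = a := FiniteField.pow_card a
  change (π.appTop.hom ((Scheme.ΓSpecIso (CommRingCat.of F)).inv.hom a)) ^ Fintype.card F =
    π.appTop.hom ((Scheme.ΓSpecIso (CommRingCat.of F)).inv.hom a)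
  rw [← map_pow, ← map_pow, h]

end Frobenius

theorem toSpecΓ_structureHom {F : Type u} [Field F] {X : Scheme.{u}}
    (π : X ⟶ Spec (CommRingCat.of F)) (V : X.Opens) :
    V.toSpecΓ ≫ Spec.map (CommRingCat.ofHom (structureHom π V)) = V.ι ≫ π := by
  apply ext_to_Spec
  simp only [structureHom, CommRingCat.ofHom_hom, Spec.map_comp, Scheme.Γ_map_op,
    Scheme.Hom.comp_appTop, Category.assoc, Scheme.Opens.toSpecΓ_appTop]
  rw [reassoc_of% Scheme.ΓSpecIso_naturality (X.presheaf.map (homOfLE (le_top : V ≤ ⊤)).op),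
    reassoc_of% Scheme.ΓSpecIso_naturality π.appTop,
    reassoc_of% Scheme.ΓSpecIso_naturality (Scheme.ΓSpecIso (CommRingCat.of F)).inv]
  rw [Iso.hom_inv_id_assoc, Scheme.Opens.ι_appTop]
  refine congrArg ((Scheme.ΓSpecIso (CommRingCat.of F)).inv ≫ ·) ?_
  exact congrArg (π.appTop ≫ ·) (X.presheaf.map_comp _ _).symm

/-! ### Modules with poles along an ideal -/

section Poles

variable {R : Type u} [CommRing R]

/-- `L[J⁻¹]`: the elements `x` of the ambient module with `J ^ n • x ⊆ L` for some `n`. -/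
def poles {V : Type u} [AddCommGroup V] [Module R V] (J : Ideal R) (L : Submodule R V) :
    Submodule R V where
  carrier := {x | ∃ n : ℕ, ∀ r ∈ J ^ n, r • x ∈ L}
  zero_mem' := ⟨0, fun r _ => by simp⟩
  add_mem' := by
    rintro x y ⟨m, hm⟩ ⟨n, hn⟩
    refine ⟨max m n, fun r hr => ?_⟩
    rw [smul_add]
    exact L.add_mem (hm r (Ideal.pow_le_pow_right (le_max_left m n) hr))
      (hn r (Ideal.pow_le_pow_right (le_max_right m n) hr))
  smul_mem' := by
    rintro c x ⟨n, hn⟩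
    refine ⟨n, fun r hr => ?_⟩
    rw [smul_comm]
    exact L.smul_mem c (hn r hr)

theorem le_poles {V : Type u} [AddCommGroup V] [Module R V] (J : Ideal R) (L : Submodule R V) :
    L ≤ poles J L :=
  fun _ hx => ⟨0, fun r _ => L.smul_mem r hx⟩

variable (R) in
/-- `M ⊗ Quot(R)`, where `Quot(R)` is the localization of `R` at its non-zero-divisors. -/
abbrev Generic (M : Type u) [AddCommGroup M] [Module R M] : Type u := FractionRing R ⊗[R] M

variable (R) in
/-- The canonical map `M → M ⊗ Quot(R)`. -/
noncomputable def toGeneric (M : Type u) [AddCommGroup M] [Module R M] : M →ₗ[R] Generic R M :=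
  TensorProduct.mk R (FractionRing R) M 1

/-- `M[J⁻¹]`, the sections of `M` over the complement of `V(J)` in `Spec R`, as a submodule of
`M ⊗ Quot(R)`. -/
noncomputable def modulePoles (J : Ideal R) (M : Type u) [AddCommGroup M] [Module R M] :
    Submodule R (Generic R M) :=
  poles J (LinearMap.range (toGeneric R M))

/-- The pullback `τ^* M = R ⊗_{τ, R} M` along a ring endomorphism `τ` of `R`. -/
noncomputable abbrev FrobPullback (τ : R →+* R) (M : Type u) [AddCommGroup M] [Module R M] :
    Type u :=
  (ModuleCat.extendScalars.{u, u, u} τ).obj (ModuleCat.of R M)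

/-- The `τ`-semilinear map `M → τ^* M`, `m ↦ 1 ⊗ m`. -/
noncomputable def frobUnit (τ : R →+* R) (M : Type u) [AddCommGroup M] [Module R M] (m : M) :
    FrobPullback τ M :=
  TensorProduct.tmul R (M := (ModuleCat.restrictScalars τ).obj (ModuleCat.of R R)) (1 : R) m

end Poles

/-! ### The curve and its rings -/

/-- A smooth projective geometrically irreducible curve `C` over the field `F`, with a closed point
`∞`. (A curve is projective if and only if it is proper.) -/
structure PointedCurve (F : Type u) [Field F] where
  /-- the curve `C` -/
  C : Scheme.{u}
  /-- the structure morphism -/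
  π : C ⟶ Spec (CommRingCat.of F)
  smooth : SmoothOfRelativeDimension 1 π
  proper : IsProper π
  geometricallyIrreducible : GeometricallyIrreducible π
  /-- the closed point `∞` -/
  inf : C
  isClosed_inf : IsClosed ({inf} : Set C)

namespace PointedCurve

variable {F : Type u} [Field F] (X : PointedCurve F)

/-- The open subset `C ∖ {∞}`. -/
def affinePart : X.C.Opens := ⟨{X.inf}ᶜ, X.isClosed_inf.isOpen_compl⟩

/-- The ring `A = H⁰(C ∖ {∞}, 𝒪_C)`. -/
abbrev A : Type u := Γ(X.C, X.affinePart)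

noncomputable instance : Algebra F X.A := (structureHom X.π X.affinePart).toAlgebra

/-- The fraction field `K` of `A`. -/
abbrev K : Type u := FractionRing X.A

/-- The inclusion `A → K`. -/
noncomputable def inclK : X.A →ₐ[F] X.K := IsScalarTower.toAlgHom F X.A X.K

/-- The ring `A ⊗ A`. -/
abbrev AA : Type u := X.A ⊗[F] X.A

/-- The ring `A ⊗ K`. -/
abbrev AK : Type u := X.A ⊗[F] X.K

noncomputable instance : Algebra X.AA X.AK :=
  (Algebra.TensorProduct.map (AlgHom.id F X.A) X.inclK).toRingHom.toAlgebra

/-- The kernel of `A ⊗ A → A`, `a ⊗ b ↦ a b`. -/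
noncomputable def jA : Ideal X.AA :=
  RingHom.ker (Algebra.TensorProduct.productMap (AlgHom.id F X.A) (AlgHom.id F X.A))

/-- The kernel of `A ⊗ K → K`, `a ⊗ r ↦ a r`. -/
noncomputable def jK : Ideal X.AK :=
  RingHom.ker (Algebra.TensorProduct.productMap X.inclK (AlgHom.id F X.K))

/-- The endomorphism `a ⊗ r ↦ a ⊗ r ^ q` of `A ⊗ K`. -/
noncomputable def frobAK [Fintype F] : X.AK →+* X.AK :=
  (Algebra.TensorProduct.map (AlgHom.id F X.A) (FiniteField.frobeniusAlgHom F X.K)).toRingHom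

/-! ### The surface `Spec A × C` -/

/-- The product `Spec A × C` over `Spec F`. -/
noncomputable abbrev surface : Scheme.{u} :=
  Limits.pullback (Spec.map (CommRingCat.ofHom (algebraMap F X.A))) X.π

/-- The projection `Spec A × C → Spec A`. -/
noncomputable abbrev pr₁ : X.surface ⟶ Spec (CommRingCat.of X.A) := Limits.pullback.fst _ _

/-- The projection `Spec A × C → C`. -/
noncomputable abbrev pr₂ : X.surface ⟶ X.C := Limits.pullback.snd _ _

/-- The endomorphism `τ` of `Spec A × C`: the identity on `Spec A` and the absolute `q`-Frobenius on
`C`. -/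
noncomputable def frob [Fintype F] : X.surface ⟶ X.surface :=
  Limits.pullback.lift X.pr₁ (X.pr₂ ≫ absoluteFrobenius X.π) (by
    rw [Category.assoc, absoluteFrobenius_comp, Limits.pullback.condition])

/-- The open subscheme `Spec A × (C ∖ {∞}) = Spec (A ⊗ A)` of `Spec A × C`. -/
noncomputable def affineOpen : X.surface.Opens := X.pr₂ ⁻¹ᵁ X.affinePart

theorem affineOpen_le_frob [Fintype F] : X.affineOpen ≤ X.frob ⁻¹ᵁ X.affineOpen := by
  have h : X.frob ≫ X.pr₂ = X.pr₂ ≫ absoluteFrobenius X.π := Limits.pullback.lift_snd _ _ _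
  have : X.frob ⁻¹ᵁ X.affineOpen = (X.frob ≫ X.pr₂) ⁻¹ᵁ X.affinePart := rfl
  rw [this, h]
  exact le_rfl

/-- The function `a ⊗ b` on `Spec A × (C ∖ {∞})`, for `a, b ∈ A`. -/
noncomputable def tensorSection (a b : X.A) : Γ(X.surface, X.affineOpen) :=
  (X.pr₁.appLE ⊤ X.affineOpen le_top).hom ((Scheme.ΓSpecIso (CommRingCat.of X.A)).inv.hom a) *
    (X.pr₂.appLE X.affinePart X.affineOpen le_rfl).hom b

theorem diagonal_condition :
    X.affinePart.toSpecΓ ≫ Spec.map (CommRingCat.ofHom (algebraMap F X.A)) =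
      X.affinePart.ι ≫ X.π :=
  toSpecΓ_structureHom X.π X.affinePart

/-- The diagonal `Δ` on `Spec A × C`, i.e. the trace of the diagonal of `C × C`: the points
`(x, x)` with `x` in `C ∖ {∞} = Spec A`. -/
noncomputable def diagonal : Set X.surface :=
  Set.range (Limits.pullback.lift (f := Spec.map (CommRingCat.ofHom (algebraMap F X.A))) (g := X.π)
    X.affinePart.toSpecΓ X.affinePart.ι X.diagonal_condition)

/-- The closed immersion of the divisor `∞_A = Spec A × {∞}` into `Spec A × C`. -/
noncomputable def infDivisor :
    Limits.pullback X.pr₂ (X.C.fromSpecResidueField X.inf) ⟶ X.surface :=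
  Limits.pullback.fst _ _

end PointedCurve

section Sheaves
variable {S : Scheme.{u}}

/-- A coherent sheaf on a locally Noetherian scheme: a quasi-coherent sheaf of modules whose
sections over every affine open subset form a finitely generated module. -/
def IsCoherent (N : S.Modules) : Prop :=
  SheafOfModules.IsQuasicoherent N ∧
    ∀ V : S.Opens, IsAffineOpen V → Module.Finite Γ(S, V) Γ(N, V)

/-- The support of a sheaf of modules: the points at which the stalk is nonzero. -/
def moduleSupport (N : S.Modules) : Set S := {x | Nontrivial (N.presheaf.stalk x)}

/-- The ideal sheaf of a closed subscheme `i : Z ⟶ S`, i.e. the kernel of `𝒪_S → i_* 𝒪_Z`, as a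
submodule of `𝒪_S`. -/
noncomputable def idealSubmodule {Z : Scheme.{u}} (i : Z ⟶ S) :
    PresheafOfModules.Submodule (PresheafOfModules.unit (S.presheaf ⋙ forget₂ CommRingCat RingCat)) where
  obj V := (RingHom.ker (i.app V.unop).hom : Ideal Γ(S, V.unop))
  map {V W} f := by
    have key : ∀ s : Γ(S, V.unop), (i.app V.unop).hom s = 0 →
        (i.app W.unop).hom ((S.presheaf.map f).hom s) = 0 := by
      intro s hs
      have h : (i.app W.unop).hom ((S.presheaf.map f).hom s) =
          (Z.presheaf.map ((Opens.map i.base).map f.unop).op).hom ((i.app V.unop).hom s) :=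
        congr($(i.naturality f) s)
      rw [h, hs, map_zero]
    exact fun s hs => key s hs

open MonoidalCategory in
/-- The presheaf `V ↦ N(V) ⊗ I(V)`, where `I` is the ideal sheaf of `i`. -/
noncomputable def twistPresheaf {Z : Scheme.{u}} (N : S.Modules) (i : Z ⟶ S) :
    PresheafOfModules.{u} (S.presheaf ⋙ forget₂ CommRingCat RingCat) :=
  PresheafOfModules.Monoidal.tensorObj (R := S.presheaf) N.val (idealSubmodule i).toPresheafOfModules

/-- The twist `N ⊗ I`, where `I` is the ideal sheaf of `i`; this is `N(-D)` when `i` is the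
closed immersion of an effective Cartier divisor `D`. -/
noncomputable def twist {Z : Scheme.{u}} (N : S.Modules) (i : Z ⟶ S) : S.Modules :=
  (PresheafOfModules.sheafification (𝟙 S.ringCatSheaf.obj)).obj (twistPresheaf N i)

open MonoidalCategory in
/-- The map `N(V) ⊗ I(V) → N(V)`, `n ⊗ f ↦ f n`. -/
noncomputable def twistPresheafι {Z : Scheme.{u}} (N : S.Modules) (i : Z ⟶ S) :
    twistPresheaf N i ⟶ N.val :=
  PresheafOfModules.Monoidal.tensorHom (R := S.presheaf) (𝟙 N.val) (idealSubmodule i).ι ≫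
    (MonoidalCategoryStruct.rightUnitor
      (C := PresheafOfModules.{u} (S.presheaf ⋙ forget₂ CommRingCat RingCat)) N.val).hom

/-- The canonical morphism `N ⊗ I → N`. -/
noncomputable def twistι {Z : Scheme.{u}} (N : S.Modules) (i : Z ⟶ S) : twist N i ⟶ N :=
  ((PresheafOfModules.sheafificationAdjunction (𝟙 S.ringCatSheaf.obj)).homEquiv _ N).symm
    (twistPresheafι N i)

end Sheaves

/-! ### Anderson motives -/

/-- An `A`-motive over `K`: a finite locally free `A ⊗ K`-module `M` with an isomorphism
`τ_M : (τ^* M)[j⁻¹] ≃ M[j⁻¹]` of `A ⊗ K`-modules. -/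
structure AMotive {F : Type u} [Field F] [Fintype F] (X : PointedCurve F) where
  /-- the module `M` -/
  M : Type u
  [addCommGroup : AddCommGroup M]
  [module : Module X.AK M]
  finite : Module.Finite X.AK M
  projective : Module.Projective X.AK M
  /-- the isomorphism `τ_M` -/
  τ : modulePoles X.jK (FrobPullback X.frobAK M) ≃ₗ[X.AK] modulePoles X.jK M

namespace AMotive

variable {F : Type u} [Field F] [Fintype F] {X : PointedCurve F} (E : AMotive X)

instance : AddCommGroup E.M := E.addCommGroup
instance : Module X.AK E.M := E.module

noncomputable instance : Module X.AA E.M := Module.compHom E.M (algebraMap X.AA X.AK)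

instance : IsScalarTower X.AA X.AK E.M :=
  ⟨fun a b m => by rw [Algebra.smul_def, mul_smul]; rfl⟩

/-- The restriction `τ^* M → M ⊗ Quot(A ⊗ K)` of `τ_M` to `τ^* M`. -/
noncomputable def τLin : FrobPullback X.frobAK E.M →ₗ[X.AK] Generic X.AK E.M :=
  (modulePoles X.jK E.M).subtype ∘ₗ E.τ.toLinearMap ∘ₗ
    (toGeneric X.AK (FrobPullback X.frobAK E.M)).codRestrict
      (modulePoles X.jK (FrobPullback X.frobAK E.M))
      (fun t => le_poles _ _ (LinearMap.mem_range_self _ t))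

/-- The `τ`-semilinear map `m ↦ τ_M(1 ⊗ m)` on `M`. -/
noncomputable def τSemi (m : E.M) : Generic X.AK E.M := E.τLin (frobUnit X.frobAK E.M m)

/-- `L[j⁻¹]`, for an `A ⊗ A`-submodule `L` of `M`. -/
noncomputable def latticePoles (L : Submodule X.AA E.M) : Submodule X.AA (Generic X.AK E.M) :=
  poles X.jA (L.map ((toGeneric X.AK E.M).restrictScalars X.AA))

/-- `τ_M(τ^* L)`, for an `A ⊗ A`-submodule `L` of `M`: the `A ⊗ A`-submodule generated by the
elements `τ_M(1 ⊗ m)`, `m ∈ L`. -/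
noncomputable def τLattice (L : Submodule X.AA E.M) : Submodule X.AA (Generic X.AK E.M) :=
  Submodule.span X.AA (E.τSemi '' L)

/-- An integral model of `M` over `A`: a finitely generated `A ⊗ A`-submodule `L` of `M` which
generates `M` over `A ⊗ K` and satisfies `τ_M(τ^* L) ⊆ L[j⁻¹]`. -/
structure IsIntegralModel (L : Submodule X.AA E.M) : Prop where
  fg : L.FG
  span_eq_top : Submodule.span X.AK (L : Set E.M) = ⊤
  stable : E.τLattice L ≤ E.latticePoles L

/-- The maximal integral model `M_A` of `M` over `A`. -/
def IsMaximalIntegralModel (L : Submodule X.AA E.M) : Prop := Maximal E.IsIntegralModel L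

/-- The `A ⊗ A`-module `N_A = (M + τ_M(τ^* M)) ∩ M_A[j⁻¹]`. -/
noncomputable def N_A (M_A : Submodule X.AA E.M) : Submodule X.AA (Generic X.AK E.M) :=
  (LinearMap.range (toGeneric X.AK E.M) ⊔ LinearMap.range E.τLin).restrictScalars X.AA ⊓
    E.latticePoles M_A

theorem τSemi_add (m n : E.M) : E.τSemi (m + n) = E.τSemi m + E.τSemi n := by
  have h : frobUnit X.frobAK E.M (m + n) = frobUnit X.frobAK E.M m + frobUnit X.frobAK E.M n :=
    TensorProduct.tmul_add _ _ _
  rw [τSemi, h, map_add, τSemi, τSemi]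

theorem latticePoles_mono {L L' : Submodule X.AA E.M} (h : L ≤ L') :
    E.latticePoles L ≤ E.latticePoles L' := by
  rintro x ⟨n, hn⟩
  exact ⟨n, fun r hr => Submodule.map_mono h (hn r hr)⟩

theorem IsIntegralModel.sup {L L' : Submodule X.AA E.M} (h : E.IsIntegralModel L)
    (h' : E.IsIntegralModel L') : E.IsIntegralModel (L ⊔ L') where
  fg := h.fg.sup h'.fg
  span_eq_top := top_le_iff.mp (h.span_eq_top ▸ Submodule.span_mono (le_sup_left (a := L)))
  stable := by
    refine Submodule.span_le.mpr ?_
    rintro _ ⟨m, hm, rfl⟩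
    obtain ⟨x, hx, y, hy, rfl⟩ := Submodule.mem_sup.mp hm
    rw [τSemi_add]
    exact add_mem
      (E.latticePoles_mono le_sup_left (h.stable (Submodule.subset_span ⟨x, hx, rfl⟩)))
      (E.latticePoles_mono le_sup_right (h'.stable (Submodule.subset_span ⟨y, hy, rfl⟩)))

/-- The maximal integral model is unique. -/
theorem IsMaximalIntegralModel.unique {L L' : Submodule X.AA E.M}
    (h : E.IsMaximalIntegralModel L) (h' : E.IsMaximalIntegralModel L') : L = L' :=
  le_antisymm
    (le_sup_left.trans (h'.2 (IsIntegralModel.sup E h.1 h'.1) le_sup_right))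
    (le_sup_right.trans (h.2 (IsIntegralModel.sup E h.1 h'.1) le_sup_left))

/-- A `C`-shtuka model for `E`, where `M_A` is the maximal integral model of `E`. -/
structure CShtukaModel (M_A : Submodule X.AA E.M) where
  /-- the sheaf `𝓝` on `Spec A × C` -/
  N : X.surface.Modules
  N_coherent : IsCoherent N
  /-- the identification `𝓝(Spec (A ⊗ A)) = N_A` -/
  sectionsN : Γ(N, X.affineOpen) ≃+ E.N_A M_A
  sectionsN_smul : ∀ (a b : X.A) (s : Γ(N, X.affineOpen)),
    sectionsN (X.tensorSection a b • s) = (a ⊗ₜ[F] b : X.AA) • sectionsN s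
  /-- the subsheaf `𝓜` of `𝓝` -/
  M : X.surface.Modules
  M_coherent : IsCoherent M
  /-- the inclusion of `𝓜` in `𝓝` -/
  ι : M ⟶ N
  mono : Mono ι
  /-- the identification `𝓜(Spec (A ⊗ A)) = M_A` -/
  sectionsM : Γ(M, X.affineOpen) ≃+ M_A
  sectionsM_smul : ∀ (a b : X.A) (s : Γ(M, X.affineOpen)),
    sectionsM (X.tensorSection a b • s) = (a ⊗ₜ[F] b : X.AA) • sectionsM s
  /-- both identifications are compatible with the inclusions `𝓜 ⊆ 𝓝` and `M_A ⊆ N_A` -/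
  sections_ι : ∀ s : Γ(M, X.affineOpen),
    (sectionsN (ι.app X.affineOpen s) : Generic X.AK E.M) =
      toGeneric X.AK E.M (sectionsM s : E.M)
  /-- the cokernel of the inclusion is supported at `Δ` -/
  support_subset : moduleSupport (Limits.cokernel ι) ⊆ X.diagonal
  /-- the morphism `τ_𝓜 : τ^* 𝓜 → 𝓝(-∞_A)` -/
  τ : (Scheme.Modules.pullback X.frob).obj M ⟶ twist N X.infDivisor
  /-- `τ_𝓜` coincides with `τ_M : τ^* M_A → N_A` on `Spec (A ⊗ A)`: the `τ`-semilinear map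
  `𝓜 → τ_* 𝓝` that corresponds to `τ_𝓜` is `m ↦ τ_M(1 ⊗ m)` on sections over `Spec (A ⊗ A)` -/
  sections_τ : ∀ s : Γ(M, X.affineOpen),
    (sectionsN (N.presheaf.map (homOfLE X.affineOpen_le_frob).op
      ((((Scheme.Modules.pullbackPushforwardAdjunction X.frob).homEquiv M N)
        (τ ≫ twistι N X.infDivisor)).app X.affineOpen s)) : Generic X.AK E.M) =
      E.τSemi (sectionsM s : E.M)

end AMotive

end ShtukaModels

/-! Denominators are controlled one function at a time. Choose `h` in `A` such that `A` is free of
finite rank over `F[h]`, put δ = h ⊗ 1 - 1 ⊗ h, and take a basis h^i ε_j of `A` over `F`. The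
content of z in A ⊗ K is the `A`-submodule of `K` generated by the coordinates of z. Multiplication
by elements of A ⊗ A does not enlarge the content, z lies in A ⊗ A exactly when its content lies in
`A`, and the content of z is contained in that of δz (`content_le_content_mul`). Hence poles along δ
neither create nor hide denominators from `K`.

Maximal model. Embed M as a summand of a free module. Up to a power of δ, the inverse of τ_M is a
matrix over A ⊗ K, with a common denominator β. If x and y = δ^n τ_M(x) lie in a model and c is in
the content of x, then β c^q is in the content of y (`exists_denominator`). Iterating this, with one
denominator d of the model, gives d(βc)^(q^m) in `A` for all m, so βc is integral
(`isIntegral_of_mul_pow_mem`) and lies in `A`. All models are therefore contained in one Noetherian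
lattice depending only on M (`IsIntegralModel.le_boundingLattice`). Scaling generators of M gives
some model, and the ascending chain condition gives a maximal one.

Shtuka model. A sheaf is described by its local lattices in the function-field vector space W = M ⊗
Quot (`fracSheaf`); it is coherent if these lattices are locally given by a common finite set of
generators. Over Spec(A ⊗ A) the lattices are those of M_A and N_A. The content lemma shows that N_A
is finitely generated, so δ^n N_A lies in M_A for some n. For an `h` with a pole at ∞, θ = 1/(1 ⊗ h)
vanishes on ∞_A, and θδ = θ(h ⊗ 1) - 1 is invertible near ∞_A. Both sheaves are extended across ∞_A
by the lattice generated by θ^k times generators of M_A. As τ(θ^k m) = θ^(qk) τ_M(m), the gain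
θ^((q-1)k) outweighs the bounded pole of τ_M once k is large, and one spare factor θ yields the
twist by -∞_A (`nonempty_cShtukaModel`).

Geometry of the curve. Local rings of a smooth curve are principal ideal domains. A rational
function whose only pole is ∞ exists because a Čech H^1 of the structure sheaf is finite-dimensional
(`exists_finite_reg`, `exists_regularOpen_eq_affinePart`). It defines a proper quasi-finite, hence
finite, map from C ∖ {∞} to the affine line. So C ∖ {∞} is affine and `A` is finite over `F[h]`. -/

namespace ShtukaModels

/-! ### Sheaves of local lattices in a vector space over the function field -/

section FractionalSheaves

variable {S : Scheme.{u}} [IsIntegral S]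

/-- The local ring at `x`, as a subring of the function field. -/
noncomputable def localRing (x : S) : Subring S.functionField :=
  (algebraMap (S.presheaf.stalk x) S.functionField).range

theorem genericPoint_mem {V : S.Opens} {x : S} (hx : x ∈ V) : genericPoint S ∈ V :=
  ((genericPoint_spec S).mem_open_set_iff V.isOpen).mpr ⟨x, trivial, hx⟩

theorem algebraMap_germ_genericPoint {V : S.Opens} {x : S} (hx : x ∈ V)
    (hξ : genericPoint S ∈ V) (r : Γ(S, V)) :
    algebraMap (S.presheaf.stalk x) S.functionField (S.presheaf.germ V x hx r) =
      S.presheaf.germ V (genericPoint S) hξ r := by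
  haveI : Nonempty V := ⟨⟨x, hx⟩⟩
  exact Scheme.algebraMap_germ_eq_germToFunctionField S hx r

theorem germ_mem_localRing {V : S.Opens} {x : S} (hx : x ∈ V) (hξ : genericPoint S ∈ V)
    (r : Γ(S, V)) : S.presheaf.germ V (genericPoint S) hξ r ∈ localRing x :=
  ⟨_, algebraMap_germ_genericPoint hx hξ r⟩

theorem mem_localRing_iff {x : S} {a : S.functionField} :
    a ∈ localRing x ↔ ∃ (V : S.Opens) (hx : x ∈ V) (r : Γ(S, V)),
      S.presheaf.germ V (genericPoint S) (genericPoint_mem hx) r = a := by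
  constructor
  · rintro ⟨b, rfl⟩
    obtain ⟨V, hx, r, rfl⟩ := S.presheaf.exists_germ_eq b
    exact ⟨V, hx, r, (algebraMap_germ_genericPoint hx _ r).symm⟩
  · rintro ⟨V, hx, r, rfl⟩
    exact germ_mem_localRing hx _ r

theorem germ_genericPoint_injective {V : S.Opens} (h : genericPoint S ∈ V) :
    Function.Injective (S.presheaf.germ V (genericPoint S) h) :=
  germ_injective_of_isIntegral _ _ _

variable {W : Type u} [AddCommGroup W] [Module S.functionField W]

theorem germ_res {V V' : S.Opensᵒᵖ} (i : V ⟶ V') (p : genericPoint S ∈ V'.unop)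
    (r : Γ(S, V.unop)) :
    S.presheaf.germ V'.unop (genericPoint S) p (S.presheaf.map i r) =
      S.presheaf.germ V.unop (genericPoint S) (i.unop.le p) r :=
  TopCat.Presheaf.germ_res_apply' S.presheaf i _ _ r

/-- The sections over `V` of the sheaf whose stalk at `x` is the `𝒪_x`-submodule of `W` generated
by `G x`. -/
noncomputable def fracSections (G : S → Set W) (V : S.Opens) :
    AddSubgroup (PLift (genericPoint S ∈ V) → W) where
  carrier := {f | ∀ x ∈ V, ∀ p, f ⟨p⟩ ∈ Submodule.span (localRing x) (G x)}
  zero_mem' := fun _ _ _ => zero_mem _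
  add_mem' := fun hf hg x hx p => add_mem (hf x hx p) (hg x hx p)
  neg_mem' := fun hf x hx p => neg_mem (hf x hx p)

theorem germ_smul_mem_span {V : S.Opens} {x : S} (hx : x ∈ V) (hξ : genericPoint S ∈ V)
    (r : Γ(S, V)) {G : Set W} {w : W} (hw : w ∈ Submodule.span (localRing x) G) :
    S.presheaf.germ V (genericPoint S) hξ r • w ∈ Submodule.span (localRing x) G :=
  Submodule.smul_mem _ (⟨_, germ_mem_localRing hx hξ r⟩ : localRing x) hw

noncomputable instance fracSectionsModule (G : S → Set W) (V : S.Opens) :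
    Module Γ(S, V) (fracSections G V) where
  smul r f := ⟨fun p => S.presheaf.germ V (genericPoint S) p.down r • f.1 p,
    fun _ hx p => germ_smul_mem_span hx p r (f.2 _ hx p)⟩
  one_smul f := by
    ext p
    change S.presheaf.germ V (genericPoint S) p.down 1 • f.1 p = _
    rw [map_one, one_smul]
  mul_smul r s f := by
    ext p
    change S.presheaf.germ V (genericPoint S) p.down (r * s) • f.1 p = _
    rw [map_mul, mul_smul]
    rfl
  smul_zero r := by
    ext p
    exact smul_zero _
  smul_add r f g := by
    ext p
    exact smul_add _ _ _
  add_smul r s f := by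
    ext p
    change S.presheaf.germ V (genericPoint S) p.down (r + s) • f.1 p = _
    rw [map_add, add_smul]
    rfl
  zero_smul f := by
    ext p
    change S.presheaf.germ V (genericPoint S) p.down 0 • f.1 p = _
    rw [map_zero, zero_smul]
    rfl

/-- Restriction of sections. -/
noncomputable def fracRes (G : S → Set W) {V V' : S.Opens} (h : V' ≤ V) :
    fracSections G V →+ fracSections G V' where
  toFun f := ⟨fun p => f.1 ⟨h p.down⟩, fun x hx p => f.2 x (h hx) (h p)⟩
  map_zero' := rfl
  map_add' _ _ := rfl

/-- The presheaf of abelian groups `V ↦ fracSections G V`. -/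
noncomputable def fracPresheafAb (G : S → Set W) : TopCat.Presheaf Ab.{u} S where
  obj V := AddCommGrpCat.of (fracSections G V.unop)
  map i := AddCommGrpCat.ofHom (fracRes G i.unop.le)

noncomputable instance (G : S → Set W) (V : S.Opensᵒᵖ) :
    Module (S.ringCatSheaf.obj.obj V) ((fracPresheafAb G).obj V) :=
  fracSectionsModule G V.unop

/-- The presheaf of modules `V ↦ fracSections G V`. -/
noncomputable def fracPresheaf (G : S → Set W) : S.PresheafOfModules :=
  PresheafOfModules.ofPresheaf (R := S.ringCatSheaf.obj) (fracPresheafAb G) (by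
    intro V V' i r m
    refine Subtype.ext (funext fun p => ?_)
    change S.presheaf.germ V.unop _ _ r • _ = S.presheaf.germ V'.unop _ _ (S.presheaf.map i r) • _
    exact congrArg (· • m.1 _) (germ_res i _ r).symm)

/-- On an irreducible scheme every nonempty open subset contains the generic point, so a section
over it is a single vector of `W`, and compatible sections over a cover are the same vector. The
domain `PLift` of a section makes the sections over the empty set trivial, as a sheaf requires. -/
theorem fracPresheafAb_isSheaf (G : S → Set W) : (fracPresheafAb G).IsSheaf := by
  rw [TopCat.Presheaf.isSheaf_iff_isSheaf_comp (forget AddCommGrpCat)]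
  apply TopCat.Presheaf.isSheaf_of_isSheafUniqueGluing_types
  intro ι U sf hsf
  classical
  let s : ∀ i, fracSections G (U i) := sf
  have hs : ∀ (i j : ι) (pi : genericPoint S ∈ U i) (pj : genericPoint S ∈ U j),
      (s i).1 ⟨pi⟩ = (s j).1 ⟨pj⟩ := by
    intro i j pi pj
    have := hsf i j
    exact congrFun (congrArg Subtype.val this) ⟨⟨pi, pj⟩⟩
  let f : PLift (genericPoint S ∈ iSup U) → W := fun p =>
    (s (Opens.mem_iSup.mp p.down).choose).1 ⟨(Opens.mem_iSup.mp p.down).choose_spec⟩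
  have hf : ∀ i (pi : genericPoint S ∈ U i) p, f p = (s i).1 ⟨pi⟩ := fun i pi p => hs _ _ _ _
  have hmem : f ∈ fracSections G (iSup U) := by
    intro x hx p
    obtain ⟨i, hi⟩ := Opens.mem_iSup.mp hx
    rw [hf i (genericPoint_mem hi) ⟨p⟩]
    exact (s i).2 x hi _
  refine ⟨(⟨f, hmem⟩ : fracSections G (iSup U)), fun i => ?_, fun t ht => ?_⟩
  · exact Subtype.ext (funext fun p => hf i p.down ⟨(le_iSup U i) p.down⟩)
  · refine Subtype.ext (funext fun p => ?_)
    obtain ⟨i, hi⟩ := Opens.mem_iSup.mp p.down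
    exact (congrFun (congrArg Subtype.val (ht i)) ⟨hi⟩).trans (hf i hi p).symm

/-- The sheaf of modules on `S` whose stalk at `x` is the `𝒪_x`-submodule of the `K(S)`-vector
space `W` generated by `G x`. -/
noncomputable def fracSheaf (G : S → Set W) : S.Modules where
  val := fracPresheaf G
  isSheaf := fracPresheafAb_isSheaf G

/-- The value in `W` of a section over an open subset containing the generic point. -/
noncomputable def fracVal (G : S → Set W) {V : S.Opens} (p : genericPoint S ∈ V) :
    Γ(fracSheaf G, V) →+ W where
  toFun f := (show fracSections G V from f).1 ⟨p⟩
  map_zero' := rfl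
  map_add' _ _ := rfl

variable {G : S → Set W} {V : S.Opens}

theorem fracVal_injective (p : genericPoint S ∈ V) : Function.Injective (fracVal G p) :=
  fun _ _ h => Subtype.ext (funext fun _ => h)

theorem fracVal_smul (p : genericPoint S ∈ V) (r : Γ(S, V)) (f : Γ(fracSheaf G, V)) :
    fracVal G p (r • f) = S.presheaf.germ V (genericPoint S) p r • fracVal G p f := rfl

theorem fracVal_mem (p : genericPoint S ∈ V) (f : Γ(fracSheaf G, V)) {x : S} (hx : x ∈ V) :
    fracVal G p f ∈ Submodule.span (localRing x) (G x) :=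
  (show fracSections G V from f).2 x hx p

/-- The section with a given value. -/
noncomputable def fracMk (G : S → Set W) (V : S.Opens) (w : W)
    (h : ∀ x ∈ V, w ∈ Submodule.span (localRing x) (G x)) : Γ(fracSheaf G, V) :=
  (⟨fun _ => w, fun x hx _ => h x hx⟩ : fracSections G V)

theorem fracVal_fracMk (p : genericPoint S ∈ V) (w : W) (h) :
    fracVal G p (fracMk G V w h) = w := rfl

theorem frac_ext {f g : Γ(fracSheaf G, V)} (h : ∀ p, fracVal G p f = fracVal G p g) : f = g :=
  Subtype.ext (funext fun p => h p.down)

/-- A constructor for morphisms of sheaves of modules. -/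
noncomputable def modulesHomMk {X : Scheme.{u}} {M N : X.Modules}
    (φ : ∀ V : X.Opens, Γ(M, V) →+ Γ(N, V))
    (hnat : ∀ {V V' : X.Opens} (i : V' ⟶ V) (m : Γ(M, V)),
      φ V' (M.presheaf.map i.op m) = N.presheaf.map i.op (φ V m))
    (hsmul : ∀ (V : X.Opens) (r : Γ(X, V)) (m : Γ(M, V)), φ V (r • m) = r • φ V m) : M ⟶ N where
  val := PresheafOfModules.homMk
    { app := fun V => AddCommGrpCat.ofHom (φ V.unop)
      naturality := fun V V' i => by
        ext m
        exact hnat i.unop m }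
    (fun V r m => hsmul V.unop r m)

/-- Inclusions of fractional sheaves. -/
noncomputable def fracHom {G G' : S → Set W}
    (h : ∀ x, ∀ w ∈ G x, w ∈ Submodule.span (localRing x) (G' x)) :
    fracSheaf G ⟶ fracSheaf G' :=
  modulesHomMk (M := fracSheaf G) (N := fracSheaf G')
    (fun V =>
      { toFun := fun f => (⟨(show fracSections G V from f).1, fun x hx p =>
          Submodule.span_le.mpr (h x) ((show fracSections G V from f).2 x hx p)⟩ :
            fracSections G' V)
        map_zero' := rfl
        map_add' := fun _ _ => rfl })
    (fun _ _ => rfl) (fun _ _ _ => rfl)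

theorem fracVal_fracHom {G G' : S → Set W} (h) (p : genericPoint S ∈ V)
    (f : Γ(fracSheaf G, V)) : fracVal G' p ((fracHom (G := G) (G' := G') h).app V f) =
      fracVal G p f := rfl

theorem mono_of_app_injective {X : Scheme.{u}} {M N : X.Modules} (f : M ⟶ N)
    (h : ∀ V, Function.Injective (f.app V)) : Mono f := by
  refine ⟨fun g k hgk => ?_⟩
  ext V x
  apply h V
  exact congr($(congrArg (fun z => Scheme.Modules.Hom.app z V) hgk) x)

instance {G G' : S → Set W} (h) : Mono (fracHom (G := G) (G' := G') h) :=
  mono_of_app_injective _ fun V _ _ e => frac_ext fun p => congrArg (fracVal G' p) e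

end FractionalSheaves

/-! ### Quasi-coherence from affine charts -/

/-- The restriction of a sheaf of modules to an open subset, in its two forms. -/
noncomputable def overIso {X : Scheme.{u}} (V : X.Opens) (M : X.Modules) :
    (Scheme.Modules.overEquiv V).inverse.obj ((Scheme.Modules.restrictFunctor V.ι).obj M) ≅
      (SheafOfModules.overFunctor X.ringCatSheaf V).obj M :=
  (Scheme.Modules.overEquiv V).inverse.mapIso ((Scheme.Modules.overFunctorEquiv V).app M).symm ≪≫
    (Scheme.Modules.overEquiv V).unitIso.symm.app _

noncomputable def overUnitIso {X : Scheme.{u}} (V : X.Opens) :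
    SheafOfModules.unit (X.ringCatSheaf.over V) ≅
      (Scheme.Modules.overEquiv V).inverse.obj (SheafOfModules.unit (V : Scheme.{u}).ringCatSheaf) :=
  ((Scheme.Modules.overEquiv V).inverse.mapIso (Scheme.Modules.restrictUnitIso V.ι).symm ≪≫
    overIso V (SheafOfModules.unit X.ringCatSheaf)).symm

noncomputable def presentationOver {X : Scheme.{u}} (V : X.Opens) (M : X.Modules)
    (pres : SheafOfModules.Presentation.{u} (R := (V : Scheme.{u}).ringCatSheaf)
      ((Scheme.Modules.restrictFunctor V.ι).obj M)) :
    SheafOfModules.Presentation.{u} (R := X.ringCatSheaf.over V)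
      ((SheafOfModules.overFunctor X.ringCatSheaf V).obj M) :=
  let F : SheafOfModules.{u} (V : Scheme.{u}).ringCatSheaf ⥤
      SheafOfModules.{u} (X.ringCatSheaf.over V) := (Scheme.Modules.overEquiv V).inverse
  haveI : Limits.PreservesColimitsOfSize.{u, u} F :=
    (Scheme.Modules.overEquiv V).symm.toAdjunction.leftAdjoint_preservesColimits
  @SheafOfModules.Presentation.ofIsIso.{u, u, u} _ _ _ _ _ _ _ _ (overIso V M).hom (Iso.isIso_hom (overIso V M))
    (pres.map F (overUnitIso V))

/-- A module sheaf of the form M~ on an affine scheme has a global presentation. It is carried along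
`isoSpec` to the open subscheme and then to the slice site over `V x`, where quasi-coherence is
defined. -/
theorem isQuasicoherent_of_restrict_fromSpec {X : Scheme.{u}} (M : X.Modules)
    (h : ∀ x : X, ∃ (V : X.Opens) (hV : IsAffineOpen V), x ∈ V ∧
      IsIso (M.restrict hV.fromSpec).fromTildeΓ) :
    SheafOfModules.IsQuasicoherent (R := X.ringCatSheaf) M := by
  choose V hV hx hM using h
  have key : ∀ x, Nonempty (SheafOfModules.Presentation.{u} (R := X.ringCatSheaf.over (V x))
      ((SheafOfModules.overFunctor X.ringCatSheaf (V x)).obj M)) := by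
    intro x
    refine ⟨presentationOver _ _ ?_⟩
    have := hM x
    let pres := 
      @SheafOfModules.Presentation.ofIsIso.{u, u, u} _ _ _ _ _ _ _ _ (M.restrict (hV x).fromSpec).fromTildeΓ (hM x)
        (presentationTilde.{u} _ .univ (by simp) _ (Submodule.span_eq _))
    let pres2 := Scheme.Modules.presentationRestrict (hV x).isoSpec.hom pres
    let iso : Scheme.Modules.restrictFunctor (hV x).fromSpec ⋙
        Scheme.Modules.restrictFunctor (hV x).isoSpec.hom ≅
        Scheme.Modules.restrictFunctor (V x).ι :=
      (Scheme.Modules.restrictFunctorComp _ _).symm ≪≫ Scheme.Modules.restrictFunctorCongr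
        (by simp)
    exact
      @SheafOfModules.Presentation.ofIsIso.{u, u, u} _ _ _ _ _ _ _ _ (iso.app M).hom (Iso.isIso_hom (iso.app M)) pres2
  refine SheafOfModules.QuasicoherentData.isQuasicoherent.{u} (R := X.ringCatSheaf) (M := M)
    { I := X, X := V, coversTop := ?_, presentation := fun x => (key x).some : SheafOfModules.QuasicoherentData.{u} (R := X.ringCatSheaf) M }
  rw [Opens.coversTop_iff]
  exact eq_top_iff.mpr fun x _ => Opens.mem_iSup.mpr ⟨x, hx x⟩

/-! ### Locally finitely generated families of lattices -/

section LocallyFG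

variable {S : Scheme.{u}} [IsIntegral S] {W : Type u} [AddCommGroup W] [Module S.functionField W]

/-- The ring of sections over `U`, as a subring of the function field. -/
noncomputable def sectionRing (U : S.Opens) (h : genericPoint S ∈ U) : Subring S.functionField :=
  (S.presheaf.germ U (genericPoint S) h).hom.range

theorem span_sectionRing_le {U : S.Opens} (h : genericPoint S ∈ U) {x : S} (hx : x ∈ U)
    {T : Set W} {w : W} (hw : w ∈ Submodule.span (sectionRing U h) T) :
    w ∈ Submodule.span (localRing x) T := by
  induction hw using Submodule.span_induction with
  | mem w hw => exact Submodule.subset_span hw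
  | zero => exact zero_mem _
  | add a b _ _ ha hb => exact add_mem ha hb
  | smul a w _ hw =>
    obtain ⟨_, r, rfl⟩ := a
    exact germ_smul_mem_span hx h r hw

/-- An element of the localization at a point is a fraction. -/
theorem exists_mul_mem_of_localRing {U : S.Opens} (hU : IsAffineOpen U) (h : genericPoint S ∈ U)
    (p : PrimeSpectrum Γ(S, U)) {a : S.functionField} (ha : a ∈ localRing (hU.fromSpec p)) :
    ∃ s r : Γ(S, U), s ∉ p.asIdeal ∧
      S.presheaf.germ U (genericPoint S) h s * a = S.presheaf.germ U (genericPoint S) h r := by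
  have hp : hU.fromSpec p ∈ U := by
    rw [← SetLike.mem_coe, ← hU.range_fromSpec]; exact ⟨p, rfl⟩
  obtain ⟨b, rfl⟩ := ha
  letI : Algebra Γ(S, U) (S.presheaf.stalk (hU.fromSpec p)) :=
    TopCat.Presheaf.algebra_section_stalk S.presheaf ⟨hU.fromSpec p, hp⟩
  have : IsLocalization.AtPrime (S.presheaf.stalk (hU.fromSpec p)) p.asIdeal :=
    hU.isLocalization_stalk' p hp
  obtain ⟨⟨r, s⟩, hrs⟩ := IsLocalization.surj p.asIdeal.primeCompl b
  refine ⟨s, r, s.2, ?_⟩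
  rw [← algebraMap_germ_genericPoint hp h, ← algebraMap_germ_genericPoint hp h, ← map_mul]
  refine congrArg _ ?_
  rw [mul_comm]
  exact hrs

/-- The functions g with g w in the span over the section ring form an ideal. If a prime p above it
omitted f, then w would lie in the local span at p, and clearing denominators would produce an
element of the ideal outside p. Hence f is in the radical. -/
theorem exists_pow_smul_mem_span_sectionRing {U : S.Opens} (hU : IsAffineOpen U)
    (h : genericPoint S ∈ U) (T : Set W) (f : Γ(S, U)) (w : W)
    (hw : ∀ y ∈ S.basicOpen f, w ∈ Submodule.span (localRing y) T) :
    ∃ n : ℕ, S.presheaf.germ U (genericPoint S) h f ^ n • w ∈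
      Submodule.span (sectionRing U h) T := by
  let φ := (S.presheaf.germ U (genericPoint S) h).hom
  have key : ∀ (r : Γ(S, U)) {v : W}, v ∈ Submodule.span (sectionRing U h) T →
      φ r • v ∈ Submodule.span (sectionRing U h) T := fun r v hv =>
    Submodule.smul_mem _ (⟨φ r, r, rfl⟩ : sectionRing U h) hv
  let I : Ideal Γ(S, U) :=
    { carrier := {g | φ g • w ∈ Submodule.span (sectionRing U h) T}
      zero_mem' := by simp
      add_mem' := fun {a b} ha hb => by
        change φ (a + b) • w ∈ Submodule.span (sectionRing U h) T
        rw [map_add, add_smul]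
        exact add_mem ha hb
      smul_mem' := fun c a ha => by
        change φ (c * a) • w ∈ Submodule.span (sectionRing U h) T
        rw [map_mul, mul_smul]
        exact key c ha }
  suffices hf : f ∈ I.radical by
    obtain ⟨n, hn⟩ := hf
    exact ⟨n, by rw [← map_pow]; exact hn⟩
  rw [Ideal.radical_eq_sInf, Ideal.mem_sInf]
  rintro p ⟨hIp, hp⟩
  by_contra hfp
  have hy : hU.fromSpec ⟨p, hp⟩ ∈ S.basicOpen f := by
    have : (⟨p, hp⟩ : PrimeSpectrum Γ(S, U)) ∈ hU.fromSpec ⁻¹ᵁ S.basicOpen f := by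
      rw [hU.fromSpec_preimage_basicOpen]
      exact hfp
    exact this
  have main : ∀ v ∈ Submodule.span (localRing (hU.fromSpec ⟨p, hp⟩)) T,
      ∃ s ∉ p, φ s • v ∈ Submodule.span (sectionRing U h) T := by
    intro v hv
    induction hv using Submodule.span_induction with
    | mem v hv =>
      exact ⟨1, (Ideal.ne_top_iff_one p).mp hp.ne_top, by
        rw [map_one, one_smul]; exact Submodule.subset_span hv⟩
    | zero => exact ⟨1, (Ideal.ne_top_iff_one p).mp hp.ne_top, by simp⟩
    | add a b _ _ ha hb =>
      obtain ⟨s, hs, has⟩ := ha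
      obtain ⟨t, ht, hbt⟩ := hb
      refine ⟨s * t, fun hst => (hp.mem_or_mem hst).elim hs ht, ?_⟩
      rw [smul_add]
      refine add_mem ?_ ?_
      · rw [mul_comm, map_mul, mul_smul]
        exact key t has
      · rw [map_mul, mul_smul]
        exact key s hbt
    | smul a v _ hv =>
      obtain ⟨s, hs, hvs⟩ := hv
      obtain ⟨t, r, ht, htr⟩ := exists_mul_mem_of_localRing hU h ⟨p, hp⟩ a.2
      refine ⟨t * s, fun hst => (hp.mem_or_mem hst).elim ht hs, ?_⟩
      have e : φ (t * s) • (a • v) = φ r • φ s • v := by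
        change φ (t * s) • (a.1 • v) = _
        rw [smul_smul, smul_smul]
        congr 1
        rw [map_mul, mul_right_comm]
        exact congrArg (· * φ s) htr
      rw [e]
      exact key r hvs
  obtain ⟨s, hs, hsw⟩ := main w (hw _ hy)
  exact hs (hIp hsw)

/-- The family of generators `G` is locally given by a finite set. -/
def IsLocallyFG (G : S → Set W) : Prop :=
  ∀ x : S, ∃ (U : S.Opens) (T : Set W), IsAffineOpen U ∧ x ∈ U ∧ T.Finite ∧
    ∀ y ∈ U, Submodule.span (localRing y) (G y) = Submodule.span (localRing y) T

theorem IsLocallyFG.exists_basicOpen {G : S → Set W} (hG : IsLocallyFG G) {V : S.Opens}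
    (hV : IsAffineOpen V) {x : S} (hx : x ∈ V) :
    ∃ (g : Γ(S, V)) (T : Set W), x ∈ S.basicOpen g ∧ T.Finite ∧ ∀ y ∈ S.basicOpen g,
      Submodule.span (localRing y) (G y) = Submodule.span (localRing y) T := by
  obtain ⟨U, T, hU, hxU, hT, h⟩ := hG x
  obtain ⟨g, hg, hxg⟩ := hV.exists_basicOpen_le ⟨x, hxU⟩ hx
  exact ⟨g, T, hxg, hT, fun y hy => h y (hg hy)⟩

theorem pow_smul_mem_span_of_le {x : S} {V : S.Opens} (hx : x ∈ V) (h : genericPoint S ∈ V)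
    {G : Set W} (f : Γ(S, V)) {m n : ℕ} (hmn : m ≤ n) {w : W}
    (hw : S.presheaf.germ V (genericPoint S) h f ^ m • w ∈ Submodule.span (localRing x) G) :
    S.presheaf.germ V (genericPoint S) h f ^ n • w ∈ Submodule.span (localRing x) G := by
  obtain ⟨k, rfl⟩ := Nat.exists_eq_add_of_le hmn
  rw [add_comm, pow_add, mul_smul, ← map_pow]
  exact germ_smul_mem_span hx h _ hw

/-- Near each point the family is the span of one finite set, so the previous estimate applies
there; quasi-compactness of `V` allows one exponent for all points. -/
theorem IsLocallyFG.exists_pow_smul_mem {G : S → Set W} (hG : IsLocallyFG G) {V : S.Opens}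
    (hV : IsAffineOpen V) (h : genericPoint S ∈ V) (f : Γ(S, V)) (w : W)
    (hw : ∀ y ∈ S.basicOpen f, w ∈ Submodule.span (localRing y) (G y)) :
    ∃ n : ℕ, ∀ y ∈ V, S.presheaf.germ V (genericPoint S) h f ^ n • w ∈
      Submodule.span (localRing y) (G y) := by
  refine IsCompact.induction_on (p := fun U : Set S => ∃ n : ℕ, ∀ y ∈ V, y ∈ U →
    S.presheaf.germ V (genericPoint S) h f ^ n • w ∈ Submodule.span (localRing y) (G y))
    hV.isCompact ⟨0, fun y _ hy => hy.elim⟩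
    (fun s t hst ⟨n, hn⟩ => ⟨n, fun y hy hys => hn y hy (hst hys)⟩)
    (fun s t ⟨m, hm⟩ ⟨n, hn⟩ => ⟨max m n, fun y hy hys => hys.elim
      (fun h1 => pow_smul_mem_span_of_le hy h f (le_max_left m n) (hm y hy h1))
      (fun h1 => pow_smul_mem_span_of_le hy h f (le_max_right m n) (hn y hy h1))⟩)
    (fun x hx => ?_) |>.imp fun n hn y hy => hn y hy hy
  obtain ⟨g, T, hxg, -, hT⟩ := hG.exists_basicOpen hV hx
  refine ⟨S.basicOpen g, mem_nhdsWithin_of_mem_nhds ((S.basicOpen g).isOpen.mem_nhds hxg), ?_⟩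
  have hξ := genericPoint_mem hxg
  let i : op V ⟶ op (S.basicOpen g) := (homOfLE (S.basicOpen_le g)).op
  obtain ⟨n, hn⟩ := exists_pow_smul_mem_span_sectionRing (hV.basicOpen g) hξ T
    (S.presheaf.map i f) w (fun y hy => by
      rw [S.basicOpen_res] at hy
      rw [← hT y hy.1]
      exact hw y hy.2)
  refine ⟨n, fun y _ hy => ?_⟩
  rw [hT y hy]
  have := span_sectionRing_le hξ hy hn
  rwa [germ_res i hξ f] at this

theorem span_eq_of_smul_eq {x : S} {T Z : Set W} {a : S.functionField} (ha : a ∈ localRing x)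
    (hinv : a⁻¹ ∈ localRing x) (h0 : a ≠ 0)
    (h1 : ∀ t ∈ T, a • t ∈ Submodule.span (localRing x) Z) :
    ∀ t ∈ T, t ∈ Submodule.span (localRing x) Z := by
  intro t ht
  have := Submodule.smul_mem _ (⟨a⁻¹, hinv⟩ : localRing x) (h1 t ht)
  change a⁻¹ • a • t ∈ _ at this
  rwa [smul_smul, inv_mul_cancel₀ h0, one_smul] at this

theorem inv_germ_mem_localRing {V : S.Opens} (h : genericPoint S ∈ V) {f : Γ(S, V)} {y : S}
    (hy : y ∈ S.basicOpen f) : (S.presheaf.germ V (genericPoint S) h f)⁻¹ ∈ localRing y := by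
  have hyV : y ∈ V := S.basicOpen_le f hy
  obtain ⟨b, hb⟩ := ((S.mem_basicOpen f y hyV).mp hy).exists_right_inv
  refine ⟨b, ?_⟩
  rw [← algebraMap_germ_genericPoint hyV h]
  refine eq_inv_of_mul_eq_one_right ?_
  rw [← map_mul, hb, map_one]

theorem germ_ne_zero_of_mem_basicOpen {V : S.Opens} (h : genericPoint S ∈ V) {f : Γ(S, V)} {y : S}
    (hy : y ∈ S.basicOpen f) : S.presheaf.germ V (genericPoint S) h f ≠ 0 := by
  rw [← algebraMap_germ_genericPoint (S.basicOpen_le f hy) h]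
  exact (((S.mem_basicOpen f y (S.basicOpen_le f hy)).mp hy).map _).ne_zero

/-- Over an affine open subset, a locally finitely generated fractional sheaf is generated by
finitely many global sections. -/
theorem IsLocallyFG.exists_generators {G : S → Set W} (hG : IsLocallyFG G) {V : S.Opens}
    (hV : IsAffineOpen V) (h : genericPoint S ∈ V) :
    ∃ Z : Set W, Z.Finite ∧ ∀ y ∈ V,
      Submodule.span (localRing y) (G y) = Submodule.span (localRing y) Z := by
  suffices hZ : ∃ Z : Set W, Z.Finite ∧
      (∀ z ∈ Z, ∀ y ∈ V, z ∈ Submodule.span (localRing y) (G y)) ∧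
      ∀ y ∈ V, y ∈ (V : Set S) → G y ⊆ Submodule.span (localRing y) Z by
    obtain ⟨Z, hZ, h1, h2⟩ := hZ
    exact ⟨Z, hZ, fun y hy => le_antisymm (Submodule.span_le.mpr (h2 y hy hy))
      (Submodule.span_le.mpr fun z hz => h1 z hz y hy)⟩
  refine IsCompact.induction_on (p := fun U : Set S => ∃ Z : Set W, Z.Finite ∧
      (∀ z ∈ Z, ∀ y ∈ V, z ∈ Submodule.span (localRing y) (G y)) ∧
      ∀ y ∈ V, y ∈ U → G y ⊆ Submodule.span (localRing y) Z) hV.isCompact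
    ⟨∅, Set.finite_empty, fun _ hz => hz.elim, fun _ _ hy => hy.elim⟩
    (fun s t hst ⟨Z, hZ, h1, h2⟩ => ⟨Z, hZ, h1, fun y hy hys => h2 y hy (hst hys)⟩)
    (fun s t ⟨Z, hZ, h1, h2⟩ ⟨Z', hZ', h1', h2'⟩ => ⟨Z ∪ Z', hZ.union hZ',
      fun z hz => hz.elim (h1 z) (h1' z), fun y hy hys => hys.elim
        (fun h => (h2 y hy h).trans (Submodule.span_mono Set.subset_union_left))
        (fun h => (h2' y hy h).trans (Submodule.span_mono Set.subset_union_right))⟩)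
    (fun x hx => ?_)
  obtain ⟨g, T, hxg, hTf, hT⟩ := hG.exists_basicOpen hV hx
  have hex : ∀ t ∈ T, ∃ n : ℕ, ∀ y ∈ V, S.presheaf.germ V (genericPoint S) h g ^ n • t ∈
      Submodule.span (localRing y) (G y) := fun t ht =>
    hG.exists_pow_smul_mem hV h g t fun y hy => by
      rw [hT y hy]
      exact Submodule.subset_span ht
  choose! n hn using hex
  let γ := S.presheaf.germ V (genericPoint S) h g
  -- A power of `g` turns each local generator into a section over all of `V`. Since `g` is a unit
  -- on its basic open set, the local spans there do not change.
  refine ⟨S.basicOpen g, mem_nhdsWithin_of_mem_nhds ((S.basicOpen g).isOpen.mem_nhds hxg),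
    (fun t => γ ^ n t • t) '' T, hTf.image _, ?_, fun y hy hyg => ?_⟩
  · rintro _ ⟨t, ht, rfl⟩ y hy
    exact hn t ht y hy
  · refine Submodule.span_le.mp ?_
    rw [hT y hyg]
    refine Submodule.span_le.mpr fun t ht => ?_
    refine span_eq_of_smul_eq (T := {t}) (a := γ ^ n t)
      (pow_mem (germ_mem_localRing hy h g) _) ?_ (pow_ne_zero _ (germ_ne_zero_of_mem_basicOpen h hyg))
      ?_ t rfl
    · rw [← inv_pow]
      exact pow_mem (inv_germ_mem_localRing h hyg) _
    · rintro _ rfl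
      exact Submodule.subset_span ⟨_, ht, rfl⟩

/-- If `w` lies in all the local modules of `V`, it is a combination of the generators. -/
theorem mem_span_sectionRing {U : S.Opens} (hU : IsAffineOpen U)
    (h : genericPoint S ∈ U) (T : Set W) (w : W)
    (hw : ∀ y ∈ U, w ∈ Submodule.span (localRing y) T) :
    w ∈ Submodule.span (sectionRing U h) T := by
  obtain ⟨n, hn⟩ := exists_pow_smul_mem_span_sectionRing hU h T 1 w
    (fun y hy => hw y (S.basicOpen_le _ hy))
  rwa [map_one, one_pow, one_smul] at hn

theorem IsLocallyFG.finite_sections {G : S → Set W} (hG : IsLocallyFG G) {V : S.Opens}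
    (hV : IsAffineOpen V) : Module.Finite Γ(S, V) Γ(fracSheaf G, V) := by
  by_cases h : genericPoint S ∈ V
  · obtain ⟨Z, hZf, hZ⟩ := hG.exists_generators hV h
    have hmem : ∀ z ∈ Z, ∀ x ∈ V, z ∈ Submodule.span (localRing x) (G x) := fun z hz x hx => by
      rw [hZ x hx]; exact Submodule.subset_span hz
    let s : Z → Γ(fracSheaf G, V) := fun z => fracMk G V z.1 (hmem z z.2)
    have := hZf.to_subtype
    refine Module.finite_def.mpr ?_
    rw [← (eq_top_iff (a := Submodule.span Γ(S, V) (Set.range s))).mpr ?_]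
    · exact Submodule.fg_span (Set.finite_range s)
    intro f _
    have hf : fracVal G h f ∈ Submodule.span (sectionRing V h) Z :=
      mem_span_sectionRing hV h Z _ fun y hy => by
        rw [← hZ y hy]; exact fracVal_mem h f hy
    have key : ∀ w ∈ Submodule.span (sectionRing V h) Z,
        ∃ f ∈ Submodule.span Γ(S, V) (Set.range s), fracVal G h f = w := by
      intro w hw
      induction hw using Submodule.span_induction with
      | mem w hw => exact ⟨s ⟨w, hw⟩, Submodule.subset_span ⟨_, rfl⟩, rfl⟩
      | zero => exact ⟨0, zero_mem _, map_zero _⟩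
      | add a b _ _ ha hb =>
        obtain ⟨f, hf, rfl⟩ := ha
        obtain ⟨g, hg, rfl⟩ := hb
        exact ⟨f + g, add_mem hf hg, map_add _ _ _⟩
      | smul a w _ hw =>
        obtain ⟨_, r, rfl⟩ := a
        obtain ⟨f, hf, rfl⟩ := hw
        exact ⟨r • f, Submodule.smul_mem _ _ hf, fracVal_smul h r f⟩
    obtain ⟨g, hg, hgf⟩ := key _ hf
    rwa [← fracVal_injective h hgf]
  · have : Subsingleton Γ(fracSheaf G, V) := ⟨fun f g => frac_ext fun p => (h p).elim⟩
    infer_instance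

end LocallyFG

/-! ### Coherence of the lattice sheaves -/

section

variable {S : Scheme.{u}} [IsIntegral S] {W : Type u} [AddCommGroup W] [Module S.functionField W]

theorem appIso_inv_fromSpec {V : S.Opens} (hV : IsAffineOpen V) (U : (Spec Γ(S, V)).Opens)
    (h : hV.fromSpec ''ᵁ U ≤ V) :
    (Scheme.ΓSpecIso Γ(S, V)).inv ≫ (Spec Γ(S, V)).presheaf.map U.leTop.op ≫
      (hV.fromSpec.appIso U).inv = S.presheaf.map (homOfLE h).op := by
  have h2 : U ≤ hV.fromSpec ⁻¹ᵁ V := by rw [hV.fromSpec_preimage_self]; exact le_top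
  have := hV.fromSpec.appLE_appIso_inv (U := V) (V := U) h2
  rw [← this, Scheme.Hom.appLE, hV.fromSpec_app_self]
  simp only [Category.assoc, ← Functor.map_comp_assoc]
  rfl

theorem fracVal_restrict_smul {G : S → Set W} {V : S.Opens} (hV : IsAffineOpen V)
    (h : genericPoint S ∈ V) (U : (Spec Γ(S, V)).Opens)
    (p : genericPoint S ∈ hV.fromSpec ''ᵁ U) (r : Γ(S, V))
    (x : Γ((fracSheaf G).restrict hV.fromSpec, U)) :
    fracVal G p (show Γ(fracSheaf G, hV.fromSpec ''ᵁ U) from r • x) =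
      S.presheaf.germ V (genericPoint S) h r •
        fracVal G p (show Γ(fracSheaf G, hV.fromSpec ''ᵁ U) from x) := by
  have hle : hV.fromSpec ''ᵁ U ≤ V := by
    rw [← SetLike.coe_subset_coe]
    refine (Set.image_subset_range _ _).trans hV.range_fromSpec.subset
  have e := congr($(appIso_inv_fromSpec hV U hle) r)
  have h1 : fracVal G p (show Γ(fracSheaf G, hV.fromSpec ''ᵁ U) from r • x) =
    S.presheaf.germ _ (genericPoint S) p ((hV.fromSpec.appIso U).inv
      ((Spec Γ(S, V)).presheaf.map U.leTop.op ((Scheme.ΓSpecIso Γ(S, V)).inv r))) •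
        fracVal G p (show Γ(fracSheaf G, hV.fromSpec ''ᵁ U) from x) := rfl
  rw [h1, ← germ_res (homOfLE hle).op p r]
  exact congrArg (fun t => S.presheaf.germ _ (genericPoint S) p t • _) e

theorem fracVal_restrict_pow_smul {G : S → Set W} {V : S.Opens} (hV : IsAffineOpen V)
    (h : genericPoint S ∈ V) (U : (Spec Γ(S, V)).Opens)
    (p : genericPoint S ∈ hV.fromSpec ''ᵁ U) (r : Γ(S, V)) (n : ℕ)
    (x : Γ((fracSheaf G).restrict hV.fromSpec, U)) :
    fracVal G p (show Γ(fracSheaf G, hV.fromSpec ''ᵁ U) from r ^ n • x) =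
      S.presheaf.germ V (genericPoint S) h r ^ n •
        fracVal G p (show Γ(fracSheaf G, hV.fromSpec ''ᵁ U) from x) := by
  rw [fracVal_restrict_smul hV h, map_pow]

/-- Sections over D(r) extend after multiplication by a power of r, by `exists_pow_smul_mem`. A
section that vanishes on a nonempty D(r) is already zero, since sections are vectors; if D(r) is
empty, then r = 0 and the exponent 1 kills everything. -/
theorem IsLocallyFG.isLocalizing {G : S → Set W} (hG : IsLocallyFG G) {V : S.Opens}
    (hV : IsAffineOpen V) (h : genericPoint S ∈ V) :
    IsLocalizing (modulesSpecToSheaf.obj ((fracSheaf G).restrict hV.fromSpec)) := by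
  intro r
  have hU : hV.fromSpec ''ᵁ (PrimeSpectrum.basicOpen r) = S.basicOpen r :=
    hV.fromSpec_image_basicOpen r
  have hT : hV.fromSpec ''ᵁ ⊤ = V := by
    rw [Scheme.Hom.image_top_eq_opensRange, hV.opensRange_fromSpec]
  have pT : genericPoint S ∈ hV.fromSpec ''ᵁ ⊤ := by rwa [hT]
  refine IsLocalizedModule.Away.mk_of_addCommGroup
    (Scheme.Modules.isUnit_algebraMap_end_of_le_basicOpen r le_rfl) ?_ ?_
  · intro x
    change Γ(fracSheaf G, hV.fromSpec ''ᵁ (PrimeSpectrum.basicOpen r)) at x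
    by_cases p : genericPoint S ∈ hV.fromSpec ''ᵁ (PrimeSpectrum.basicOpen r)
    · obtain ⟨n, hn⟩ := hG.exists_pow_smul_mem hV h r (fracVal G p x) fun y hy =>
        fracVal_mem p x (by rwa [hU])
      refine ⟨n, fracMk G (hV.fromSpec ''ᵁ ⊤) _ fun y hy => hn y (by rwa [hT] at hy), ?_⟩
      refine frac_ext (V := hV.fromSpec ''ᵁ (PrimeSpectrum.basicOpen r)) fun p => ?_
      exact fracVal_restrict_pow_smul hV h _ p r n x
    · exact ⟨0, 0, frac_ext (V := hV.fromSpec ''ᵁ (PrimeSpectrum.basicOpen r))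
        fun q => (p q).elim⟩
  · intro x hx
    change Γ(fracSheaf G, hV.fromSpec ''ᵁ ⊤) at x
    by_cases p : genericPoint S ∈ hV.fromSpec ''ᵁ (PrimeSpectrum.basicOpen r)
    · refine ⟨0, frac_ext (V := hV.fromSpec ''ᵁ ⊤) fun q => ?_⟩
      refine (fracVal_restrict_pow_smul hV h _ q r 0 x).trans ?_
      rw [pow_zero, one_smul]
      refine Eq.trans ?_ (map_zero (fracVal G q)).symm
      have := congrArg (fracVal G (V := hV.fromSpec ''ᵁ (PrimeSpectrum.basicOpen r)) p) hx
      exact this.trans (map_zero (fracVal G (V := hV.fromSpec ''ᵁ (PrimeSpectrum.basicOpen r)) p))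
    · refine ⟨1, frac_ext (V := hV.fromSpec ''ᵁ ⊤) fun q => ?_⟩
      refine (fracVal_restrict_pow_smul hV h _ q r 1 x).trans ?_
      have h0 : S.presheaf.germ V (genericPoint S) h r = 0 := by
        by_contra hne
        refine p ?_
        rw [hU, S.mem_basicOpen r _ h, isUnit_iff_ne_zero]
        exact hne
      rw [h0, pow_one, zero_smul]
      exact (map_zero (fracVal G q)).symm

theorem IsLocallyFG.isCoherent {G : S → Set W} (hG : IsLocallyFG G) :
    IsCoherent (fracSheaf G) := by
  refine ⟨isQuasicoherent_of_restrict_fromSpec _ fun x => ?_, fun V hV => hG.finite_sections hV⟩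
  obtain ⟨U, -, hU, hx, -⟩ := hG x
  exact ⟨U, hU, hx, (isIso_fromTildeΓ_iff_isLocalizing _).mpr
    (hG.isLocalizing hU (genericPoint_mem hx))⟩

end

/-- Over `V` the projection to the cokernel is zero, and it stays an epimorphism after restriction
to `V`. So the restricted cokernel is zero, and with it the stalk. -/
theorem not_mem_moduleSupport_cokernel {X : Scheme.{u}} {M N : X.Modules} (f : M ⟶ N) {x : X}
    {V : X.Opens} (hx : x ∈ V) (h : ∀ V' ≤ V, Function.Surjective (f.app V')) :
    x ∉ moduleSupport (Limits.cokernel f) := by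
  let π := Limits.cokernel.π f
  have h0 : ∀ V' ≤ V, ∀ n : Γ(N, V'), π.app V' n = 0 := by
    intro V' hV' n
    obtain ⟨m, rfl⟩ := h V' hV' n
    have := congrArg (fun z => Scheme.Modules.Hom.app z V') (Limits.cokernel.condition f)
    exact congr($this m)
  have h1 : (Scheme.Modules.restrictFunctor V.ι).map π = 0 := by
    ext V' n
    exact h0 (V.ι ''ᵁ V') (by simpa using V.ι_image_le V') n
  have h2 : 𝟙 ((Scheme.Modules.restrictFunctor V.ι).obj (Limits.cokernel f)) = 0 := by
    rw [← cancel_epi ((Scheme.Modules.restrictFunctor V.ι).map π), h1, Limits.zero_comp, Limits.zero_comp]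
  have h3 : ∀ V' ≤ V, ∀ s : Γ(Limits.cokernel f, V'), s = 0 := by
    intro V' hV' s
    have e : V.ι ''ᵁ (V.ι ⁻¹ᵁ V') = V' := by
      rw [V.ι.image_preimage_eq_opensRange_inf, V.opensRange_ι]
      exact inf_eq_right.mpr hV'
    have := congrArg (fun z => Scheme.Modules.Hom.app z (V.ι ⁻¹ᵁ V')) h2
    have h4 : ∀ s : Γ(Limits.cokernel f, V.ι ''ᵁ (V.ι ⁻¹ᵁ V')), s = 0 := fun s => congr($this s)
    rw [e] at h4
    exact h4 s
  intro hs
  obtain ⟨a, b, hab⟩ := hs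
  refine hab ?_
  have h5 : ∀ a : (Limits.cokernel f).presheaf.stalk x, a = 0 := by
    intro a
    obtain ⟨U, hU, s, rfl⟩ := TopCat.Presheaf.exists_germ_eq _ a
    have hUV : x ∈ U ⊓ V := ⟨hU, hx⟩
    refine (TopCat.Presheaf.germ_res_apply _ (homOfLE (inf_le_left : U ⊓ V ≤ U)) x hUV s).symm.trans ?_
    refine (congrArg _ (h3 (U ⊓ V) inf_le_right _)).trans (map_zero _)
  rw [h5 a, h5 b]

/-! ### The twist by an ideal sheaf -/

section Twist

variable {S : Scheme.{u}} {Z : Scheme.{u}} (N : S.Modules) (i : Z ⟶ S)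

/-- The section `n ⊗ f` of the presheaf `N ⊗ I`. -/
noncomputable def twistTmul {V : S.Opens} (n : Γ(N, V)) (f : Γ(S, V)) (hf : i.app V f = 0) :
    (twistPresheaf N i).obj (op V) :=
  show (ModuleCat.of Γ(S, V) (Γ(N, V) ⊗[Γ(S, V)] (RingHom.ker (i.app V).hom))) from
    TensorProduct.tmul Γ(S, V) n ⟨f, hf⟩

/-- The map from the presheaf `N ⊗ I` to its sheafification. -/
noncomputable def twistUnit (V : S.Opens) :
    ((twistPresheaf N i).presheaf.obj (op V)) ⟶ Γ(twist N i, V) :=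
  (CategoryTheory.toSheafify (Opens.grothendieckTopology S) (twistPresheaf N i).presheaf).app (op V)

theorem twistι_twistUnit {V : S.Opens} (p : (twistPresheaf N i).obj (op V)) :
    (twistι N i).app V (twistUnit N i V p) = (twistPresheafι N i).app (op V) p := by
  have h := PresheafOfModules.toPresheaf_map_sheafificationHomEquiv_def (𝟙 S.ringCatSheaf.obj)
    (P := twistPresheaf N i) (F := N) (twistι N i)
  have h2 : PresheafOfModules.sheafificationHomEquiv (𝟙 S.ringCatSheaf.obj) (twistι N i) =
      twistPresheafι N i :=
    (PresheafOfModules.sheafificationAdjunction_homEquiv_apply (𝟙 S.ringCatSheaf.obj)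
      (twistι N i)).symm.trans (Equiv.apply_symm_apply
        ((PresheafOfModules.sheafificationAdjunction (𝟙 S.ringCatSheaf.obj)).homEquiv _ N) _)
  rw [h2] at h
  exact congr((NatTrans.app $h (op V)) p).symm

theorem twistPresheafι_tmul {V : S.Opens} (n : Γ(N, V)) (f : Γ(S, V)) (hf : i.app V f = 0) :
    (twistPresheafι N i).app (op V) (twistTmul N i n f hf) = f • n := 
  rfl

/-- When the ideal of sections is principal, a generator can be collected in the second factor, so
every tensor is pure. No freeness of the ideal is needed. -/
theorem exists_twistTmul {V : S.Opens} (f : Γ(S, V))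
    (hf : RingHom.ker (i.app V).hom = Ideal.span {f}) (hf' : i.app V f = 0)
    (p : (twistPresheaf N i).obj (op V)) : ∃ n : Γ(N, V), p = twistTmul N i n f hf' := by
  change (Γ(N, V) ⊗[Γ(S, V)] (RingHom.ker (i.app V).hom)) at p
  change ∃ n : Γ(N, V), p = TensorProduct.tmul Γ(S, V) n ⟨f, hf'⟩
  induction p using TensorProduct.induction_on with
  | zero => exact ⟨0, (TensorProduct.zero_tmul _ _).symm⟩
  | tmul n t =>
    obtain ⟨t, ht⟩ := t
    have ht' := ht
    rw [hf, Ideal.mem_span_singleton'] at ht'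
    obtain ⟨a, rfl⟩ := ht'
    exact ⟨a • n, (TensorProduct.smul_tmul a n
      (⟨f, hf'⟩ : RingHom.ker (i.app V).hom)).symm⟩
  | add x y hx hy =>
    obtain ⟨a, rfl⟩ := hx
    obtain ⟨b, rfl⟩ := hy
    exact ⟨a + b, (TensorProduct.add_tmul _ _ _).symm⟩

/-- Locally, the ideal sheaf of `i` is generated by a nonzero function. -/
def IsLocallyPrincipal [IsIntegral S] : Prop :=
  ∀ (x : S) (U : S.Opens), x ∈ U → ∃ (V : S.Opens) (f : Γ(S, V)), V ≤ U ∧ x ∈ V ∧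
    RingHom.ker (i.app V).hom = Ideal.span {f} ∧ ∀ p, S.presheaf.germ V (genericPoint S) p f ≠ 0

theorem exists_twistUnit_eq {V : S.Opens} (s : Γ(twist N i, V)) {x : S} (hx : x ∈ V) :
    ∃ (V' : S.Opens) (j : V' ⟶ V) (p : (twistPresheaf N i).obj (op V')), x ∈ V' ∧
      twistUnit N i V' p = (twist N i).presheaf.map j.op s := by
  have h := Presheaf.imageSieve_mem (Opens.grothendieckTopology S)
    (CategoryTheory.toSheafify (Opens.grothendieckTopology S) (twistPresheaf N i).presheaf) (U := op V) s
  obtain ⟨V', j, ⟨p, hp⟩, hV'⟩ := h x hx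
  exact ⟨V', j, p, hV', hp⟩

theorem twistUnit_map {V V' : S.Opens} (j : V' ⟶ V) (p : (twistPresheaf N i).obj (op V)) :
    twistUnit N i V' ((twistPresheaf N i).presheaf.map j.op p) =
      (twist N i).presheaf.map j.op (twistUnit N i V p) :=
  congr($((CategoryTheory.toSheafify (Opens.grothendieckTopology S)
    (twistPresheaf N i).presheaf).naturality j.op) p)

/-- Locally a section of the twist comes from n ⊗ f with f a generator of the ideal, and its image
is f n. In a vector space over the function field, f n = 0 with f ≠ 0 forces n = 0. -/
theorem mono_twistι [IsIntegral S] {W : Type u} [AddCommGroup W] [Module S.functionField W]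
    (G : S → Set W) (hi : IsLocallyPrincipal i) : Mono (twistι (fracSheaf G) i) := by
  refine mono_of_app_injective _ fun V => ?_
  suffices h : ∀ s, (twistι (fracSheaf G) i).app V s = 0 → s = 0 by
    intro a b hab
    rw [← sub_eq_zero]
    apply h
    rw [map_sub, hab, sub_self]
  intro s hs
  have key : ∀ x ∈ V, ∃ (V' : S.Opens) (j : V' ⟶ V), x ∈ V' ∧
      (twist (fracSheaf G) i).presheaf.map j.op s = 0 := by
    intro x hx
    obtain ⟨V', j, p, hxV', hp⟩ := exists_twistUnit_eq _ i s hx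
    obtain ⟨V₂, f, hle, hxV₂, hf, hf0⟩ := hi x V' hxV'
    have hf' : i.app V₂ f = 0 := by
      have : f ∈ RingHom.ker (i.app V₂).hom := hf ▸ Ideal.mem_span_singleton_self f
      exact this
    let k : V₂ ⟶ V' := homOfLE hle
    obtain ⟨n, hn⟩ := exists_twistTmul (fracSheaf G) i f hf hf'
      ((twistPresheaf (fracSheaf G) i).presheaf.map k.op p)
    have h1 : twistUnit (fracSheaf G) i V₂ (twistTmul (fracSheaf G) i n f hf') =
        (twist (fracSheaf G) i).presheaf.map (k ≫ j).op s := by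
      rw [← hn, twistUnit_map, hp, op_comp, Functor.map_comp]
      rfl
    have h2 : f • n = 0 := by
      rw [← twistPresheafι_tmul (fracSheaf G) i n f hf', ← twistι_twistUnit, h1]
      have := congr($((twistι (fracSheaf G) i).mapPresheaf.naturality (k ≫ j).op) s)
      exact this.trans ((congrArg ((fracSheaf G).presheaf.map (k ≫ j).op) hs).trans
        (map_zero ((fracSheaf G).presheaf.map (k ≫ j).op).hom))
    have h3 : n = 0 := frac_ext fun p => by
      have := congrArg (fracVal G p) h2
      rw [fracVal_smul, map_zero] at this
      rw [map_zero]
      exact (smul_eq_zero.mp this).resolve_left (hf0 p)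
    refine ⟨V₂, k ≫ j, hxV₂, ?_⟩
    rw [← h1, h3]
    have : twistTmul (fracSheaf G) i 0 f hf' = 0 := TensorProduct.zero_tmul _ _
    rw [this]
    exact map_zero _
  choose U j hU hs0 using key
  refine TopCat.Sheaf.eq_of_locally_eq' ⟨(twist (fracSheaf G) i).presheaf, (twist (fracSheaf G) i).isSheaf⟩
    (fun x : V => U x x.2) V (fun x => j x x.2) (fun x hx => ?_) s 0 fun x => ?_
  · exact Opens.mem_iSup.mpr ⟨⟨x, hx⟩, hU x hx⟩
  · exact (hs0 x x.2).trans (map_zero _).symm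

end Twist

/-! ### Semilinear maps and their factorization through a twist -/

section Pushforward

variable {S : Scheme.{u}}

theorem modules_section_ext (N : S.Modules) {V : S.Opens} (s t : Γ(N, V))
    (h : ∀ x ∈ V, ∃ (V' : S.Opens) (j : V' ⟶ V), x ∈ V' ∧
      N.presheaf.map j.op s = N.presheaf.map j.op t) : s = t := by
  choose U j hU hs0 using h
  refine TopCat.Sheaf.eq_of_locally_eq' ⟨N.presheaf, N.isSheaf⟩
    (fun x : V => U x x.2) V (fun x => j x x.2) (fun x hx => ?_) s t fun x => hs0 x x.2
  exact Opens.mem_iSup.mpr ⟨⟨x, hx⟩, hU x hx⟩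

/-- The adjoint of `ψ` dies in the cokernel of `twistι`, because its values are locally of the form
f n with f in the ideal. A monomorphism in an abelian category is the kernel of its cokernel, so the
adjoint lifts. -/
theorem exists_twist_factorization {Z : Scheme.{u}} (i : Z ⟶ S) (φ : S ⟶ S) {M N : S.Modules}
    (ψ : M ⟶ (Scheme.Modules.pushforward φ).obj N) (hmono : Mono (twistι N i))
    (h : ∀ (V : S.Opens) (m : Γ(M, V)) (x : S), x ∈ φ ⁻¹ᵁ V →
      ∃ (V' : S.Opens) (j : V' ⟶ φ ⁻¹ᵁ V) (f : Γ(S, V')) (n : Γ(N, V')), x ∈ V' ∧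
        i.app V' f = 0 ∧ N.presheaf.map j.op (show Γ(N, φ ⁻¹ᵁ V) from ψ.app V m) = f • n) :
    ∃ τ : (Scheme.Modules.pullback φ).obj M ⟶ twist N i,
      (Scheme.Modules.pullbackPushforwardAdjunction φ).homEquiv M N (τ ≫ twistι N i) = ψ := by
  let e := (Scheme.Modules.pullbackPushforwardAdjunction φ).homEquiv M
  let k := Limits.cokernel.π (twistι N i)
  have hk : (Scheme.Modules.pushforward φ).map (0 : N ⟶ Limits.cokernel (twistι N i)) = 0 := by
    ext V s
    rfl
  have h0 : (e N).symm ψ ≫ k = 0 := by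
    apply (e _).injective
    have h1 : e _ ((e N).symm ψ ≫ k) = ψ ≫ (Scheme.Modules.pushforward φ).map k := by
      rw [Adjunction.homEquiv_naturality_right, Equiv.apply_symm_apply]
    have h2 : e (Limits.cokernel (twistι N i)) 0 = 0 := by
      have : e (Limits.cokernel (twistι N i)) ((e N).symm ψ ≫ 0) =
        ψ ≫ (Scheme.Modules.pushforward φ).map 0 := by
        rw [Adjunction.homEquiv_naturality_right, Equiv.apply_symm_apply]
      rwa [hk, Limits.comp_zero, Limits.comp_zero] at this
    rw [h1, h2]
    ext V m
    change k.app (φ ⁻¹ᵁ V) (ψ.app V m) = 0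
    refine modules_section_ext _ _ _ fun x hx => ?_
    obtain ⟨V', j, f, n, hxV', hf, hn⟩ := h V m x hx
    refine ⟨V', j, hxV', ?_⟩
    have h3 := congr($(k.mapPresheaf.naturality j.op) (show Γ(N, φ ⁻¹ᵁ V) from ψ.app V m))
    refine h3.symm.trans ?_
    refine (congrArg (k.app V') hn).trans ?_
    rw [map_zero, ← twistPresheafι_tmul N i n f hf, ← twistι_twistUnit]
    have := congrArg (fun z => Scheme.Modules.Hom.app z V') (Limits.cokernel.condition (twistι N i))
    exact congr($this _)
  refine ⟨Abelian.monoLift (twistι N i) ((e N).symm ψ) h0, ?_⟩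
  rw [Abelian.monoLift_comp]
  exact (e N).apply_symm_apply ψ

variable [IsIntegral S] {W : Type u} [AddCommGroup W] [Module S.functionField W]
  {φ : S ⟶ S} {G G' : S → Set W}

/-- An additive map `T : W → W` is semilinear with respect to the endomorphism `φ` of `S`. -/
def IsSemilinear (φ : S ⟶ S) (T : W →+ W) : Prop :=
  ∀ (V : S.Opens) (p : genericPoint S ∈ V) (p' : genericPoint S ∈ φ ⁻¹ᵁ V) (r : Γ(S, V)) (w : W),
    T (S.presheaf.germ V (genericPoint S) p r • w) =
      S.presheaf.germ (φ ⁻¹ᵁ V) (genericPoint S) p' (φ.app V r) • T w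

theorem IsSemilinear.map_mem_span {T : W →+ W} (hT : IsSemilinear φ T) 
    {x : S} {B B' : Set W} (h : ∀ w ∈ B, T w ∈ Submodule.span (localRing x) B') {w : W}
    (hw : w ∈ Submodule.span (localRing (φ x)) B) : T w ∈ Submodule.span (localRing x) B' := by
  induction hw using Submodule.span_induction with
  | mem w hw => exact h w hw
  | zero => rw [map_zero]; exact zero_mem _
  | add a b _ _ ha hb => rw [map_add]; exact add_mem ha hb
  | smul a w _ hw =>
    obtain ⟨a, ha⟩ := a
    obtain ⟨V, hx, r, rfl⟩ := mem_localRing_iff.mp ha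
    have hx' : x ∈ φ ⁻¹ᵁ V := hx
    have := hT V (genericPoint_mem hx) (genericPoint_mem hx') r w
    change T (S.presheaf.germ V (genericPoint S) (genericPoint_mem hx) r • w) ∈ _
    rw [this]
    exact germ_smul_mem_span hx' _ _ hw

/-- The morphism of sheaves defined by a semilinear map. -/
noncomputable def fracPushforward (T : W →+ W) (hT : IsSemilinear φ T)
    (hφ : φ (genericPoint S) = genericPoint S)
    (h : ∀ x, ∀ w ∈ G (φ x), T w ∈ Submodule.span (localRing x) (G' x)) :
    fracSheaf G ⟶ (Scheme.Modules.pushforward φ).obj (fracSheaf G') :=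
  modulesHomMk (M := fracSheaf G) (N := (Scheme.Modules.pushforward φ).obj (fracSheaf G'))
    (fun V =>
      { toFun := fun f => (⟨fun p => T ((show fracSections G V from f).1
            ⟨by have := p.down; rw [← hφ]; exact this⟩), fun x hx p =>
          hT.map_mem_span (h x) ((show fracSections G V from f).2 (φ x) hx _)⟩ :
            fracSections G' (φ ⁻¹ᵁ V))
        map_zero' := Subtype.ext (funext fun p => map_zero T)
        map_add' := fun _ _ => Subtype.ext (funext fun p => map_add T _ _) })
    (fun _ _ => rfl) (fun V r f => Subtype.ext (funext fun p => hT V _ p.down r _))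

theorem fracVal_fracPushforward (T : W →+ W) (hT : IsSemilinear φ T)
    (hφ : φ (genericPoint S) = genericPoint S)
    (h : ∀ x, ∀ w ∈ G (φ x), T w ∈ Submodule.span (localRing x) (G' x)) {V : S.Opens}
    (p : genericPoint S ∈ V) (p' : genericPoint S ∈ φ ⁻¹ᵁ V) (f : Γ(fracSheaf G, V)) :
    fracVal G' p' (show Γ(fracSheaf G', φ ⁻¹ᵁ V) from (fracPushforward T hT hφ h).app V f) =
      T (fracVal G p f) := rfl

/-- Only finitely many coefficients occur in a membership at `x`, and each is regular on a
neighbourhood. This turns divisibility at a point into divisibility of sections. -/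
theorem IsLocallyFG.exists_nhds_mem (hG : IsLocallyFG G) {x : S} {w : W}
    (hw : w ∈ Submodule.span (localRing x) (G x)) :
    ∃ V : S.Opens, x ∈ V ∧ ∀ y ∈ V, w ∈ Submodule.span (localRing y) (G y) := by
  obtain ⟨U, T, -, hxU, -, hT⟩ := hG x
  rw [hT x hxU] at hw
  suffices h : ∃ V : S.Opens, x ∈ V ∧ ∀ y ∈ V, w ∈ Submodule.span (localRing y) T by
    obtain ⟨V, hV, h⟩ := h
    exact ⟨U ⊓ V, ⟨hxU, hV⟩, fun y hy => by rw [hT y hy.1]; exact h y hy.2⟩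
  clear hT
  induction hw using Submodule.span_induction with
  | mem w hw => exact ⟨U, hxU, fun y _ => Submodule.subset_span hw⟩
  | zero => exact ⟨U, hxU, fun y _ => zero_mem _⟩
  | add a b _ _ ha hb =>
    obtain ⟨V, hV, h⟩ := ha
    obtain ⟨V', hV', h'⟩ := hb
    exact ⟨V ⊓ V', ⟨hV, hV'⟩, fun y hy => add_mem (h y hy.1) (h' y hy.2)⟩
  | smul a w _ hw =>
    obtain ⟨a, ha⟩ := a
    obtain ⟨V, hV, h⟩ := hw
    obtain ⟨V', hx, r, rfl⟩ := mem_localRing_iff.mp ha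
    exact ⟨V ⊓ V', ⟨hV, hx⟩, fun y hy => germ_smul_mem_span hy.2 _ r (h y hy.1)⟩

/-- It suffices to divide the images of generators by a local element of the ideal: semilinearity
spreads the division to the whole local module, and `exists_nhds_mem` spreads it to a neighbourhood.
-/
theorem exists_twist_of_semilinear {Z : Scheme.{u}} (i : Z ⟶ S) (hi : IsLocallyPrincipal i)
    (hG' : IsLocallyFG G') (T : W →+ W) (hT : IsSemilinear φ T)
    (hφ : φ (genericPoint S) = genericPoint S)
    (h : ∀ x, ∀ w ∈ G (φ x), T w ∈ Submodule.span (localRing x) (G' x))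
    (H : ∀ x : S, ∃ (V : S.Opens) (hx : x ∈ V) (f : Γ(S, V)), i.app V f = 0 ∧
      ∀ w ∈ G (φ x), ∃ n ∈ Submodule.span (localRing x) (G' x),
        T w = S.presheaf.germ V (genericPoint S) (genericPoint_mem hx) f • n) :
    ∃ τ : (Scheme.Modules.pullback φ).obj (fracSheaf G) ⟶ twist (fracSheaf G') i,
      (Scheme.Modules.pullbackPushforwardAdjunction φ).homEquiv (fracSheaf G) (fracSheaf G')
        (τ ≫ twistι (fracSheaf G') i) = fracPushforward T hT hφ h := by
  refine exists_twist_factorization i φ _ (mono_twistι i G' hi) fun V m x hx => ?_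
  obtain ⟨U, hxU, f, hf, hfw⟩ := H x
  have hV := genericPoint_mem (V := V) hx
  have key : ∀ w ∈ Submodule.span (localRing (φ x)) (G (φ x)),
      ∃ n ∈ Submodule.span (localRing x) (G' x),
        T w = S.presheaf.germ U (genericPoint S) (genericPoint_mem hxU) f • n := by
    intro w hw
    induction hw using Submodule.span_induction with
    | mem w hw => exact hfw w hw
    | zero => exact ⟨0, zero_mem _, by rw [map_zero, smul_zero]⟩
    | add a b _ _ ha hb =>
      obtain ⟨n, hn, ha⟩ := ha
      obtain ⟨n', hn', hb⟩ := hb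
      exact ⟨n + n', add_mem hn hn', by rw [map_add, ha, hb, smul_add]⟩
    | smul a w _ hw =>
      obtain ⟨a, ha⟩ := a
      obtain ⟨n, hn, hw⟩ := hw
      obtain ⟨V, hx, r, rfl⟩ := mem_localRing_iff.mp ha
      have hx' : x ∈ φ ⁻¹ᵁ V := hx
      refine ⟨_, germ_smul_mem_span hx' (genericPoint_mem hx') (φ.app V r) hn, ?_⟩
      rw [smul_comm, ← hw]
      exact hT V (genericPoint_mem hx) (genericPoint_mem hx') r w
  obtain ⟨n, hn, hTn⟩ := key _ (fracVal_mem hV m hx)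
  obtain ⟨V₂, hx₂, hn₂⟩ := hG'.exists_nhds_mem hn
  let V' : S.Opens := φ ⁻¹ᵁ V ⊓ (U ⊓ V₂)
  let k : V' ⟶ U := homOfLE (inf_le_right.trans inf_le_left)
  refine ⟨V', homOfLE inf_le_left, S.presheaf.map k.op f, fracMk G' V' n fun y hy => hn₂ y hy.2.2,
    ⟨hx, hxU, hx₂⟩, ?_, ?_⟩
  · have := congr($(i.naturality k.op) f)
    refine this.trans ?_
    exact (congrArg _ hf).trans
      (map_zero (Z.presheaf.map ((Opens.map i.base).map k.op.unop).op).hom)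
  · refine frac_ext fun p => ?_
    rw [fracVal_smul, fracVal_fracMk]
    refine Eq.trans ?_ (hTn.trans ?_)
    · rfl
    · rw [germ_res k.op p f]

end Pushforward

/-! ### Local rings of smooth curves -/

/-- A Noetherian local ring whose maximal ideal is generated by a non-zero-divisor is a domain. -/
theorem isDomain_of_maximalIdeal_eq_span {R : Type*} [CommRing R] [IsLocalRing R]
    [IsNoetherianRing R] (π : R) (hπ : IsLocalRing.maximalIdeal R = Ideal.span {π})
    (h : π ∈ nonZeroDivisors R) : IsDomain R := by
  -- By Krull's intersection theorem a nonzero x has a last power of the maximal ideal containing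
  -- it, which gives x = u π^n with u a unit. Products of such elements cannot vanish when π is a
  -- non-zero-divisor.
  have key : ∀ x : R, x ≠ 0 → ∃ (n : ℕ) (u : R), IsUnit u ∧ x = u * π ^ n := by
    intro x hx
    have hinf : ⨅ i : ℕ, IsLocalRing.maximalIdeal R ^ i = ⊥ :=
      Ideal.iInf_pow_eq_bot_of_isLocalRing _ (IsLocalRing.maximalIdeal.isMaximal R).ne_top
    have hex : ∃ n : ℕ, x ∉ IsLocalRing.maximalIdeal R ^ n := by
      by_contra! hall
      exact hx (by rw [← Ideal.mem_bot, ← hinf]; exact Submodule.mem_iInf _ |>.mpr hall)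
    classical
    have hn := Nat.find_spec hex
    have h0 : Nat.find hex ≠ 0 := by
      intro h0
      rw [h0, pow_zero, Ideal.one_eq_top] at hn
      exact hn trivial
    obtain ⟨n, hn'⟩ := Nat.exists_eq_succ_of_ne_zero h0
    have hlt := Nat.find_min hex (m := n) (by omega)
    rw [not_not, hπ, Ideal.span_singleton_pow, Ideal.mem_span_singleton'] at hlt
    obtain ⟨u, rfl⟩ := hlt
    refine ⟨n, u, ?_, rfl⟩
    by_contra hu
    have hu' : u ∈ IsLocalRing.maximalIdeal R := hu
    rw [hπ, Ideal.mem_span_singleton'] at hu'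
    obtain ⟨v, rfl⟩ := hu'
    refine hn ?_
    rw [hn', hπ, Ideal.span_singleton_pow, Ideal.mem_span_singleton']
    exact ⟨v, by rw [pow_succ]; ring⟩
  have : NoZeroDivisors R := by
    refine ⟨fun {a b} hab => ?_⟩
    by_contra! hne
    obtain ⟨n, u, hu, rfl⟩ := key a hne.1
    obtain ⟨m, v, hv, rfl⟩ := key b hne.2
    have h1 : (u * v) * π ^ (n + m) = 0 := by rw [pow_add]; linear_combination hab
    have h2 : u * v = 0 := (mul_right_mem_nonZeroDivisors_eq_zero_iff (pow_mem h _)).mp h1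
    exact not_isUnit_zero (h2 ▸ hu.mul hv)
  exact NoZeroDivisors.to_isDomain R

theorem isPrincipalIdealRing_of_maximalIdeal_eq_span {R : Type*} [CommRing R] [IsLocalRing R]
    [IsNoetherianRing R] [IsDomain R] (π : R) (hπ : IsLocalRing.maximalIdeal R = Ideal.span {π}) :
    IsPrincipalIdealRing R := by
  by_cases hf : IsField R
  · letI := hf.toField
    infer_instance
  · have : IsDiscreteValuationRing R := ((IsDiscreteValuationRing.TFAE R hf).out 4 0).mp
      (show Submodule.IsPrincipal _ from ⟨π, hπ⟩)
    infer_instance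

/-- Unramifiedness makes the maximal ideal the extension of the prime below, hence generated by one
π. Flatness makes a nonzero π a non-zero-divisor; if π = 0, the local ring is a field. -/
theorem localization_of_etale (R S : Type u) [CommRing R] [IsDomain R] [IsPrincipalIdealRing R]
    [CommRing S] [Algebra R S] [Algebra.Etale R S] (q : Ideal S) [q.IsPrime] :
    IsDomain (Localization.AtPrime q) ∧ IsPrincipalIdealRing (Localization.AtPrime q) ∧
      Function.Injective (algebraMap R (Localization.AtPrime q)) := by
  let p := q.under R
  letI := Localization.AtPrime.algebraOfLiesOver p q
  have : IsNoetherianRing S := Algebra.FiniteType.isNoetherianRing R S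
  have : IsNoetherianRing (Localization.AtPrime q) := 
    IsLocalization.isNoetherianRing q.primeCompl _ inferInstance
  have h1 := ((Algebra.isUnramifiedAt_iff_map_eq R p q).mp inferInstance).2
  have : Module.Flat R S := inferInstance
  have hflat : Module.Flat R (Localization.AtPrime q) := 
    Module.Flat.trans R S (Localization.AtPrime q)
  have hinj : Function.Injective (algebraMap R (Localization.AtPrime q)) :=
    FaithfulSMul.algebraMap_injective _ _
  obtain ⟨π, hπ⟩ := IsPrincipalIdealRing.principal p
  have h2 : IsLocalRing.maximalIdeal (Localization.AtPrime q) =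
      Ideal.span {algebraMap R (Localization.AtPrime q) π} := by
    rw [← h1, hπ]
    exact (Ideal.map_span _ _).trans (by rw [Set.image_singleton])
  have hdom : IsDomain (Localization.AtPrime q) := by
    by_cases h0 : π = 0
    · have : IsField (Localization.AtPrime q) := by
        rw [IsLocalRing.isField_iff_maximalIdeal_eq, h2, h0, map_zero]
        exact Ideal.span_singleton_eq_bot.mpr rfl
      exact this.isDomain
    · refine isDomain_of_maximalIdeal_eq_span _ h2 ?_
      rw [mem_nonZeroDivisors_iff_right]
      intro x hx
      have : π • x = 0 := by rw [Algebra.smul_def, mul_comm, hx]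
      exact (smul_eq_zero.mp this).resolve_left h0
  exact ⟨hdom, isPrincipalIdealRing_of_maximalIdeal_eq_span _ h2, hinj⟩

theorem mvPolynomial_fin_one {R : Type u} [CommRing R] (h : IsField R) :
    IsDomain (MvPolynomial (Fin 1) R) ∧ IsPrincipalIdealRing (MvPolynomial (Fin 1) R) := by
  letI := h.toField
  have : IsDomain (MvPolynomial (Fin 1) R) := inferInstance
  exact ⟨inferInstance, IsPrincipalIdealRing.of_surjective
    (MvPolynomial.uniqueAlgEquiv R (Fin 1)).symm.toRingEquiv.toRingHom
    (MvPolynomial.uniqueAlgEquiv R (Fin 1)).symm.surjective⟩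

/-- A smooth curve is locally étale over the affine line, so its local rings are local rings of
étale algebras over k[X]. The section `T` is the image of X; its transcendence is what later
separates the generic point from `∞`. -/
theorem exists_etale_of_smooth {k : Type u} [Field k] {X : Scheme.{u}}
    (f : X ⟶ Spec (CommRingCat.of k)) [SmoothOfRelativeDimension 1 f] (x : X) :
    IsDomain (X.presheaf.stalk x) ∧ IsPrincipalIdealRing (X.presheaf.stalk x) ∧
      ∃ (V : X.Opens) (hx : x ∈ V) (T : Γ(X, V)), Function.Injective
        fun p : Polynomial k => X.presheaf.germ V x hx (p.eval₂ (structureHom f V) T) := by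
  obtain ⟨U, hU, V, hV, hx, e, h⟩ :=
    SmoothOfRelativeDimension.exists_isStandardSmoothOfRelativeDimension (n := 1) (f := f) x
  have hUtop : U = ⊤ := by
    refine eq_top_iff.mpr fun y _ => ?_
    have : Subsingleton (Spec (CommRingCat.of k)) := inferInstanceAs (Subsingleton (PrimeSpectrum k))
    rw [Subsingleton.elim y (f x)]
    exact e hx
  subst hUtop
  let ek := (Scheme.ΓSpecIso (CommRingCat.of k)).commRingCatIsoToRingEquiv
  have hfield : IsField Γ(Spec (CommRingCat.of k), ⊤) := ek.toMulEquiv.isField (Field.toIsField k)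
  obtain ⟨g, hgC, hg⟩ := h.exists_etale_mvPolynomial
  obtain ⟨h1, h2⟩ := mvPolynomial_fin_one hfield
  let P := MvPolynomial (Fin 1) Γ(Spec (CommRingCat.of k), ⊤)
  letI : Algebra P Γ(X, V) := g.toAlgebra
  have : Algebra.Etale P Γ(X, V) := hg
  obtain ⟨a, b, c⟩ := localization_of_etale P Γ(X, V) (hV.primeIdealOf ⟨x, hx⟩).asIdeal
  letI := TopCat.Presheaf.algebra_section_stalk X.presheaf ⟨x, hx⟩
  have hloc : IsLocalization.AtPrime (X.presheaf.stalk x) (hV.primeIdealOf ⟨x, hx⟩).asIdeal :=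
    hV.isLocalization_stalk ⟨x, hx⟩
  let es := IsLocalization.algEquiv (hV.primeIdealOf ⟨x, hx⟩).asIdeal.primeCompl
    (Localization.AtPrime (hV.primeIdealOf ⟨x, hx⟩).asIdeal) (X.presheaf.stalk x)
  refine ⟨es.symm.toMulEquiv.isDomain, IsPrincipalIdealRing.of_surjective es.toRingEquiv.toRingHom
    es.surjective, V, hx, g (MvPolynomial.X 0), ?_⟩
  let ι : Polynomial k →+* P := Polynomial.eval₂RingHom
    (MvPolynomial.C.comp ek.symm.toRingHom) (MvPolynomial.X 0)
  have hι : Function.Injective ι := by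
    have : ι = ((MvPolynomial.uniqueAlgEquiv Γ(Spec (CommRingCat.of k), ⊤)
        (Fin 1)).symm.toRingEquiv.toRingHom).comp (Polynomial.mapRingHom ek.symm.toRingHom) := by
      refine Polynomial.ringHom_ext (fun r => ?_) ?_
      · simp [ι, MvPolynomial.uniqueAlgEquiv]
      · simp [ι, MvPolynomial.uniqueAlgEquiv]
    rw [this]
    exact (MvPolynomial.uniqueAlgEquiv _ (Fin 1)).symm.injective.comp
      (Polynomial.map_injective _ ek.symm.injective)
  have key : (fun p : Polynomial k => X.presheaf.germ V x hx
      (p.eval₂ (structureHom f V) (g (MvPolynomial.X 0)))) =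
      fun p => es (algebraMap P _ (ι p)) := by
    funext p
    have e1 : es (algebraMap P _ (ι p)) = X.presheaf.germ V x hx (g (ι p)) := by
      rw [IsScalarTower.algebraMap_apply P Γ(X, V)]
      exact es.commutes _
    rw [e1]
    congr 1
    have e2 : Polynomial.eval₂RingHom (structureHom f V) (g (MvPolynomial.X 0)) = g.comp ι := by
      refine Polynomial.ringHom_ext (fun r => ?_) ?_
      · simp only [Polynomial.coe_eval₂RingHom, Polynomial.eval₂_C, RingHom.comp_apply, ι]
        exact (congr($hgC (ek.symm r))).symm
      · simp [ι]
    exact congr($e2 p)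
  rw [key]
  exact es.injective.comp (c.comp hι)

/-- Smoothness survives base change to any field, and the stalks of a smooth curve over a field are
domains. -/
theorem geometricallyReduced_of_smooth {k : Type u} [Field k] {X : Scheme.{u}}
    (f : X ⟶ Spec (CommRingCat.of k)) [h : SmoothOfRelativeDimension 1 f] :
    GeometricallyReduced f := by
  refine ⟨fun K _ y X' fst snd hp => ?_⟩
  have : SmoothOfRelativeDimension 1 snd :=
    (smoothOfRelativeDimension_isStableUnderBaseChange 1).of_isPullback hp h
  have : ∀ x : X', IsReduced (X'.presheaf.stalk x) := fun x => by
    have := (exists_etale_of_smooth snd x).1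
    infer_instance
  exact isReduced_of_isReduced_stalk X'

/-! ### Basic properties of the pointed curve -/

namespace PointedCurve

variable {F : Type u} [Field F] (X : PointedCurve F)

instance : SmoothOfRelativeDimension 1 X.π := X.smooth
instance : IsProper X.π := X.proper
instance : GeometricallyIrreducible X.π := X.geometricallyIrreducible
instance : GeometricallyReduced X.π := geometricallyReduced_of_smooth X.π
instance : GeometricallyIntegral X.π :=
  GeometricallyIntegral.of_geometricallyReduced_of_geometricallyIrreducible X.π
instance : Smooth X.π := SmoothOfRelativeDimension.smooth 1 X.π
instance : Subsingleton (Spec (CommRingCat.of F)) := inferInstanceAs (Subsingleton (PrimeSpectrum F))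
instance : IsIntegral X.C := GeometricallyIntegral.isIntegral_of_subsingleton X.π
instance : IsLocallyNoetherian X.C := LocallyOfFiniteType.isLocallyNoetherian X.π
instance : CompactSpace X.C := by
  exact isCompact_univ_iff.mp (X.π.isCompact_preimage (U := ⊤) isCompact_univ)
instance : AlgebraicGeometry.IsNoetherian X.C := {}

instance (x : X.C) : IsDomain (X.C.presheaf.stalk x) := (exists_etale_of_smooth X.π x).1
instance (x : X.C) : IsPrincipalIdealRing (X.C.presheaf.stalk x) := (exists_etale_of_smooth X.π x).2.1

end PointedCurve

/-! ### Points and regular loci on one-dimensional schemes -/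

section Points

variable {S : Scheme.{u}} [IsIntegral S]

/-- The open subset on which a rational function is regular. -/
noncomputable def regularOpen (u : S.functionField) : S.Opens where
  carrier := {x | u ∈ localRing x}
  is_open' := by
    rw [isOpen_iff_forall_mem_open]
    intro x hx
    obtain ⟨V, hxV, r, hr⟩ := mem_localRing_iff.mp hx
    exact ⟨V, fun y hy => mem_localRing_iff.mpr ⟨V, hy, r, hr⟩, V.isOpen, hxV⟩

theorem mem_regularOpen {u : S.functionField} {x : S} : x ∈ regularOpen u ↔ u ∈ localRing x :=
  Iff.rfl

/-- A rational function that is regular at all points of `V` is a section over `V`. -/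
theorem exists_section_of_mem_localRing {V : S.Opens} (h : genericPoint S ∈ V)
    (u : S.functionField) (hu : ∀ x ∈ V, u ∈ localRing x) :
    ∃ s : Γ(S, V), S.presheaf.germ V (genericPoint S) h s = u := by
  have hex : ∀ x : V, ∃ (U : S.Opens) (hx : x.1 ∈ U) (_ : U ≤ V) (r : Γ(S, U)),
      S.presheaf.germ U (genericPoint S) (genericPoint_mem hx) r = u := fun x => by
    obtain ⟨U, hx, r, hr⟩ := mem_localRing_iff.mp (hu x.1 x.2)
    refine ⟨U ⊓ V, ⟨hx, x.2⟩, inf_le_right, S.presheaf.map (homOfLE inf_le_left).op r, ?_⟩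
    rw [← hr]
    exact germ_res (homOfLE inf_le_left).op _ r
  choose U hx hle r hr using hex
  obtain ⟨s, hs, -⟩ := S.sheaf.existsUnique_gluing' U V (fun x => homOfLE (hle x))
    (fun x hxV => Opens.mem_iSup.mpr ⟨⟨x, hxV⟩, hx ⟨x, hxV⟩⟩) r (fun x y => by
      have hm : genericPoint S ∈ U x ⊓ U y := ⟨genericPoint_mem (hx x), genericPoint_mem (hx y)⟩
      apply germ_genericPoint_injective hm
      exact (germ_res (V' := op (U x ⊓ U y)) (homOfLE inf_le_left).op hm (r x)).trans
        ((hr x).trans ((hr y).symm.trans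
          (germ_res (V' := op (U x ⊓ U y)) (homOfLE inf_le_right).op hm (r y)).symm)))
  refine ⟨s, ?_⟩
  have := hs ⟨_, h⟩
  rw [← hr ⟨_, h⟩, ← this]
  exact (germ_res (homOfLE (hle ⟨_, h⟩)).op _ s).symm

/-- Generalizations of `x` are primes of its stalk, and a prime of a principal ideal domain is zero
or maximal. -/
theorem eq_genericPoint_or_eq [∀ x : S, IsPrincipalIdealRing (S.presheaf.stalk x)] {x y : S}
    (h : y ⤳ x) : y = genericPoint S ∨ y = x := by
  obtain ⟨p, rfl⟩ : y ∈ Set.range (S.fromSpecStalk x) := by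
    rw [Scheme.range_fromSpecStalk]; exact h
  change PrimeSpectrum (S.presheaf.stalk x) at p
  by_cases hp : p.asIdeal = ⊥
  · left
    obtain ⟨q, hq⟩ : genericPoint S ∈ Set.range (S.fromSpecStalk x) := by
      rw [Scheme.range_fromSpecStalk]; exact genericPoint_specializes x
    change PrimeSpectrum (S.presheaf.stalk x) at q
    have hpq : p ⤳ q := by
      rw [← PrimeSpectrum.le_iff_specializes, ← PrimeSpectrum.asIdeal_le_asIdeal, hp]
      exact bot_le
    have := hpq.map (S.fromSpecStalk x).continuous
    rw [hq] at this
    exact (this.antisymm (genericPoint_specializes _)).eq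
  · right
    have := p.isPrime.isMaximal hp
    have e : p = IsLocalRing.closedPoint (S.presheaf.stalk x) :=
      PrimeSpectrum.ext (IsLocalRing.eq_maximalIdeal this)
    exact (congrArg _ e).trans Scheme.fromSpecStalk_closedPoint

theorem isClosed_singleton_of_ne [∀ x : S, IsPrincipalIdealRing (S.presheaf.stalk x)] {x : S}
    (hx : x ≠ genericPoint S) : IsClosed ({x} : Set S) := by
  rw [← closure_subset_iff_isClosed]
  intro y hy
  exact ((eq_genericPoint_or_eq (specializes_iff_mem_closure.mpr hy)).resolve_left hx).symm

/-- Each of the finitely many irreducible components has a generic point different from that of `S`.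
Such a point is closed, so the component is this point alone. -/
theorem finite_of_isClosed [NoetherianSpace S]
    [∀ x : S, IsPrincipalIdealRing (S.presheaf.stalk x)] {Z : Set S} (hZ : IsClosed Z)
    (h : genericPoint S ∉ Z) : Z.Finite := by
  obtain ⟨T, hT, hcl, hirr, rfl⟩ := NoetherianSpace.exists_finite_set_isClosed_irreducible hZ
  refine hT.sUnion fun t ht => ?_
  have hg := (hirr t ht).isGenericPoint_genericPoint (hcl t ht)
  have hne : (hirr t ht).genericPoint ≠ genericPoint S := fun e =>
    h ⟨t, ht, e ▸ hg.mem⟩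
  rw [← hg, (isClosed_singleton_of_ne hne).closure_eq]
  exact Set.finite_singleton _

end Points

/-! ### The map to the affine line defined by a rational function -/

section AffineLine

variable {k : Type u} [Field k] {S : Scheme.{u}} (f : S ⟶ Spec (CommRingCat.of k))

/-- The `k`-algebra homomorphism `k[T] → Γ(S, V)` that maps `T` to `s`. -/
noncomputable def evalHom {V : S.Opens} (s : Γ(S, V)) : Polynomial k →+* Γ(S, V) :=
  Polynomial.eval₂RingHom (structureHom f V) s

/-- The morphism from an open subscheme to the affine line that is given by a section. -/
noncomputable def toAffineLine {V : S.Opens} (s : Γ(S, V)) :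
    V.toScheme ⟶ Spec (CommRingCat.of (Polynomial k)) :=
  V.toSpecΓ ≫ Spec.map (CommRingCat.ofHom (evalHom f s))

theorem toAffineLine_comp {V : S.Opens} (s : Γ(S, V)) :
    toAffineLine f s ≫ Spec.map (CommRingCat.ofHom (Polynomial.C : k →+* Polynomial k)) =
      V.ι ≫ f := by
  rw [← toSpecΓ_structureHom, toAffineLine, Category.assoc, ← Spec.map_comp]
  congr 2
  ext r
  exact Polynomial.eval₂_C _ _

theorem toAffineLine_appTop {V : S.Opens} (s : Γ(S, V)) (p : Polynomial k) :
    (toAffineLine f s).appTop.hom ((Scheme.ΓSpecIso (CommRingCat.of (Polynomial k))).inv.hom p) =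
      V.topIso.inv.hom (evalHom f s p) := by
  have h : (Scheme.ΓSpecIso (CommRingCat.of (Polynomial k))).inv ≫ (toAffineLine f s).appTop =
      CommRingCat.ofHom (evalHom f s) ≫ V.topIso.inv := by
    rw [toAffineLine, Scheme.Hom.comp_appTop, Scheme.Opens.toSpecΓ_appTop,
      ← Scheme.ΓSpecIso_inv_naturality_assoc, Iso.inv_hom_id_assoc]
  exact congr($h p)

instance {V : S.Opens} (s : Γ(S, V)) [LocallyOfFiniteType f] :
    LocallyOfFiniteType (toAffineLine f s) := by
  have : LocallyOfFiniteType (toAffineLine f s ≫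
      Spec.map (CommRingCat.ofHom (Polynomial.C : k →+* Polynomial k))) := by
    rw [toAffineLine_comp]; infer_instance
  exact locallyOfFiniteType_of_comp _
    (Spec.map (CommRingCat.ofHom (Polynomial.C : k →+* Polynomial k)))

instance {V : S.Opens} (s : Γ(S, V)) [IsSeparated f] : IsSeparated (toAffineLine f s) := by
  have : IsSeparated (toAffineLine f s ≫
      Spec.map (CommRingCat.ofHom (Polynomial.C : k →+* Polynomial k))) := by
    rw [toAffineLine_comp]; infer_instance
  exact IsSeparated.of_comp _ (Spec.map (CommRingCat.ofHom (Polynomial.C : k →+* Polynomial k)))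

theorem inv_mem_localRing [IsIntegral S] [∀ x : S, IsPrincipalIdealRing (S.presheaf.stalk x)]
    {x : S} {u : S.functionField} (hu : u ∉ localRing x) : u⁻¹ ∈ localRing x := by
  rcases (ValuationRing.iff_isInteger_or_isInteger (S.presheaf.stalk x)
    S.functionField).mp inferInstance u with h | h
  · exact absurd h hu
  · exact h

theorem ι_appLE_top (V : S.Opens) (e : ⊤ ≤ V.ι ⁻¹ᵁ V) : V.ι.appLE V ⊤ e = V.topIso.inv := by
  rw [Scheme.Opens.ι_appLE, Scheme.Opens.topIso_inv]
  rfl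

/-- This is the valuative criterion: a valuation ring mapping to the affine line lifts to the proper
scheme `S`, and the image of its closed point cannot be a pole of u, because u pulls back to an
element of the valuation ring. -/
theorem isProper_toAffineLine [IsIntegral S] [∀ x : S, IsPrincipalIdealRing (S.presheaf.stalk x)]
    [IsProper f] [NoetherianSpace S] (u : S.functionField)
    {V : S.Opens} (hV : regularOpen u ≤ V) (hξ : genericPoint S ∈ V) (s : Γ(S, V))
    (hs : S.presheaf.germ V (genericPoint S) hξ s = u) :
    IsProper (toAffineLine f s) := by
  have : NoetherianSpace V := V.isOpenEmbedding.isInducing.noetherianSpace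
  have : CompactSpace V := inferInstance
  have : QuasiCompact (toAffineLine f s) := inferInstance
  have : UniversallyClosed (toAffineLine f s) := by
    refine UniversallyClosed.of_valuativeCriterion _ fun Q => ?_
    obtain ⟨R, K, i₁, i₂, ⟨hsq⟩⟩ := Q
    let j := Spec.map (CommRingCat.ofHom (algebraMap R K))
    have hsq' : CommSq (i₁ ≫ V.ι) j f
        (i₂ ≫ Spec.map (CommRingCat.ofHom (Polynomial.C : k →+* Polynomial k))) := by
      constructor
      rw [Category.assoc, ← toAffineLine_comp f s, reassoc_of% hsq]
    have hf := (IsProper.eq_valuativeCriterion.le _ _ f ‹_›).1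
    obtain ⟨l, hl1⟩ : ∃ l : Spec (CommRingCat.of R) ⟶ S, j ≫ l = i₁ ≫ V.ι := by
      obtain ⟨⟨l, hl1, -⟩⟩ := (hf.1.1.existence ⟨R, K, _, _, hsq'⟩).exists_lift
      exact ⟨l, hl1⟩
    have hmem : l (IsLocalRing.closedPoint R) ∈ V := by
      by_contra hx'
      have hx : u ∉ localRing (l (IsLocalRing.closedPoint R)) := fun h => hx' (hV h)
      obtain ⟨V', hxV', r, hr⟩ := mem_localRing_iff.mp (inv_mem_localRing hx)
      have hle : ⊤ ≤ l ⁻¹ᵁ V' := (Scheme.preimage_eq_top_of_closedPoint_mem l hxV').ge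
      have hu0 : u ≠ 0 := fun h => hx (h ▸ zero_mem (localRing (l (IsLocalRing.closedPoint R))))
      have hW : genericPoint S ∈ V' ⊓ V := ⟨genericPoint_mem hxV', hξ⟩
      -- At a pole of u the inverse r = u⁻¹ is regular, and r s = 1 on the overlap. Pulled back, r
      -- times the coordinate T is 1 over K, hence already over R, since R embeds in K. So r is a
      -- unit at the closed point and u is regular there, a contradiction.
      have hrs : S.presheaf.map (homOfLE inf_le_left : V' ⊓ V ⟶ V').op r *
          S.presheaf.map (homOfLE inf_le_right : V' ⊓ V ⟶ V).op s = 1 := by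
        apply germ_genericPoint_injective hW
        have e1 := germ_res (V' := op (V' ⊓ V)) (homOfLE inf_le_left).op hW r
        have e2 := germ_res (V' := op (V' ⊓ V)) (homOfLE inf_le_right).op hW s
        rw [map_mul, map_one]
        refine (congrArg₂ (· * ·) (e1.trans hr) (e2.trans hs)).trans (inv_mul_cancel₀ hu0)
      have hm1 : ⊤ ≤ (j ≫ l) ⁻¹ᵁ V' := fun y _ => hle (Set.mem_univ (j y))
      have hm2 : ⊤ ≤ (j ≫ l) ⁻¹ᵁ V := fun y _ => by
        have : (i₁ ≫ V.ι) y ∈ V := (i₁ y).2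
        rw [← hl1] at this
        exact this
      have hm : (j ≫ l).appLE V' ⊤ hm1 r * (j ≫ l).appLE V ⊤ hm2 s = 1 := by
        have := congrArg ((j ≫ l).appLE (V' ⊓ V) ⊤ (le_inf hm1 hm2)).hom hrs
        rw [map_mul, map_one] at this
        rw [← this]
        congr 1
        · exact congr($((Scheme.Hom.map_appLE (j ≫ l) (le_inf hm1 hm2) (homOfLE inf_le_left).op).symm) r)
        · exact congr($((Scheme.Hom.map_appLE (j ≫ l) (le_inf hm1 hm2) (homOfLE inf_le_right).op).symm) s)
      let T := (Scheme.ΓSpecIso (CommRingCat.of (Polynomial k))).inv.hom Polynomial.X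
      have hr' : (j ≫ l).appLE V' ⊤ hm1 r = j.appTop.hom (l.appLE V' ⊤ hle r) := by
        have := Scheme.Hom.appLE_comp_appLE j l V' ⊤ ⊤ hle le_top
        rw [← this]
        rfl
      have hs' : (j ≫ l).appLE V ⊤ hm2 s = j.appTop.hom (i₂.appTop.hom T) := by
        have e1 : j.appTop.hom (i₂.appTop.hom T) = (j ≫ i₂).appTop.hom T := by
          rw [Scheme.Hom.comp_appTop]; rfl
        have e2 : (i₁ ≫ toAffineLine f s).appTop.hom T =
            i₁.appTop.hom ((toAffineLine f s).appTop.hom T) := by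
          rw [Scheme.Hom.comp_appTop]; rfl
        rw [e1, ← hsq, e2, toAffineLine_appTop, evalHom, Polynomial.coe_eval₂RingHom,
          Polynomial.eval₂_X]
        have := Scheme.Hom.appLE_comp_appLE i₁ V.ι V ⊤ ⊤ V.ι_preimage_self.ge le_top
        simp only [hl1]
        rw [← this, ι_appLE_top]
        rfl
      rw [hr', hs', ← map_mul, ← map_one j.appTop.hom] at hm
      have hinj : Function.Injective j.appTop.hom := by
        have e := Scheme.ΓSpecIso_inv_naturality (CommRingCat.ofHom (algebraMap R K))
        intro a b hab
        have h1 : ∀ a, j.appTop.hom a = (Scheme.ΓSpecIso (CommRingCat.of K)).inv.hom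
            (algebraMap R K ((Scheme.ΓSpecIso (CommRingCat.of R)).hom.hom a)) := fun a => by
          have := congr($e ((Scheme.ΓSpecIso (CommRingCat.of R)).hom.hom a))
          refine .trans ?_ this.symm
          exact congrArg j.appTop.hom congr($((Scheme.ΓSpecIso (CommRingCat.of R)).hom_inv_id) a).symm
        rw [h1, h1] at hab
        have := (Scheme.ΓSpecIso (CommRingCat.of K)).commRingCatIsoToRingEquiv.symm.injective hab
        exact (Scheme.ΓSpecIso (CommRingCat.of R)).commRingCatIsoToRingEquiv.injective
          (IsFractionRing.injective R K this)
      have hunit : IsUnit (l.appLE V' ⊤ hle r) := IsUnit.of_mul_eq_one _ (hinj hm)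
      have := Scheme.basicOpen_appLE l ⊤ V' hle r
      rw [Scheme.basicOpen_of_isUnit _ hunit] at this
      have hb : l (IsLocalRing.closedPoint R) ∈ S.basicOpen r :=
        (this.le (Set.mem_univ _)).2
      have := inv_germ_mem_localRing (genericPoint_mem hxV') hb
      rw [hr, inv_inv] at this
      exact hx this
    have hle : Set.range l ⊆ Set.range V.ι := by
      rw [Scheme.Opens.range_ι]
      rintro _ ⟨y, rfl⟩
      exact (Scheme.preimage_eq_top_of_closedPoint_mem l hmem).ge (Set.mem_univ y)
    have h1 : j ≫ IsOpenImmersion.lift V.ι l hle = i₁ := by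
      rw [← cancel_mono V.ι, Category.assoc, IsOpenImmersion.lift_fac, hl1]
    have h2 : IsOpenImmersion.lift V.ι l hle ≫ toAffineLine f s = i₂ := by
      obtain ⟨φ, hφ⟩ := Spec.map_surjective (IsOpenImmersion.lift V.ι l hle ≫ toAffineLine f s)
      obtain ⟨ψ, rfl⟩ := Spec.map_surjective i₂
      rw [← hφ]
      have : j ≫ Spec.map φ = j ≫ Spec.map ψ := by rw [hφ, ← hsq, ← h1, Category.assoc]
      rw [← Spec.map_comp, ← Spec.map_comp] at this
      have h3 := Spec.map_injective this
      congr 1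
      apply CommRingCat.hom_ext
      exact RingHom.ext fun p => IsFractionRing.injective R K congr($h3 p)
    refine ⟨⟨⟨IsOpenImmersion.lift V.ι l hle, h1, h2⟩⟩⟩
  exact ⟨⟩

end AffineLine

/-! ### Finiteness over the affine line -/

section FiniteMaps

variable {k : Type u} [Field k] {S : Scheme.{u}} (f : S ⟶ Spec (CommRingCat.of k))

theorem mem_basicOpen_toAffineLine {V : S.Opens} (s : Γ(S, V)) (p : Polynomial k) (x : V) :
    p ∉ (toAffineLine f s x).asIdeal ↔ x.1 ∈ S.basicOpen (evalHom f s p) := by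
  have h1 : p ∉ (toAffineLine f s x).asIdeal ↔ toAffineLine f s x ∈
      (Spec (CommRingCat.of (Polynomial k))).basicOpen
        ((Scheme.ΓSpecIso (CommRingCat.of (Polynomial k))).inv.hom p) := by
    have := basicOpen_eq_of_affine (R := CommRingCat.of (Polynomial k)) p
    exact (this ▸ Iff.rfl)
  have h2 : toAffineLine f s x ∈ (Spec (CommRingCat.of (Polynomial k))).basicOpen
        ((Scheme.ΓSpecIso (CommRingCat.of (Polynomial k))).inv.hom p) ↔
        x ∈ V.toScheme.basicOpen (V.topIso.inv.hom (evalHom f s p)) := by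
    have := (toAffineLine f s).preimage_basicOpen
      ((Scheme.ΓSpecIso (CommRingCat.of (Polynomial k))).inv.hom p)
    have h3 := toAffineLine_appTop f s p
    rw [← h3]
    exact this ▸ Iff.rfl
  rw [h1, h2, ← Scheme.Opens.ι_image_basicOpen_topIso_inv V (evalHom f s p)]
  exact (Scheme.Hom.apply_mem_image_iff V.ι).symm

variable [IsIntegral S]

/-- The embedding of the base field in the function field. -/
noncomputable def constHom : k →+* S.functionField :=
  (S.presheaf.germ ⊤ (genericPoint S) trivial).hom.comp (structureHom f ⊤)

theorem germ_structureHom {V : S.Opens} (h : genericPoint S ∈ V) (a : k) :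
    S.presheaf.germ V (genericPoint S) h (structureHom f V a) = constHom f a := by
  have e : structureHom f V a = S.presheaf.map (homOfLE (le_top : V ≤ ⊤)).op
      (structureHom f ⊤ a) := by
    have := S.presheaf.map_comp (homOfLE (le_top : (⊤ : S.Opens) ≤ ⊤)).op
      (homOfLE (le_top : V ≤ ⊤)).op
    exact congr($this (f.appTop ((Scheme.ΓSpecIso (CommRingCat.of k)).inv a)))
  rw [e]
  exact germ_res (V' := op V) (homOfLE (le_top : V ≤ ⊤)).op h _

theorem germ_evalHom {V : S.Opens} (h : genericPoint S ∈ V) (s : Γ(S, V)) (p : Polynomial k) :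
    S.presheaf.germ V (genericPoint S) h (evalHom f s p) =
      p.eval₂ (constHom f) (S.presheaf.germ V (genericPoint S) h s) := by
  have := Polynomial.hom_eval₂ p (structureHom f V) (S.presheaf.germ V (genericPoint S) h).hom s
  refine this.trans (congrArg (fun φ => Polynomial.eval₂ φ _ p) ?_)
  exact RingHom.ext fun a => germ_structureHom f h a

theorem toAffineLine_genericPoint {V : S.Opens} (h : genericPoint S ∈ V) (s : Γ(S, V))
    (hs : Function.Injective fun p : Polynomial k =>
      p.eval₂ (constHom f) (S.presheaf.germ V (genericPoint S) h s)) :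
    (toAffineLine f s ⟨genericPoint S, h⟩).asIdeal = ⊥ := by
  rw [eq_bot_iff]
  intro p hp
  by_contra hp0
  refine (mem_basicOpen_toAffineLine f s p ⟨genericPoint S, h⟩).mpr ?_ hp
  rw [Scheme.mem_basicOpen _ _ _ h]
  change IsUnit (M := S.functionField) _
  rw [germ_evalHom, isUnit_iff_ne_zero]
  intro h0
  exact hp0 (hs (h0.trans (Polynomial.eval₂_zero _ _).symm))

/-- A proper map sends closed points to closed points, and the generic point of the affine line is
not closed because k[T] is not a field. -/
theorem toAffineLine_ne_bot {V : S.Opens} (s : Γ(S, V)) [IsProper (toAffineLine f s)] (x : V)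
    (hx : IsClosed ({x.1} : Set S)) : (toAffineLine f s x).asIdeal ≠ ⊥ := by
  intro h
  have h1 : IsClosed ({x} : Set V) := by
    have := hx.preimage (continuous_subtype_val (p := (· ∈ V)))
    refine (congrArg IsClosed ?_).mp this
    exact Set.ext fun y => Subtype.ext_iff.symm
  have h2 := (toAffineLine f s).isClosedMap _ h1
  have h3 := (PrimeSpectrum.isClosed_singleton_iff_isMaximal (R := Polynomial k)
    (toAffineLine f s x)).mp ((congrArg IsClosed Set.image_singleton).mp h2)
  rw [h] at h3
  exact Polynomial.not_isField k (Ring.isField_iff_maximal_bot.mpr h3)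

/-- Proper and quasi-finite implies finite. The fibre over the generic point of the line contains at
most the generic point of `V`; any other fibre is the trace of a closed set missing the generic
point, hence finite. -/
theorem isFinite_toAffineLine [∀ x : S, IsPrincipalIdealRing (S.presheaf.stalk x)]
    [LocallyOfFiniteType f] [NoetherianSpace S]
    {V : S.Opens} (h : genericPoint S ∈ V) (s : Γ(S, V)) [IsProper (toAffineLine f s)]
    (hs : Function.Injective fun p : Polynomial k =>
      p.eval₂ (constHom f) (S.presheaf.germ V (genericPoint S) h s)) :
    IsFinite (toAffineLine f s) := by
  have : LocallyQuasiFinite (toAffineLine f s) := by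
    refine LocallyQuasiFinite.of_finite_preimage_singleton _ fun y => ?_
    by_cases hy : PrimeSpectrum.asIdeal (R := Polynomial k) y = ⊥
    · refine (Set.finite_singleton (⟨genericPoint S, h⟩ : V)).subset fun x hx => ?_
      by_contra hne
      refine toAffineLine_ne_bot f s x
        (isClosed_singleton_of_ne fun e => hne (Subtype.ext e)) ?_
      have hx' : toAffineLine f s x = y := hx
      exact (congrArg PrimeSpectrum.asIdeal hx').trans hy
    · have hcl : IsClosed ({y} : Set (Spec (CommRingCat.of (Polynomial k)))) :=
        (PrimeSpectrum.isClosed_singleton_iff_isMaximal (R := Polynomial k) y).mpr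
          (PrimeSpectrum.isPrime (R := Polynomial k) y |>.isMaximal hy)
      obtain ⟨Z, hZ, hZ'⟩ := isClosed_induced_iff.mp (hcl.preimage (toAffineLine f s).continuous)
      have hξ : genericPoint S ∉ Z := fun hmem => by
        have : toAffineLine f s ⟨genericPoint S, h⟩ = y :=
          hZ'.le (show (⟨genericPoint S, h⟩ : V) ∈ Subtype.val ⁻¹' Z from hmem)
        exact hy ((congrArg PrimeSpectrum.asIdeal this).symm.trans
          (toAffineLine_genericPoint f h s hs))
      rw [← hZ']
      exact (finite_of_isClosed hZ hξ).preimage Subtype.val_injective.injOn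
  exact IsFinite.of_isProper_of_locallyQuasiFinite _

/-- The locus where a transcendental rational function on a complete curve is regular is affine,
and its coordinate ring is finite over the polynomial ring in that function. -/
theorem finite_evalHom [∀ x : S, IsPrincipalIdealRing (S.presheaf.stalk x)]
    [IsProper f] [NoetherianSpace S] {V : S.Opens} (h : genericPoint S ∈ V) (s : Γ(S, V))
    (hV : regularOpen (S.presheaf.germ V (genericPoint S) h s) ≤ V)
    (hs : Function.Injective fun p : Polynomial k =>
      p.eval₂ (constHom f) (S.presheaf.germ V (genericPoint S) h s)) :
    IsAffineOpen V ∧ (evalHom f s).Finite := by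
  have := isProper_toAffineLine f _ hV h s rfl
  have hfin := isFinite_toAffineLine f h s hs
  have : IsAffine V := isAffine_of_isAffineHom (toAffineLine f s)
  refine ⟨this, ?_⟩
  have h1 := hfin.finite_app ⊤ (isAffineOpen_top _)
  let e1 := (Scheme.ΓSpecIso (CommRingCat.of (Polynomial k))).commRingCatIsoToRingEquiv
  let e2 := V.topIso.commRingCatIsoToRingEquiv
  have h2 : evalHom f s = (e2.toRingHom.comp (toAffineLine f s).appTop.hom).comp
      e1.symm.toRingHom := by
    refine RingHom.ext fun p => ?_
    have := toAffineLine_appTop f s p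
    exact ((congrArg e2 this).trans (e2.apply_symm_apply _)).symm
  rw [h2]
  exact ((RingHom.Finite.of_surjective _ e2.surjective).comp h1).comp
    (RingHom.Finite.of_surjective _ e1.symm.surjective)

end FiniteMaps

/-! ### Functions with poles, and finiteness of a Čech cohomology group -/

namespace PointedCurve

variable {F : Type u} [Field F] (X : PointedCurve F)

noncomputable instance : Algebra F X.C.functionField := (constHom X.π).toAlgebra

theorem constHom_mem_localRing (a : F) (x : X.C) : constHom X.π a ∈ localRing x :=
  germ_mem_localRing (V := ⊤) trivial trivial _

theorem aeval_germ {V : X.C.Opens} (h : genericPoint X.C ∈ V) (s : Γ(X.C, V)) (p : Polynomial F) :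
    Polynomial.aeval (X.C.presheaf.germ V (genericPoint X.C) h s) p =
      X.C.presheaf.germ V (genericPoint X.C) h (evalHom X.π s p) :=
  (germ_evalHom X.π h s p).symm

/-- The rational functions that are regular on `V`. -/
noncomputable def reg (V : X.C.Opens) : Subalgebra F X.C.functionField where
  carrier := {b | ∀ x ∈ V, b ∈ localRing x}
  mul_mem' ha hb x hx := mul_mem (ha x hx) (hb x hx)
  add_mem' ha hb x hx := add_mem (ha x hx) (hb x hx)
  algebraMap_mem' a x _ := X.constHom_mem_localRing a x

/-- After division by the leading coefficient, e is a root of a monic equation over the stalk, and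
the stalk is integrally closed. So a pole of e remains a pole of every nonconstant polynomial in e.
-/
theorem mem_localRing_of_aeval {x : X.C} {e : X.C.functionField} {P : Polynomial F}
    (hP : P.natDegree ≠ 0) (h : Polynomial.aeval e P ∈ localRing x) : e ∈ localRing x := by
  let φ : F →+* X.C.presheaf.stalk x :=
    (X.C.presheaf.germ ⊤ x trivial).hom.comp (structureHom X.π ⊤)
  have hφ : (algebraMap (X.C.presheaf.stalk x) X.C.functionField).comp φ = constHom X.π :=
    RingHom.ext fun a => algebraMap_germ_genericPoint (V := ⊤) trivial trivial _
  have hP0 : P ≠ 0 := fun h0 => hP (by rw [h0, Polynomial.natDegree_zero])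
  let Q := (P * Polynomial.C P.leadingCoeff⁻¹).map φ
  have hQm : (P * Polynomial.C P.leadingCoeff⁻¹).Monic := Polynomial.monic_mul_leadingCoeff_inv hP0
  have hQd : Q.natDegree ≠ 0 := by
    rw [hQm.natDegree_map, Polynomial.natDegree_mul_C (inv_ne_zero (by simpa using hP0))]
    exact hP
  have hQ : Polynomial.aeval e Q = Polynomial.aeval e P * constHom X.π P.leadingCoeff⁻¹ := by
    rw [Polynomial.aeval_def, Polynomial.eval₂_map, hφ, Polynomial.eval₂_mul, Polynomial.eval₂_C]
    rfl
  obtain ⟨y, hy⟩ : Polynomial.aeval e Q ∈ localRing x :=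
    hQ ▸ mul_mem h (X.constHom_mem_localRing _ x)
  have h1 : IsIntegral (X.C.presheaf.stalk x) (Polynomial.aeval e Q) := hy ▸ isIntegral_algebraMap
  exact IsIntegrallyClosed.isIntegral_iff.mp (IsIntegral.of_aeval_monic (hQm.map φ) hQd h1)

/-- An algebraic relation would make a nonconstant polynomial in e equal to 0, which is regular, so
e itself would be regular. -/
theorem transcendental_of_notMem {x : X.C} {e : X.C.functionField} (h : e ∉ localRing x) :
    Transcendental F e := by
  rintro ⟨P, hP, h0⟩
  refine h (X.mem_localRing_of_aeval (P := P) (fun hd => hP ?_) (h0 ▸ zero_mem _))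
  rw [Polynomial.eq_C_of_natDegree_eq_zero hd] at h0 ⊢
  rw [Polynomial.aeval_C] at h0
  rw [(algebraMap F X.C.functionField).injective (h0.trans (map_zero _).symm), map_zero]

/-- If the generic point were closed, the curve would be one point and a transcendental local
coordinate would be a section over all of it. Its proper map to the affine line would send a closed
point to the generic point. -/
theorem inf_ne_genericPoint : X.inf ≠ genericPoint X.C := by
  intro h
  obtain ⟨-, -, V, hx, T, hT⟩ := exists_etale_of_smooth X.π (genericPoint X.C)
  have htop : ∀ x : X.C, x = genericPoint X.C := fun x => by
    have hcl := h ▸ X.isClosed_inf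
    have : x ∈ closure {genericPoint X.C} := by
      rw [genericPoint_spec X.C]; trivial
    rwa [hcl.closure_eq] at this
  have := isProper_toAffineLine X.π (X.C.presheaf.germ V _ hx T) (V := V)
    (fun x _ => (htop x).symm ▸ hx) hx T rfl
  refine toAffineLine_ne_bot X.π T ⟨_, hx⟩
    (show IsClosed ({genericPoint X.C} : Set X.C) from h ▸ X.isClosed_inf)
    (toAffineLine_genericPoint X.π hx T fun p q hpq => hT ?_)
  simp only [← germ_evalHom] at hpq
  exact hpq

theorem genericPoint_mem_affinePart : genericPoint X.C ∈ X.affinePart :=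
  fun h => X.inf_ne_genericPoint (Set.mem_singleton_iff.mp h).symm

theorem eq_of_specializes {x y : X.C} (h : y ⤳ x) (hy : y ≠ genericPoint X.C) : y = x :=
  (eq_genericPoint_or_eq h).resolve_left hy

/-- If all rational functions were regular at `x`, the stalk would be a field with a single prime,
and `x` would be the generic point. -/
theorem exists_notMem_localRing {x : X.C} (hx : x ≠ genericPoint X.C) :
    ∃ u : X.C.functionField, u ∉ localRing x := by
  by_contra! hall
  have hf : IsField (X.C.presheaf.stalk x) := by
    let e := RingEquiv.ofBijective (algebraMap (X.C.presheaf.stalk x) X.C.functionField)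
      ⟨IsFractionRing.injective _ _, fun u => hall u⟩
    exact e.toMulEquiv.isField (Field.toIsField _)
  letI := hf.toField
  obtain ⟨p, hp⟩ : genericPoint X.C ∈ Set.range (X.C.fromSpecStalk x) := by
    rw [Scheme.range_fromSpecStalk]; exact genericPoint_specializes x
  have : Subsingleton (PrimeSpectrum (X.C.presheaf.stalk x)) :=
    (PrimeSpectrum.instUnique (R := (X.C.presheaf.stalk x))).instSubsingleton
  exact hx (Scheme.fromSpecStalk_closedPoint.symm.trans ((congrArg _ (this.elim _ p)).trans hp))

theorem genericPoint_mem_regularOpen (u : X.C.functionField) : genericPoint X.C ∈ regularOpen u := by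
  obtain ⟨V, hx, r, hr⟩ := X.C.presheaf.exists_germ_eq u
  exact mem_localRing_iff.mpr ⟨V, hx, r, hr⟩

/-- The coordinate ring of the locus where a transcendental function `u` is regular is affine, with
coordinate ring finite over the polynomials in `u`. -/
theorem finite_reg {u : X.C.functionField} (hu : Transcendental F u) :
    IsAffineOpen (regularOpen u) ∧ ∃ (n : ℕ) (t : Fin n → X.C.functionField),
      (∀ i, t i ∈ X.reg (regularOpen u)) ∧
      ∀ b ∈ X.reg (regularOpen u), ∃ p : Fin n → Polynomial F,
        b = ∑ i, Polynomial.aeval u (p i) * t i := by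
  have hξ := X.genericPoint_mem_regularOpen u
  obtain ⟨s, hs⟩ := exists_section_of_mem_localRing hξ u fun x hx => hx
  obtain ⟨h1, h2⟩ := finite_evalHom X.π hξ s (by rw [hs]) (by
    rw [hs]; exact transcendental_iff_injective.mp hu)
  refine ⟨h1, ?_⟩
  letI := (evalHom X.π s).toAlgebra
  have : Module.Finite (Polynomial F) Γ(X.C, regularOpen u) := h2
  obtain ⟨n, t, ht⟩ := Module.Finite.exists_fin (R := Polynomial F) (M := Γ(X.C, regularOpen u))
  refine ⟨n, fun i => X.C.presheaf.germ _ _ hξ (t i), fun i x hx => germ_mem_localRing hx hξ _,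
    fun b hb => ?_⟩
  obtain ⟨r, rfl⟩ := exists_section_of_mem_localRing hξ b hb
  obtain ⟨c, hc⟩ := (Submodule.mem_span_range_iff_exists_fun _).mp (ht.ge (Submodule.mem_top (x := r)))
  refine ⟨c, ?_⟩
  rw [← hc, map_sum]
  refine Finset.sum_congr rfl fun i _ => ?_
  have := X.aeval_germ hξ s (c i)
  rw [hs] at this
  rw [this]
  exact map_mul _ _ _

/-- The possible poles of d on `V` lie among the zeros of v, and on an affine open set a power of v
cancels them. -/
theorem exists_pow_mul_mem_reg {V : X.C.Opens} (hV : IsAffineOpen V)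
    (hξ : genericPoint X.C ∈ V) {v d : X.C.functionField}
    (hv : v ∈ X.reg V) (hd : ∀ x ∈ V, v⁻¹ ∈ localRing x → d ∈ localRing x) :
    ∃ n : ℕ, v ^ n * d ∈ X.reg V := by
  obtain ⟨s, rfl⟩ := exists_section_of_mem_localRing hξ v hv
  obtain ⟨n, hn⟩ := exists_pow_smul_mem_span_sectionRing hV hξ {(1 : X.C.functionField)} s d
    fun y hy => by
      refine Submodule.mem_span_singleton.mpr
        ⟨⟨d, hd y (X.C.basicOpen_le s hy) (inv_germ_mem_localRing hξ hy)⟩, mul_one d⟩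
  refine ⟨n, fun x hx => ?_⟩
  obtain ⟨⟨_, r, rfl⟩, hr⟩ := Submodule.mem_span_singleton.mp hn
  rw [← smul_eq_mul, ← hr]
  exact (congrArg (· ∈ localRing x) (mul_one _)).mpr (germ_mem_localRing hx hξ r)

/-- This is the finiteness of H^1 of the structure sheaf, for the cover by the loci where u and u⁻¹
are regular. Writing u^N d over generators t_i makes d a combination of the u^j t_i with j an
integer. For j ≥ 0 these are regular where u is, for j very negative they are regular where u⁻¹ is,
and finitely many remain. -/
theorem exists_finite_reg {u : X.C.functionField} (hu : Transcendental F u) :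
    ∃ Z : Finset X.C.functionField, ∀ d ∈ X.reg (regularOpen u ⊓ regularOpen u⁻¹),
      d ∈ Subalgebra.toSubmodule (X.reg (regularOpen u)) ⊔
        Subalgebra.toSubmodule (X.reg (regularOpen u⁻¹)) ⊔ Submodule.span F (Z : Set _) := by
  classical
  have hu0 : u ≠ 0 := fun h => hu (h ▸ isAlgebraic_zero)
  have hu' : Transcendental F u⁻¹ := fun h => hu (IsAlgebraic.inv_iff.mp h)
  obtain ⟨h1, n, t, ht, hB⟩ := X.finite_reg hu
  obtain ⟨h2, -⟩ := X.finite_reg hu'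
  have hm : ∀ i, ∃ m, u⁻¹ ^ m * t i ∈ X.reg (regularOpen u⁻¹) := fun i =>
    X.exists_pow_mul_mem_reg h2 (X.genericPoint_mem_regularOpen _) (fun x hx => hx) fun x hx hx' => ht i x (by rwa [inv_inv] at hx')
  choose m hm using hm
  refine ⟨Finset.univ.biUnion fun i => (Finset.range (m i)).image fun j => u⁻¹ ^ j * t i, 
    fun d hd => ?_⟩
  obtain ⟨N, hN⟩ := X.exists_pow_mul_mem_reg h1 (X.genericPoint_mem_regularOpen _) (v := u) (d := d)
    (fun x hx => hx)
    fun x hx hx' => hd x ⟨hx, hx'⟩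
  obtain ⟨p, hp⟩ := hB _ hN
  have hd' : d = ∑ i, ∑ k ∈ (p i).support, (p i).coeff k • (u ^ k * u⁻¹ ^ N * t i) := by
    have e : d = u⁻¹ ^ N * (u ^ N * d) := by
      rw [← mul_assoc, ← mul_pow, inv_mul_cancel₀ hu0, one_pow, one_mul]
    rw [e, hp, Finset.mul_sum]
    refine Finset.sum_congr rfl fun i _ => ?_
    rw [Polynomial.aeval_def, Polynomial.eval₂_eq_sum, Polynomial.sum, Finset.sum_mul,
      Finset.mul_sum]
    refine Finset.sum_congr rfl fun k _ => ?_
    rw [Algebra.smul_def]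
    ring
  rw [hd']
  refine sum_mem fun i _ => sum_mem fun k _ => Submodule.smul_mem _ _ ?_
  rcases le_total N k with hNk | hNk
  · obtain ⟨c, rfl⟩ := Nat.exists_eq_add_of_le hNk
    have e : u ^ (N + c) * u⁻¹ ^ N = u ^ c := by
      rw [pow_add, mul_right_comm, ← mul_pow, mul_inv_cancel₀ hu0, one_pow, one_mul]
    rw [e]
    exact Submodule.mem_sup_left (Submodule.mem_sup_left 
      ((X.reg (regularOpen u)).mul_mem (pow_mem (fun x hx => hx) c) (ht i)))
  · obtain ⟨c, rfl⟩ := Nat.exists_eq_add_of_le hNk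
    have e : u ^ k * u⁻¹ ^ (k + c) = u⁻¹ ^ c := by
      rw [pow_add, ← mul_assoc, ← mul_pow, mul_inv_cancel₀ hu0, one_pow, one_mul]
    rw [e]
    by_cases hc : c < m i
    · refine Submodule.mem_sup_right (Submodule.subset_span ?_)
      simp only [Finset.coe_biUnion, Finset.coe_image, Set.mem_iUnion]
      exact ⟨i, Finset.mem_univ i, c, by simpa using hc, rfl⟩
    · obtain ⟨c', rfl⟩ := Nat.exists_eq_add_of_le (not_lt.mp hc)
      refine Submodule.mem_sup_left (Submodule.mem_sup_right ?_)
      rw [add_comm, pow_add, mul_assoc]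
      exact (X.reg (regularOpen u⁻¹)).mul_mem (pow_mem (fun x hx => hx) c') (hm i)

end PointedCurve

theorem fromSpec_mem_basicOpen {S : Scheme.{u}} {V : S.Opens} (hV : IsAffineOpen V)
    (p : PrimeSpectrum Γ(S, V)) (s : Γ(S, V)) : hV.fromSpec p ∈ S.basicOpen s ↔ s ∉ p.asIdeal := by
  have := hV.fromSpec_preimage_basicOpen s
  exact (show p ∈ hV.fromSpec ⁻¹ᵁ S.basicOpen s ↔ _ from this ▸ Iff.rfl)

/-! ### A rational function whose only pole is the point at infinity -/

namespace PointedCurve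

variable {F : Type u} [Field F] (X : PointedCurve F)

theorem aeval_mem_localRing {x : X.C} {e : X.C.functionField} (h : e ∈ localRing x)
    (P : Polynomial F) : Polynomial.aeval e P ∈ localRing x := by
  rw [Polynomial.aeval_def, Polynomial.eval₂_eq_sum]
  exact sum_mem fun n _ => mul_mem (X.constHom_mem_localRing _ x) (pow_mem h n)

/-- On an affine open subset there is a rational function whose only pole is a given closed
point. -/
theorem exists_unique_pole {V : X.C.Opens} (hV : IsAffineOpen V) {x : X.C} (hx : x ∈ V)
    (hxξ : x ≠ genericPoint X.C) {u : X.C.functionField} (hu : u ∉ localRing x)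
    (hu' : u⁻¹ ∈ X.reg V) :
    ∃ e : X.C.functionField, e ∉ localRing x ∧ ∀ y ∈ V, y ≠ x → e ∈ localRing y := by
  have hξ := genericPoint_mem hx
  obtain ⟨s, hs⟩ := exists_section_of_mem_localRing hξ u⁻¹ hu'
  have hs0 : X.C.presheaf.germ V _ hξ s ≠ 0 := by
    rw [hs]
    exact inv_ne_zero fun h => hu (h ▸ zero_mem _)
  have : IsNoetherianRing Γ(X.C, V) := IsLocallyNoetherian.component_noetherian ⟨V, hV⟩
  set P := hV.primeIdealOf ⟨x, hx⟩ with hP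
  have hPx : hV.fromSpec P = x := hV.fromSpec_primeIdealOf ⟨x, hx⟩
  have hsP : s ∈ P.asIdeal := by
    by_contra h
    rw [← fromSpec_mem_basicOpen hV, hPx] at h
    have := inv_germ_mem_localRing hξ h
    rw [hs, inv_inv] at this
    exact hu this
  have hmin : P.asIdeal ∈ (Ideal.span {s}).minimalPrimes := by
    refine ⟨⟨P.isPrime, (Ideal.span_singleton_le_iff_mem _).mpr hsP⟩, fun Q hQ hQP => ?_⟩
    let q : PrimeSpectrum Γ(X.C, V) := ⟨Q, hQ.1⟩
    have hsp : hV.fromSpec q ⤳ x := by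
      have h1 : q ⤳ P := (PrimeSpectrum.le_iff_specializes q P).mp hQP
      exact hPx ▸ h1.map hV.fromSpec.continuous
    have hne : hV.fromSpec q ≠ genericPoint X.C := by
      intro h
      have hsq : s ∈ q.asIdeal := hQ.2 (Ideal.mem_span_singleton_self s)
      refine (not_not.mpr hsq) ((fromSpec_mem_basicOpen hV q s).mp ?_)
      rw [h, Scheme.mem_basicOpen _ _ _ hξ]
      exact (isUnit_iff_ne_zero (G₀ := X.C.functionField)).mpr hs0
    have : q = P := hV.fromSpec.isOpenEmbedding.injective
      ((X.eq_of_specializes hsp hne).trans hPx.symm)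
    exact (congrArg PrimeSpectrum.asIdeal this).ge
  -- The point is a component of the zero locus of s = u⁻¹, so its prime P is minimal over (s) and
  -- hence associated: P = (s : b) for some b. The desired function is b / s. At a point y ≠ x some
  -- σ in P is a unit, and σ b = s c gives b / s = c / σ.
  have hass : P.asIdeal ∈ associatedPrimes Γ(X.C, V) (Γ(X.C, V) ⧸ Ideal.span {s}) := by
    apply Module.associatedPrimes.minimalPrimes_annihilator_subset_associatedPrimes
    rwa [Ideal.annihilator_quotient]
  obtain ⟨-, b', hb'⟩ := isAssociatedPrime_iff.mp hass
  obtain ⟨b, rfl⟩ := Ideal.Quotient.mk_surjective b'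
  have hmem : ∀ σ, σ ∈ P.asIdeal ↔ ∃ c, σ * b = s * c := fun σ => by
    rw [hb', Submodule.mem_colon_singleton, Submodule.mem_bot]
    change Ideal.Quotient.mk _ (σ * b) = 0 ↔ _
    rw [Ideal.Quotient.eq_zero_iff_mem, Ideal.mem_span_singleton]
    rfl
  let γ := (X.C.presheaf.germ V (genericPoint X.C) hξ).hom
  refine ⟨γ b / γ s, fun h => ?_, fun y hy hyx => ?_⟩
  · rw [← hPx] at h
    obtain ⟨σ, r, hσ, hr⟩ := exists_mul_mem_of_localRing hV hξ P h
    refine hσ ((hmem σ).mpr ⟨r, germ_genericPoint_injective hξ ?_⟩)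
    change γ (σ * b) = γ (s * r)
    rw [map_mul, map_mul]
    change γ σ * (γ b / γ s) = γ r at hr
    rw [← hr, mul_comm (γ s), mul_assoc, div_mul_cancel₀ _ (show γ s ≠ 0 from hs0)]
  · obtain ⟨σ, hσP, hσy⟩ : ∃ σ ∈ P.asIdeal, y ∈ X.C.basicOpen σ := by
      by_contra! hall
      have hPy : hV.fromSpec (hV.primeIdealOf ⟨y, hy⟩) = y := hV.fromSpec_primeIdealOf ⟨y, hy⟩
      have hle : P ≤ hV.primeIdealOf ⟨y, hy⟩ := fun σ hσ => by
        have := hall σ hσ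
        rw [← hPy, fromSpec_mem_basicOpen, not_not] at this
        exact this
      have h1 := ((PrimeSpectrum.le_iff_specializes _ _).mp hle).map hV.fromSpec.continuous
      rw [hPx, hPy] at h1
      exact hyx (X.eq_of_specializes h1 hxξ).symm
    obtain ⟨c, hc⟩ := (hmem σ).mp hσP
    have hσ0 := germ_ne_zero_of_mem_basicOpen hξ hσy
    have : γ b / γ s = γ c * (γ σ)⁻¹ := by
      have h1 : γ σ * γ b = γ s * γ c := by rw [← map_mul, hc, map_mul]
      rw [div_eq_iff hs0, mul_right_comm, ← div_eq_mul_inv, eq_div_iff hσ0, mul_comm, h1, mul_comm]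
    rw [this]
    exact mul_mem (germ_mem_localRing hy hξ c) (inv_germ_mem_localRing hξ hσy)

/-- There is a rational function whose only pole is `∞`. -/
theorem exists_regularOpen_eq_affinePart :
    ∃ h : X.C.functionField, Transcendental F h ∧ regularOpen h = X.affinePart := by
  obtain ⟨u, hu⟩ := X.exists_notMem_localRing X.inf_ne_genericPoint
  have htr := X.transcendental_of_notMem hu
  have htr' : Transcendental F u⁻¹ := fun h => htr (IsAlgebraic.inv_iff.mp h)
  obtain ⟨Z, hZ⟩ := X.exists_finite_reg htr
  obtain ⟨e, he, he'⟩ := X.exists_unique_pole (X.finite_reg htr').1 (x := X.inf)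
    (inv_mem_localRing hu) X.inf_ne_genericPoint hu fun x hx => hx
  have heD : e ∈ X.reg (regularOpen u ⊓ regularOpen u⁻¹) := fun y hy =>
    he' y hy.2 fun h => hu (h ▸ hy.1)
  let M := Subalgebra.toSubmodule (X.reg (regularOpen u)) ⊔
        Subalgebra.toSubmodule (X.reg (regularOpen u⁻¹))
  -- The values at e of the polynomials X p span a finite-dimensional space modulo `M`, so some
  -- nonzero p has its value in `M`. The factor X guarantees that the polynomial is nonconstant.
  obtain ⟨P, hP, hPM⟩ : ∃ P : Polynomial F, P.natDegree ≠ 0 ∧ Polynomial.aeval e P ∈ M := by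
    let g : Polynomial F →ₗ[F] X.C.functionField ⧸ M :=
      M.mkQ ∘ₗ (Polynomial.aeval e).toLinearMap ∘ₗ LinearMap.mulLeft F Polynomial.X
    have hg : ∀ p, g p ∈ (Submodule.span F (Z : Set X.C.functionField)).map M.mkQ := fun p => by
      have h1 : Polynomial.aeval e (Polynomial.X * p) ∈
          X.reg (regularOpen u ⊓ regularOpen u⁻¹) := by
        exact fun y hy => X.aeval_mem_localRing (heD y hy) _
      obtain ⟨m, hm, z, hz, hmz⟩ := Submodule.mem_sup.mp (hZ _ h1)
      refine ⟨z, hz, ?_⟩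
      change _ = M.mkQ (Polynomial.aeval e (Polynomial.X * p))
      have hm0 : M.mkQ m = 0 := (Submodule.Quotient.mk_eq_zero M).mpr hm
      rw [← hmz, map_add, hm0, zero_add]
    have hninj : ¬ Function.Injective g := fun hinj => by
      have : Module.Finite F (Submodule.span F (Z : Set X.C.functionField)) :=
        Module.Finite.span_finset F Z
      have hfin := Module.Finite.of_injective (g.codRestrict _ hg)
        (fun p q hpq => hinj (congrArg Subtype.val hpq))
      exact Polynomial.not_finite hfin
    obtain ⟨p, hp, hp0⟩ : ∃ p, g p = 0 ∧ p ≠ 0 := by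
      by_contra! hall
      exact hninj ((injective_iff_map_eq_zero g).mpr hall)
    have hp' : M.mkQ (Polynomial.aeval e (Polynomial.X * p)) = 0 := hp
    rw [Submodule.mkQ_apply, Submodule.Quotient.mk_eq_zero] at hp'
    refine ⟨Polynomial.X * p, ?_, hp'⟩
    rw [Polynomial.natDegree_X_mul hp0]
    exact Nat.succ_ne_zero _
  obtain ⟨b, hb, b', hb', hbb⟩ := Submodule.mem_sup.mp hPM
  -- In P(e) = b + b', the summand b' is regular wherever u⁻¹ is, in particular at ∞. So b inherits
  -- the pole of P(e) at ∞; elsewhere it is regular, either because u is or as P(e) - b'.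
  have hbinf : b ∉ localRing X.inf := fun h => he (X.mem_localRing_of_aeval hP
    (hbb ▸ add_mem h (hb' _ (inv_mem_localRing hu))))
  refine ⟨b, X.transcendental_of_notMem hbinf, ?_⟩
  ext y
  constructor
  · intro hy h
    exact hbinf (Set.mem_singleton_iff.mp h ▸ hy)
  · intro hy
    by_cases hyu : y ∈ regularOpen u
    · exact hb y hyu
    · have hy2 : y ∈ regularOpen u⁻¹ := inv_mem_localRing hyu
      have h1 : Polynomial.aeval e P ∈ localRing y :=
        X.aeval_mem_localRing (he' y hy2 hy) P
      have : b = Polynomial.aeval e P - b' := by rw [← hbb]; ring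
      change b ∈ localRing y
      rw [this]
      exact sub_mem h1 (hb' y hy2)

end PointedCurve

/-! ### Coordinate rings of the affine part and of a neighbourhood of infinity -/

theorem exists_dvd_mul_of_localization {R L : Type*} [CommRing R] [IsNoetherianRing R] [CommRing L]
    [Algebra R L] (P : Ideal R) [P.IsPrime] [IsLocalization.AtPrime L P] [IsPrincipalIdealRing L] :
    ∃ a ∈ P, ∃ g ∉ P, ∀ p ∈ P, a ∣ g * p := by
  -- Take for `a` the numerator of a generator of the localized prime. Each of the finitely many
  -- generators of P is divisible by `a` after multiplication by some element outside P, and the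
  -- product of these elements serves as g.
  classical
  obtain ⟨w, hw⟩ := IsPrincipalIdealRing.principal (P.map (algebraMap R L))
  have hwP : w ∈ P.map (algebraMap R L) := hw ▸ Ideal.mem_span_singleton_self w
  obtain ⟨⟨⟨a, ha⟩, s⟩, has⟩ :=
    (IsLocalization.mem_map_algebraMap_iff P.primeCompl L).mp hwP
  have h1 : ∀ p : P, ∃ g ∉ P, a ∣ g * p := fun ⟨p, hp⟩ => by
    obtain ⟨c, hc⟩ := Ideal.mem_span_singleton.mp (hw.le (Ideal.mem_map_of_mem _ hp))
    obtain ⟨⟨r, s'⟩, hr⟩ := IsLocalization.surj P.primeCompl c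
    have h2 : algebraMap R L (p * (s * s')) = algebraMap R L (a * r) := by
      rw [map_mul, map_mul, map_mul, ← has, ← hr, hc]
      ring
    obtain ⟨t, ht⟩ := (IsLocalization.eq_iff_exists P.primeCompl L).mp h2
    refine ⟨t * (s * s'), (t * (s * s')).2, t * r, ?_⟩
    rw [mul_assoc, mul_comm _ p, ht, mul_left_comm]
  choose g hg hag using h1
  obtain ⟨T, hT⟩ := (inferInstance : IsNoetherian R P).noetherian ⊤
  refine ⟨a, ha, ∏ p ∈ T, g p, fun h => ?_, fun p hp => ?_⟩
  · obtain ⟨p, -, hp⟩ := (Ideal.IsPrime.prod_mem_iff (p := P)).mp h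
    exact hg p hp
  · have hpT : (⟨p, hp⟩ : P) ∈ Submodule.span R (T : Set P) := hT ▸ Submodule.mem_top
    suffices ∀ x ∈ Submodule.span R (T : Set P), a ∣ (∏ p ∈ T, g p) * x from this _ hpT
    intro x hx
    induction hx using Submodule.span_induction with
    | mem x hx => exact (hag x).trans (mul_dvd_mul_right (Finset.dvd_prod_of_mem g hx) _)
    | zero => simp
    | add x y _ _ hx hy => rw [Submodule.coe_add, mul_add]; exact dvd_add hx hy
    | smul c x _ hx => 
      rw [Submodule.coe_smul, smul_eq_mul, mul_left_comm]
      exact hx.mul_left c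

namespace PointedCurve

variable {F : Type u} [Field F] (X : PointedCurve F)

instance : Nonempty X.affinePart := ⟨⟨_, X.genericPoint_mem_affinePart⟩⟩

/-- The function h with sole pole ∞ has the affine part as its regular locus, so `finite_evalHom`
applies with V = C ∖ {∞}. -/
theorem exists_finite_aeval : ∃ h : X.A,
    (Polynomial.aeval h : Polynomial F →ₐ[F] X.A).toRingHom.Finite ∧
    Function.Injective (Polynomial.aeval h : Polynomial F →ₐ[F] X.A) ∧
    IsAffineOpen X.affinePart ∧
    X.C.presheaf.germ X.affinePart _ X.genericPoint_mem_affinePart h ∉ localRing X.inf := by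
  obtain ⟨h, htr, hU⟩ := X.exists_regularOpen_eq_affinePart
  obtain ⟨s, hs⟩ := exists_section_of_mem_localRing X.genericPoint_mem_affinePart h
    fun x hx => (hU.ge hx : x ∈ regularOpen h)
  have hinj := transcendental_iff_injective.mp htr
  obtain ⟨h1, h2⟩ := finite_evalHom X.π X.genericPoint_mem_affinePart s (by rw [hs, hU])
    (by rw [hs]; exact hinj)
  refine ⟨s, h2, fun p q hpq => hinj ?_, h1, fun hinf => ?_⟩
  · have e := fun p => (X.aeval_germ X.genericPoint_mem_affinePart s p).symm
    rw [hs] at e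
    exact (e p).symm.trans ((congrArg _ hpq).trans (e q))
  · rw [hs] at hinf
    exact hU.le (show X.inf ∈ regularOpen h from hinf) rfl

theorem isAffineOpen_affinePart : IsAffineOpen X.affinePart :=
  let ⟨_, _, _, h, _⟩ := X.exists_finite_aeval
  h

instance : IsNoetherianRing X.A :=
  IsLocallyNoetherian.component_noetherian ⟨_, X.isAffineOpen_affinePart⟩

instance : IsFractionRing X.A X.C.functionField :=
  functionField_isFractionRing_of_isAffineOpen _ _ X.isAffineOpen_affinePart

/-- An element integral over `A` is integral over every stalk of the affine part, hence regular
there. -/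
instance : IsIntegrallyClosed X.A := by
  refine (isIntegrallyClosed_iff X.C.functionField).mpr fun {e} he => ?_
  obtain ⟨r, hr⟩ := exists_section_of_mem_localRing X.genericPoint_mem_affinePart e fun x hx => by
    letI : Algebra X.A (X.C.presheaf.stalk x) :=
      (X.C.presheaf.germ X.affinePart x hx).hom.toAlgebra
    have : IsScalarTower X.A (X.C.presheaf.stalk x) X.C.functionField :=
      IsScalarTower.of_algebraMap_eq fun r =>
        (algebraMap_germ_genericPoint hx X.genericPoint_mem_affinePart r).symm
    exact IsIntegrallyClosed.isIntegral_iff.mp (he.tower_top (A := X.C.presheaf.stalk x))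
  exact ⟨r, hr⟩

/-- An affine neighbourhood of a closed point on which the point is defined by one equation. -/
theorem exists_uniformizer {V₀ : X.C.Opens} (hx₀ : X.inf ∈ V₀) :
    ∃ (V : X.C.Opens) (_ : V ≤ V₀) (_ : X.inf ∈ V) (_ : IsAffineOpen V) (ϖ : Γ(X.C, V)),
      ∀ r : Γ(X.C, V), X.inf ∉ X.C.basicOpen r ↔ ϖ ∣ r := by
  obtain ⟨U, hU, hxU, hUV⟩ := exists_isAffineOpen_mem_and_subset hx₀
  let P := (hU.primeIdealOf ⟨X.inf, hxU⟩).asIdeal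
  letI := TopCat.Presheaf.algebra_section_stalk X.C.presheaf ⟨X.inf, hxU⟩
  have hloc : IsLocalization.AtPrime (X.C.presheaf.stalk X.inf) P :=
    hU.isLocalization_stalk ⟨X.inf, hxU⟩
  have : IsNoetherianRing Γ(X.C, U) := IsLocallyNoetherian.component_noetherian ⟨U, hU⟩
  have hmem : ∀ r : Γ(X.C, U), X.inf ∈ X.C.basicOpen r ↔ r ∉ P := fun r => by
    have := fromSpec_mem_basicOpen hU (hU.primeIdealOf ⟨X.inf, hxU⟩) r
    rwa [hU.fromSpec_primeIdealOf] at this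
  obtain ⟨a, haP, g, hgP, hg⟩ : ∃ a ∈ P, ∃ g ∉ P, ∀ p ∈ P, a ∣ g * p :=
    exists_dvd_mul_of_localization (L := X.C.presheaf.stalk X.inf) P
  have hgx := (hmem g).mpr hgP
  have hle := X.C.basicOpen_le g
  let i := (homOfLE hle).op
  have hloc' := hU.isLocalization_basicOpen g
  refine ⟨X.C.basicOpen g, hle.trans hUV, hgx, hU.basicOpen g, X.C.presheaf.map i a, fun r => ?_⟩
  have hgu : IsUnit (X.C.presheaf.map i g) := RingedSpace.isUnit_res_basicOpen _ g
  have hbas : ∀ r : Γ(X.C, U), X.inf ∈ X.C.basicOpen (X.C.presheaf.map i r) ↔ r ∉ P := fun r => by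
    rw [X.C.basicOpen_res, ← hmem]
    exact ⟨fun h => h.2, fun h => ⟨hgx, h⟩⟩
  constructor
  · intro hr
    obtain ⟨⟨r₀, ⟨_, n, rfl⟩⟩, hr₀⟩ := IsLocalization.surj (Submonoid.powers g) r
    have hr₀' : r * X.C.presheaf.map i g ^ n = X.C.presheaf.map i r₀ := by
      rw [← map_pow]; exact hr₀
    have h1 : r₀ ∈ P := by
      by_contra h
      rw [← hbas, ← hr₀', Scheme.basicOpen_mul] at h
      exact hr h.1
    obtain ⟨c, hc⟩ := hg r₀ h1
    have h2 := congrArg (X.C.presheaf.map i) hc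
    rw [map_mul, map_mul, ← hr₀', mul_left_comm, ← pow_succ'] at h2
    have h3 : X.C.presheaf.map i a ∣ r * X.C.presheaf.map i g ^ (n + 1) := ⟨_, h2⟩
    exact (hgu.pow (n + 1)).dvd_mul_right.mp h3
  · rintro ⟨c, rfl⟩ h
    rw [Scheme.basicOpen_mul] at h
    exact (hbas a).mp h.1 haP

end PointedCurve

/-! ### The content of an element of A ⊗ K -/

section Content

variable {F A K : Type*} [Field F] [CommRing A] [Algebra F A] [Field K] [Algebra F K]

/-- Contraction of the first factor of `A ⊗ K` with a linear form. -/
noncomputable def contract (φ : A →ₗ[F] F) : A ⊗[F] K →ₗ[F] K :=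
  (TensorProduct.lid F K).toLinearMap ∘ₗ φ.rTensor K

theorem contract_tmul (φ : A →ₗ[F] F) (a : A) (c : K) : contract φ (a ⊗ₜ[F] c) = φ a • c := by
  simp [contract]

theorem contract_mul (φ : A →ₗ[F] F) (z : A ⊗[F] K) (c : K) :
    contract φ (z * (1 ⊗ₜ[F] c)) = contract φ z * c := by
  induction z using TensorProduct.induction_on with
  | zero => simp
  | tmul a d => simp [contract_tmul]
  | add x y hx hy => rw [add_mul, map_add, hx, hy, map_add, add_mul]

/-- The form takes values in `F`, where the q-power map is the identity. Thus τ acts on coordinates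
as the q-power map, whatever the basis of the first factor. -/
theorem contract_frob [Fintype F] (φ : A →ₗ[F] F) (z : A ⊗[F] K) :
    contract φ (Algebra.TensorProduct.map (AlgHom.id F A) (FiniteField.frobeniusAlgHom F K) z) =
      contract φ z ^ Fintype.card F := by
  induction z using TensorProduct.induction_on with
  | zero => simp
  | tmul a d =>
    simp only [Algebra.TensorProduct.map_tmul, contract_tmul, AlgHom.coe_id, id_eq,
      FiniteField.coe_frobeniusAlgHom]
    rw [Algebra.smul_def, Algebra.smul_def, mul_pow, ← map_pow, FiniteField.pow_card]
  | add x y hx hy =>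
    rw [map_add, map_add, hx, hy, map_add]
    exact (map_add (FiniteField.frobeniusAlgHom F K) _ _).symm

variable {ι : Type*} (b : Module.Basis ι F A)

theorem exists_eq_sum_tmul (z : A ⊗[F] K) : ∃ s : Finset ι,
    (∀ i ∉ s, contract (b.coord i) z = 0) ∧ z = ∑ i ∈ s, b i ⊗ₜ[F] contract (b.coord i) z := by
  classical
  induction z using TensorProduct.induction_on with
  | zero => exact ⟨∅, by simp, by simp⟩
  | tmul a c =>
    refine ⟨(b.repr a).support, fun i hi => ?_, ?_⟩
    · rw [contract_tmul, b.coord_apply, Finsupp.notMem_support_iff.mp hi, zero_smul]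
    · conv_lhs => rw [← b.linearCombination_repr a, Finsupp.linearCombination_apply, Finsupp.sum,
        TensorProduct.sum_tmul]
      refine Finset.sum_congr rfl fun i _ => ?_
      rw [contract_tmul, b.coord_apply, TensorProduct.smul_tmul]
  | add x y hx hy =>
    obtain ⟨s, hs0, hs⟩ := hx
    obtain ⟨t, ht0, ht⟩ := hy
    refine ⟨s ∪ t, fun i hi => ?_, ?_⟩
    · rw [Finset.notMem_union] at hi
      rw [map_add, hs0 i hi.1, ht0 i hi.2, add_zero]
    · simp only [map_add, TensorProduct.tmul_add, Finset.sum_add_distrib]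
      congr 1
      · conv_lhs => rw [hs]
        exact Finset.sum_subset Finset.subset_union_left fun i _ hi => by
          rw [hs0 i hi, TensorProduct.tmul_zero]
      · conv_lhs => rw [ht]
        exact Finset.sum_subset Finset.subset_union_right fun i _ hi => by
          rw [ht0 i hi, TensorProduct.tmul_zero]

variable [Algebra A K] [IsScalarTower F A K]

/-- The `A`-submodule of `K` generated by the coordinates of an element of `A ⊗ K`. -/
noncomputable def content (z : A ⊗[F] K) : Submodule A K :=
  Submodule.span A (Set.range fun i => contract (b.coord i) z)

theorem contract_mem_content (i : ι) (z : A ⊗[F] K) : contract (b.coord i) z ∈ content b z :=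
  Submodule.subset_span ⟨i, rfl⟩

/-- The ring homomorphism `A ⊗ A → A ⊗ K`. -/
noncomputable abbrev inclTensor (F A K : Type*) [Field F] [CommRing A] [Algebra F A] [Field K]
    [Algebra F K] [Algebra A K] [IsScalarTower F A K] : A ⊗[F] A →ₐ[F] A ⊗[F] K :=
  Algebra.TensorProduct.map (AlgHom.id F A) (IsScalarTower.toAlgHom F A K)

theorem content_add_le (x y : A ⊗[F] K) : content b (x + y) ≤ content b x ⊔ content b y := by
  refine Submodule.span_le.mpr ?_
  rintro _ ⟨i, rfl⟩
  simp only [map_add]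
  exact add_mem (Submodule.mem_sup_left (contract_mem_content b i x))
    (Submodule.mem_sup_right (contract_mem_content b i y))

/-- The coordinates of z (a ⊗ c) are `F`-combinations of those of z, multiplied by c in `A`: the
first factor only mixes coordinates through structure constants in `F`. -/
theorem content_mul_inclTensor_le (z : A ⊗[F] K) (w : A ⊗[F] A) :
    content b (z * inclTensor F A K w) ≤ content b z := by
  induction w using TensorProduct.induction_on with
  | zero =>
    refine Submodule.span_le.mpr ?_
    rintro _ ⟨i, rfl⟩
    simp
  | tmul a c =>
    refine Submodule.span_le.mpr ?_
    rintro _ ⟨i, rfl⟩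
    obtain ⟨s, -, hs⟩ := exists_eq_sum_tmul b z
    have : contract (b.coord i) (z * inclTensor F A K (a ⊗ₜ c)) =
        ∑ j ∈ s, (b.coord i (b j * a) • c) • contract (b.coord j) z := by
      conv_lhs => rw [hs]
      rw [Finset.sum_mul, map_sum]
      refine Finset.sum_congr rfl fun j _ => ?_
      rw [inclTensor, Algebra.TensorProduct.map_tmul, Algebra.TensorProduct.tmul_mul_tmul,
        contract_tmul, smul_assoc]
      congr 1
      rw [Algebra.smul_def, mul_comm]
      rfl
    simp only [this]
    exact sum_mem fun j _ => Submodule.smul_mem _ _ (contract_mem_content b j z)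
  | add x y hx hy =>
    rw [map_add, mul_add]
    exact (content_add_le b _ _).trans (sup_le hx hy)

/-- Integrality over A ⊗ A can be read off from the coordinates, since the basis elements sit in the
first factor. -/
theorem mem_range_inclTensor (z : A ⊗[F] K)
    (h : content b z ≤ LinearMap.range (Algebra.linearMap A K)) : ∃ w, inclTensor F A K w = z := by
  have : ∀ i, ∃ a : A, algebraMap A K a = contract (b.coord i) z := fun i =>
    h (contract_mem_content b i z)
  choose a ha using this
  obtain ⟨s, -, hs⟩ := exists_eq_sum_tmul b z
  refine ⟨∑ i ∈ s, b i ⊗ₜ a i, ?_⟩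
  rw [hs, map_sum]
  refine Finset.sum_congr rfl fun i _ => ?_
  rw [inclTensor, Algebra.TensorProduct.map_tmul, ← ha]
  rfl

theorem content_inclTensor_le (w : A ⊗[F] A) :
    content b (inclTensor F A K w) ≤ LinearMap.range (Algebra.linearMap A K) := by
  refine Submodule.span_le.mpr ?_
  rintro _ ⟨i, rfl⟩
  induction w using TensorProduct.induction_on with
  | zero => simp
  | tmul a c => 
    refine ⟨b.coord i a • c, ?_⟩
    simp only [inclTensor, Algebra.TensorProduct.map_tmul, contract_tmul, Algebra.linearMap_apply]
    exact map_smul (IsScalarTower.toAlgHom F A K) _ _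
  | add x y hx hy => 
    simp only [map_add] 
    exact add_mem hx hy

end Content

/-! ### Content is not lost by division by h ⊗ 1 - 1 ⊗ h -/

section Shift

variable {F A K : Type*} [Field F] [CommRing A] [Algebra F A] [Field K] [Algebra F K]
  [Algebra A K] [IsScalarTower F A K]

/-- For a basis of the form `h ^ i * ε j`, the content of `y` is contained in the content of
`(h ⊗ 1 - 1 ⊗ h) y`. -/
theorem content_le_content_mul {ι : Type*} (b : Module.Basis (ℕ × ι) F A) (h : A)
    (hb : ∀ i j, h * b (i, j) = b (i + 1, j)) (y : A ⊗[F] K) :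
    content b y ≤ content b (inclTensor F A K (h ⊗ₜ 1 - 1 ⊗ₜ h) * y) := by
  classical
  set δ := inclTensor F A K (h ⊗ₜ 1 - 1 ⊗ₜ h) with hδ
  have hcoord : ∀ i j a, b.coord (i + 1, j) (h * a) = b.coord (i, j) a := by
    intro i j a
    have : (b.coord (i + 1, j)) ∘ₗ (LinearMap.mulLeft F h) = b.coord (i, j) := by
      refine b.ext fun ⟨i', j'⟩ => ?_
      rw [LinearMap.comp_apply, LinearMap.mulLeft_apply, hb, b.coord_apply, b.coord_apply,
        b.repr_self, b.repr_self, Finsupp.single_apply, Finsupp.single_apply]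
      simp
    exact congr($this a)
  -- Multiplication by h ⊗ 1 shifts coordinates by one, so (δ y)_(i+1, j) = y_(i, j) - h y_(i+1, j).
  -- As y_(i, j) vanishes for large i, descending induction expresses the coordinates of y through
  -- those of δ y.
  have hrec : ∀ i j, contract (b.coord (i, j)) y =
      contract (b.coord (i + 1, j)) (δ * y) + h • contract (b.coord (i + 1, j)) y := by
    intro i j
    have h1 : δ * y = (h ⊗ₜ 1) * y - y * (1 ⊗ₜ algebraMap A K h) := by
      rw [hδ, map_sub, inclTensor, Algebra.TensorProduct.map_tmul, Algebra.TensorProduct.map_tmul,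
        sub_mul, mul_comm y]
      simp
    rw [h1, map_sub, contract_mul, Algebra.smul_def, mul_comm (algebraMap A K h), sub_add_cancel]
    clear h1
    induction y using TensorProduct.induction_on with
    | zero => simp
    | tmul a c =>
      rw [Algebra.TensorProduct.tmul_mul_tmul, contract_tmul, contract_tmul, hcoord, one_mul]
    | add x y hx hy => rw [mul_add, map_add, map_add, hx, hy]
  obtain ⟨s, hs, -⟩ := exists_eq_sum_tmul b y
  obtain ⟨N, hN⟩ : ∃ N : ℕ, ∀ i j, N ≤ i → contract (b.coord (i, j)) y = 0 := by
    refine ⟨s.sup Prod.fst + 1, fun i j hi => hs _ fun hmem => ?_⟩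
    have := Finset.le_sup (f := Prod.fst) hmem
    simp only at this
    omega
  have key : ∀ m i j, N ≤ i + m → contract (b.coord (i, j)) y ∈ content b (δ * y) := by
    intro m
    induction m with
    | zero => intro i j hi; rw [hN i j hi]; exact zero_mem _
    | succ m ih =>
      intro i j hi
      rw [hrec]
      exact add_mem (contract_mem_content b _ _)
        (Submodule.smul_mem _ _ (ih (i + 1) j (by omega)))
  refine Submodule.span_le.mpr ?_
  rintro _ ⟨⟨i, j⟩, rfl⟩
  exact key N i j (by omega)

end Shift

/-! ### An integrality criterion with Frobenius powers -/

section Integral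

/-- The ideals generated by the first elements d z^(q^m) form an ascending chain in a Noetherian
ring. Once it is stationary, z^(q^M) is a combination of lower powers of z, and this is a monic
equation because q > 1. -/
theorem isIntegral_of_mul_pow_mem {A K : Type*} [CommRing A] [IsNoetherianRing A] [Field K]
    [Algebra A K] {q : ℕ} (hq : 1 < q) {d : A} (hd : algebraMap A K d ≠ 0) {z : K}
    (h : ∀ m : ℕ, ∃ a : A, algebraMap A K d * z ^ q ^ m = algebraMap A K a) : IsIntegral A z := by
  choose a ha using h
  let N : ℕ →o Ideal A :=
    ⟨fun m => Ideal.span (a '' Set.Iio m), fun m n hmn => Ideal.span_mono (Set.image_mono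
      (Set.Iio_subset_Iio hmn))⟩
  obtain ⟨M, hM⟩ := monotone_stabilizes_iff_noetherian.mpr ‹IsNoetherianRing A› N
  have hmem : a M ∈ Ideal.span (a '' Set.Iio M) := by
    have := hM (M + 1) (Nat.le_succ M)
    change Ideal.span _ = Ideal.span _ at this
    rw [this]
    exact Ideal.subset_span ⟨M, Nat.lt_succ_self M, rfl⟩
  have h1 : a '' Set.Iio M = a '' (Finset.range M : Set ℕ) := by simp
  rw [h1] at hmem
  obtain ⟨c, hc⟩ := (Submodule.mem_span_image_finset_iff_exists_fun A).mp hmem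
  have hz : z ^ q ^ M = ∑ m : Finset.range M, algebraMap A K (c m) * z ^ q ^ (m : ℕ) := by
    apply mul_left_cancel₀ hd
    rw [ha, ← hc, map_sum, Finset.mul_sum]
    refine Finset.sum_congr rfl fun m _ => ?_
    rw [smul_eq_mul, map_mul, ← ha]
    ring
  refine ⟨Polynomial.X ^ q ^ M -
    ∑ m : Finset.range M, Polynomial.C (c m) * Polynomial.X ^ q ^ (m : ℕ), ?_, ?_⟩
  · refine Polynomial.monic_X_pow_sub ?_
    refine (Polynomial.degree_sum_le _ _).trans_lt ?_
    refine (Finset.sup_lt_iff (WithBot.bot_lt_coe _)).mpr fun m _ => ?_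
    refine (Polynomial.degree_C_mul_X_pow_le _ _).trans_lt ?_
    exact_mod_cast Nat.pow_lt_pow_right hq (Finset.mem_range.mp m.2)
  · rw [Polynomial.eval₂_sub, Polynomial.eval₂_X_pow, Polynomial.eval₂_finsetSum, hz, sub_eq_zero]
    refine Finset.sum_congr rfl fun m _ => ?_
    rw [Polynomial.eval₂_mul, Polynomial.eval₂_C, Polynomial.eval₂_X_pow]

end Integral

/-! ### Generic fibres and Frobenius pullbacks -/

section Generic

variable {R : Type u} [CommRing R]

theorem toGeneric_injective (M : Type u) [AddCommGroup M] [Module R M] [Module.Flat R M] :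
    Function.Injective (toGeneric R M) := by
  have h : toGeneric R M = (Algebra.linearMap R (FractionRing R)).rTensor M ∘ₗ
      (TensorProduct.lid R M).symm.toLinearMap := by
    ext m
    simp [toGeneric]
  rw [h]
  exact (Module.Flat.rTensor_preserves_injective_linearMap _
    (IsFractionRing.injective R (FractionRing R))).comp (TensorProduct.lid R M).symm.injective

theorem frobUnit_smul (τ : R →+* R) (M : Type u) [AddCommGroup M] [Module R M] (r : R) (m : M) :
    frobUnit τ M (r • m) = τ r • frobUnit τ M m := by
  let o : (ModuleCat.restrictScalars τ).obj (ModuleCat.of R R) := (1 : R)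
  have h1 : frobUnit τ M (r • m) = TensorProduct.tmul R (r • o) m :=
    (TensorProduct.smul_tmul r o m).symm
  rw [h1]
  exact (ModuleCat.ExtendScalars.smul_tmul (M := ModuleCat.of R M) τ (τ r) (1 : R) m).symm

/-- The linear map on `τ^* M` that is induced by a `τ`-semilinear map on `M`. -/
theorem exists_frobPullback_lift (τ : R →+* R) (M : Type u) [AddCommGroup M] [Module R M]
    (P : Type u) [AddCommGroup P] [Module R P] (g : M →+ P) (hg : ∀ r m, g (r • m) = τ r • g m) :
    ∃ β : FrobPullback τ M →ₗ[R] P, ∀ m, β (frobUnit τ M m) = g m := by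
  let g' : ModuleCat.of R M ⟶ (ModuleCat.restrictScalars τ).obj (ModuleCat.of R P) :=
    ModuleCat.ofHom (Y := (ModuleCat.restrictScalars τ).obj (ModuleCat.of R P))
      { toFun := g, map_add' := g.map_add, map_smul' := hg }
  refine ⟨(((ModuleCat.extendRestrictScalarsAdj τ).homEquiv _ _).symm g').hom, fun m => ?_⟩
  have := ((ModuleCat.extendRestrictScalarsAdj τ).homEquiv _ _).apply_symm_apply g'
  exact congr($this m)

end Generic

/-! ### Denominators in A ⊗ K and the basis of A over the base field -/

namespace PointedCurve

variable {F : Type u} [Field F] (X : PointedCurve F)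

theorem inclTensor_injective : Function.Injective (inclTensor F X.A X.K) := by
  have h : (inclTensor F X.A X.K).toLinearMap =
      (IsScalarTower.toAlgHom F X.A X.K).toLinearMap.lTensor X.A := by
    ext a b
    simp
  have := Module.Flat.lTensor_preserves_injective_linearMap (M := X.A)
    (IsScalarTower.toAlgHom F X.A X.K).toLinearMap (IsFractionRing.injective X.A X.K)
  rw [← h] at this
  exact this

theorem algebraMap_AK (w : X.AA) : algebraMap X.AA X.AK w = inclTensor F X.A X.K w := rfl

/-- The function `1 ⊗ b` on `Spec A × Spec A`. -/
noncomputable abbrev right (b : X.A) : X.AA := 1 ⊗ₜ b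

theorem algebraMap_right (b : X.A) :
    algebraMap X.AA X.AK (X.right b) = 1 ⊗ₜ algebraMap X.A X.K b := rfl

theorem isUnit_algebraMap_right {b : X.A} (hb : b ≠ 0) :
    IsUnit (algebraMap X.AA X.AK (X.right b)) := by
  have hb' : algebraMap X.A X.K b ≠ 0 :=
    fun h => hb (IsFractionRing.injective X.A X.K (h.trans (map_zero _).symm))
  refine IsUnit.of_mul_eq_one (1 ⊗ₜ (algebraMap X.A X.K b)⁻¹) ?_
  rw [algebraMap_right, Algebra.TensorProduct.tmul_mul_tmul, mul_one, mul_inv_cancel₀ hb']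
  rfl

theorem exists_right_mul_eq (z : X.AK) :
    ∃ b : X.A, b ≠ 0 ∧ ∃ w : X.AA, algebraMap X.AA X.AK w = algebraMap X.AA X.AK (X.right b) * z := by
  induction z using TensorProduct.induction_on with
  | zero => exact ⟨1, one_ne_zero, 0, by simp⟩
  | tmul a c =>
    obtain ⟨r, s, hs, rfl⟩ := IsFractionRing.div_surjective (A := X.A) c
    have hs0 : s ≠ 0 := nonZeroDivisors.ne_zero hs
    refine ⟨s, hs0, a ⊗ₜ r, ?_⟩
    rw [algebraMap_right, Algebra.TensorProduct.tmul_mul_tmul, one_mul, mul_div_cancel₀]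
    · rfl
    · exact fun h => hs0 (IsFractionRing.injective X.A X.K (h.trans (map_zero _).symm))
  | add x y hx hy =>
    obtain ⟨b, hb, w, hw⟩ := hx
    obtain ⟨b', hb', w', hw'⟩ := hy
    refine ⟨b * b', mul_ne_zero hb hb', X.right b' * w + X.right b * w', ?_⟩
    have : X.right (b * b') = X.right b * X.right b' := by
      simp [right]
    rw [map_add, map_mul, map_mul, hw, hw', this, map_mul]
    ring

/-- Elements of `A ⊗ K` have a common denominator. -/
theorem exists_right_mul_eq_of_finite {ι : Type*} [Finite ι] (z : ι → X.AK) :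
    ∃ b : X.A, b ≠ 0 ∧ ∀ i, ∃ w : X.AA,
      algebraMap X.AA X.AK w = algebraMap X.AA X.AK (X.right b) * z i := by
  classical
  have := Fintype.ofFinite ι
  choose b hb w hw using fun i => X.exists_right_mul_eq (z i)
  refine ⟨∏ i, b i, Finset.prod_ne_zero_iff.mpr fun i _ => hb i, fun i => ?_⟩
  refine ⟨X.right (∏ j ∈ Finset.univ.erase i, b j) * w i, ?_⟩
  have : X.right (∏ i, b i) = X.right (∏ j ∈ Finset.univ.erase i, b j) * X.right (b i) := by
    rw [← Finset.prod_erase_mul _ _ (Finset.mem_univ i)]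
    simp [right]
  rw [map_mul, hw, this, map_mul, mul_assoc]

instance : Algebra.FiniteType F X.A := by
  obtain ⟨h, h1, -⟩ := X.exists_finite_aeval
  letI := (Polynomial.aeval h : Polynomial F →ₐ[F] X.A).toRingHom.toAlgebra
  have : IsScalarTower F (Polynomial F) X.A := IsScalarTower.of_algebraMap_eq fun r =>
    ((Polynomial.aeval h : Polynomial F →ₐ[F] X.A).commutes r).symm
  have : Module.Finite (Polynomial F) X.A := h1
  exact Algebra.FiniteType.trans (S := Polynomial F) inferInstance inferInstance

instance : IsNoetherianRing X.AA := Algebra.FiniteType.isNoetherianRing X.A X.AA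

/-- A basis of `A` over `F` of the form `h ^ i * ε j`. -/
theorem exists_basis : ∃ (h : X.A) (n : ℕ) (b : Module.Basis (ℕ × Fin n) F X.A),
    ∀ i j, h * b (i, j) = b (i + 1, j) := by
  obtain ⟨h, h1, h2, -⟩ := X.exists_finite_aeval
  letI := (Polynomial.aeval h : Polynomial F →ₐ[F] X.A).toRingHom.toAlgebra
  have : IsScalarTower F (Polynomial F) X.A := IsScalarTower.of_algebraMap_eq fun r =>
    ((Polynomial.aeval h : Polynomial F →ₐ[F] X.A).commutes r).symm
  have : Module.Finite (Polynomial F) X.A := h1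
  have : Module.IsTorsionFree (Polynomial F) X.A :=
    Module.isTorsionFree_iff_algebraMap_injective.mpr h2
  obtain ⟨n, ε⟩ := Module.basisOfFiniteTypeTorsionFree' (R := Polynomial F) (M := X.A)
  refine ⟨h, n, (Polynomial.basisMonomials F).smulTower ε, fun i j => ?_⟩
  rw [Module.Basis.smulTower_apply, Module.Basis.smulTower_apply, Polynomial.coe_basisMonomials]
  have e : ∀ i, (Polynomial.monomial i (1 : F)) • ε j = h ^ i * ε j := fun i => by
    rw [Algebra.smul_def]
    refine congrArg (· * ε j) ?_
    change Polynomial.aeval h (Polynomial.monomial i (1 : F)) = _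
    rw [Polynomial.aeval_monomial, map_one, one_mul]
  rw [e, e, pow_succ', mul_assoc]

end PointedCurve

/-- The inverse of an isomorphism `N[J⁻¹] ≃ M[J⁻¹]`, followed by a linear map on `N`. -/
theorem exists_inverse_of_modulePoles_equiv {R : Type u} [CommRing R] {J : Ideal R} {δ : R}
    (hδ : δ ∈ J) {M N P : Type u} [AddCommGroup M] [Module R M] [AddCommGroup N] [Module R N]
    [AddCommGroup P] [Module R P] (τ : modulePoles J N ≃ₗ[R] modulePoles J M) (β : N →ₗ[R] P) :
    ∃ ρ : M →ₗ[R] Generic R P,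
      (∀ m, ∃ (n : ℕ) (v : P), δ ^ n • ρ m = toGeneric R P v) ∧
      ∀ (x : N) (y : M) (n : ℕ),
        toGeneric R M y = δ ^ n • (τ ⟨toGeneric R N x,
          le_poles _ _ (LinearMap.mem_range_self _ x)⟩ : Generic R M) →
        ρ y = δ ^ n • toGeneric R P (β x) := by
  let inc : M →ₗ[R] modulePoles J M :=
    (toGeneric R M).codRestrict _ (fun t => le_poles _ _ (LinearMap.mem_range_self _ t))
  let βQ : Generic R N →ₗ[R] Generic R P := β.lTensor (FractionRing R)
  have hβQ : ∀ t, βQ (toGeneric R N t) = toGeneric R P (β t) := fun t =>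
    LinearMap.lTensor_tmul _ _ _ _
  refine ⟨βQ ∘ₗ (modulePoles J N).subtype ∘ₗ τ.symm.toLinearMap ∘ₗ inc, fun m => ?_,
    fun x y n hxy => ?_⟩
  · obtain ⟨n, hn⟩ := (τ.symm (inc m)).2
    obtain ⟨t, ht⟩ := hn _ (Ideal.pow_mem_pow hδ n)
    refine ⟨n, β t, ?_⟩
    rw [← hβQ, ht, map_smul]
    rfl
  · let u : modulePoles J N :=
      ⟨toGeneric R N x, le_poles _ _ (LinearMap.mem_range_self _ x)⟩
    have h1 : inc y = δ ^ n • τ u := Subtype.ext hxy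
    have h2 : τ.symm (inc y) = δ ^ n • u := by
      rw [h1, map_smul, LinearEquiv.symm_apply_apply]
    change βQ (τ.symm (inc y) : Generic R N) = _
    rw [h2, Submodule.coe_smul, map_smul, hβQ]

/-! ### The inverse of τ_M in coordinates -/

namespace AMotive

variable {F : Type u} [Field F] [Fintype F] {X : PointedCurve F} (E : AMotive X)

instance : Module.Finite X.AK E.M := E.finite
instance : Module.Projective X.AK E.M := E.projective

theorem algebraMap_smul_toGeneric (w : X.AA) (y : Generic X.AK E.M) :
    w • y = algebraMap X.AA X.AK w • y := by
  rw [algebraMap_smul]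

theorem τSemi_smul (r : X.AK) (m : E.M) : E.τSemi (r • m) = X.frobAK r • E.τSemi m := by
  rw [τSemi, frobUnit_smul, map_smul, τSemi]

theorem τSemi_zero : E.τSemi 0 = 0 := by
  have := E.τSemi_add 0 0
  rwa [add_zero, left_eq_add] at this

/-- The difference `h ⊗ 1 - 1 ⊗ h`. -/
noncomputable def _root_.ShtukaModels.PointedCurve.diff (X : PointedCurve F) (h : X.A) : X.AA :=
  h ⊗ₜ 1 - 1 ⊗ₜ h

theorem _root_.ShtukaModels.PointedCurve.diff_mem_jA (X : PointedCurve F) (h : X.A) :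
    X.diff h ∈ X.jA := by
  rw [PointedCurve.jA, RingHom.mem_ker, PointedCurve.diff, map_sub]
  simp

theorem _root_.ShtukaModels.PointedCurve.diff_mem_jK (X : PointedCurve F) (h : X.A) :
    algebraMap X.AA X.AK (X.diff h) ∈ X.jK := by
  rw [PointedCurve.jK, RingHom.mem_ker, PointedCurve.diff, map_sub, map_sub]
  change X.inclK h * X.inclK 1 - X.inclK 1 * X.inclK h = 0
  rw [mul_comm, sub_self]

/-- A presentation of `M` as a direct summand of a free module. -/
theorem exists_retract : ∃ (r : ℕ) (i : E.M →ₗ[X.AK] (Fin r → X.AK))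
    (p : (Fin r → X.AK) →ₗ[X.AK] E.M), p ∘ₗ i = LinearMap.id := by
  obtain ⟨r, p, hp⟩ := Module.Finite.exists_fin' X.AK E.M
  obtain ⟨i, hi⟩ := Module.projective_lifting_property p LinearMap.id hp
  exact ⟨r, i, p, hi⟩

/-- The inverse of `τ_M` in coordinates, up to a power of `h ⊗ 1 - 1 ⊗ h`. -/
theorem exists_inverse (h : X.A) {r : ℕ} (i : E.M →ₗ[X.AK] (Fin r → X.AK)) :
    ∃ ρ : E.M →ₗ[X.AK] Generic X.AK (Fin r → X.AK),
      (∀ m, ∃ (n : ℕ) (v : Fin r → X.AK), algebraMap X.AA X.AK (X.diff h) ^ n • ρ m =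
        toGeneric X.AK (Fin r → X.AK) v) ∧
      ∀ (x y : E.M) (n : ℕ),
        toGeneric X.AK E.M y = algebraMap X.AA X.AK (X.diff h) ^ n • E.τSemi x →
        ρ y = algebraMap X.AA X.AK (X.diff h) ^ n •
          toGeneric X.AK (Fin r → X.AK) fun k => X.frobAK (i x k) := by
  -- This semilinear map linearizes to the pullback of `i` along τ. Composing it with the inverse of
  -- τ_M recovers the Frobenius twist of the coordinates of x from δ^n τ_M(x).
  let g : E.M →+ (Fin r → X.AK) :=
    { toFun := fun x k => X.frobAK (i x k)
      map_zero' := by ext; simp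
      map_add' := fun x y => by ext; simp }
  obtain ⟨β, hβ⟩ := exists_frobPullback_lift X.frobAK E.M (Fin r → X.AK) g
    fun a m => by ext k; simp [g]
  obtain ⟨ρ, h1, h2⟩ := exists_inverse_of_modulePoles_equiv (X.diff_mem_jK h) E.τ β
  refine ⟨ρ, h1, fun x y n hxy => ?_⟩
  rw [h2 (frobUnit X.frobAK E.M x) y n hxy, hβ]
  rfl

end AMotive

/-! ### Contents of vectors and the denominator estimate -/

section VectorContent

variable {F A K : Type*} [Field F] [CommRing A] [Algebra F A] [Field K] [Algebra F K]
  [Algebra A K] [IsScalarTower F A K] {ι : Type*} (b : Module.Basis ι F A) {r : ℕ}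

/-- The `A`-submodule of `K` generated by the coordinates of a vector over `A ⊗ K`. -/
noncomputable def vecContent (v : Fin r → A ⊗[F] K) : Submodule A K :=
  ⨆ k, content b (v k)

theorem content_le_vecContent (v : Fin r → A ⊗[F] K) (k : Fin r) :
    content b (v k) ≤ vecContent b v := le_iSup (fun k => content b (v k)) k

theorem vecContent_le {v : Fin r → A ⊗[F] K} {N : Submodule A K}
    (h : ∀ k i, contract (b.coord i) (v k) ∈ N) : vecContent b v ≤ N := by
  refine iSup_le fun k => Submodule.span_le.mpr ?_
  rintro _ ⟨i, rfl⟩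
  exact h k i

theorem content_sum_le {κ : Type*} (s : Finset κ) (z : κ → A ⊗[F] K) {N : Submodule A K}
    (h : ∀ k ∈ s, content b (z k) ≤ N) : content b (∑ k ∈ s, z k) ≤ N := by
  classical
  induction s using Finset.induction_on with
  | empty =>
    refine Submodule.span_le.mpr ?_
    rintro _ ⟨i, rfl⟩
    simp
  | insert a s ha ih =>
    rw [Finset.sum_insert ha]
    exact (content_add_le b _ _).trans (sup_le (h a (Finset.mem_insert_self a s))
      (ih fun k hk => h k (Finset.mem_insert_of_mem hk)))

end VectorContent

/-- A linear map from a summand of a free module to a module with poles along `δ` is given by a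
matrix, up to a power of `δ`. -/
theorem exists_matrix_of_generic {R : Type u} [CommRing R] {M : Type u} [AddCommGroup M]
    [Module R M] {δ : R} {r : ℕ} (i : M →ₗ[R] (Fin r → R)) (p : (Fin r → R) →ₗ[R] M)
    (hip : p ∘ₗ i = LinearMap.id) (ρ : M →ₗ[R] Generic R (Fin r → R))
    (hρ : ∀ m, ∃ (n : ℕ) (v : Fin r → R), δ ^ n • ρ m = toGeneric R (Fin r → R) v) :
    ∃ (N : ℕ) (v : Fin r → Fin r → R), ∀ (y : M) (n : ℕ) (x : Fin r → R),
      ρ y = δ ^ n • toGeneric R (Fin r → R) x → ∀ k, δ ^ (N + n) * x k = ∑ l, i y l * v l k := by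
  classical
  have hv : ∃ (N : ℕ) (v : Fin r → Fin r → R), ∀ k,
      δ ^ N • ρ (p (Pi.single k 1)) = toGeneric R (Fin r → R) (v k) := by
    choose n v hnv using fun k => hρ (p (Pi.single k 1))
    refine ⟨Finset.univ.sup n, fun k => δ ^ (Finset.univ.sup n - n k) • v k, fun k => ?_⟩
    rw [map_smul, ← hnv, smul_smul, ← pow_add,
      Nat.sub_add_cancel (Finset.le_sup (Finset.mem_univ k))]
  obtain ⟨N, v, hv⟩ := hv
  refine ⟨N, v, fun y n x hxy => ?_⟩
  have hsum : y = ∑ k, i y k • p (Pi.single k 1) := by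
    conv_lhs => rw [← LinearMap.id_apply (R := R) y, ← hip, LinearMap.comp_apply,
      pi_eq_sum_univ' (i y)]
    rw [map_sum]
    exact Finset.sum_congr rfl fun k _ => by
      rw [← map_smul]
  have h1 : δ ^ N • ρ y = toGeneric R (Fin r → R) (∑ l, i y l • v l) := by
    conv_lhs => rw [hsum]
    rw [map_sum, map_sum, Finset.smul_sum]
    refine Finset.sum_congr rfl fun l _ => ?_
    rw [map_smul, smul_comm, hv, map_smul]
  rw [hxy, smul_smul, ← pow_add, ← map_smul] at h1
  have h2 := toGeneric_injective _ h1
  intro k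
  have h3 := congr($h2 k)
  simpa using h3

namespace AMotive

variable {F : Type u} [Field F] [Fintype F] {X : PointedCurve F} (E : AMotive X)

/-- Denominators of the inverse of `τ_M`: the key estimate for integral models. -/
theorem exists_denominator {h : X.A} {s r : ℕ} (b : Module.Basis (ℕ × Fin s) F X.A)
    (hb : ∀ i j, h * b (i, j) = b (i + 1, j)) (i : E.M →ₗ[X.AK] (Fin r → X.AK))
    (p : (Fin r → X.AK) →ₗ[X.AK] E.M) (hip : p ∘ₗ i = LinearMap.id) :
    ∃ β : X.A, β ≠ 0 ∧ ∀ (x y : E.M) (n : ℕ),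
      toGeneric X.AK E.M y = algebraMap X.AA X.AK (X.diff h) ^ n • E.τSemi x →
      ∀ c ∈ vecContent b (i x), algebraMap X.A X.K β * c ^ Fintype.card F ∈ vecContent b (i y) := by
  classical
  obtain ⟨ρ, hρ1, hρ2⟩ := E.exists_inverse h i
  set δ := algebraMap X.AA X.AK (X.diff h) with hδ
  obtain ⟨N, v, hNv⟩ := exists_matrix_of_generic (δ := δ) i p hip ρ hρ1
  have key : ∀ (x y : E.M) (n : ℕ), toGeneric X.AK E.M y = δ ^ n • E.τSemi x →
      ∀ k, δ ^ (N + n) * X.frobAK (i x k) = ∑ l, i y l * v l k := fun x y n hxy =>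
    hNv y n _ (hρ2 x y n hxy)
  obtain ⟨β, hβ0, hβ⟩ := X.exists_right_mul_eq_of_finite fun lk : Fin r × Fin r => v lk.1 lk.2
  refine ⟨β, hβ0, fun x y n hxy => ?_⟩
  let V := vecContent b (i y)
  -- The q-power map is additive, and an `A`-multiple comes out as its q-th power. So the condition
  -- defines a submodule and need only be checked on coordinates.
  let N' : Submodule X.A X.K :=
    { carrier := {c | algebraMap X.A X.K β * c ^ Fintype.card F ∈ V}
      zero_mem' := by
        change _ ∈ V
        rw [zero_pow Fintype.card_ne_zero, mul_zero]
        exact zero_mem _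
      add_mem' := fun {c d} hc hd => by
        change _ ∈ V
        have : (c + d) ^ Fintype.card F = c ^ Fintype.card F + d ^ Fintype.card F :=
          map_add (FiniteField.frobeniusAlgHom F X.K) c d
        rw [this, mul_add]
        exact add_mem hc hd
      smul_mem' := fun a c hc => by
        change _ ∈ V
        rw [Algebra.smul_def, mul_pow, mul_left_comm, ← map_pow, ← Algebra.smul_def]
        exact V.smul_mem _ hc }
  refine vecContent_le b (N := N') fun k j => ?_
  change _ ∈ V
  have h1 : contract (b.coord j) (i x k) ^ Fintype.card F =
      contract (b.coord j) (X.frobAK (i x k)) := (contract_frob (b.coord j) (i x k)).symm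
  -- The power of δ clearing the poles of the inverse varies with n, but it can be dropped: the
  -- content of a vector is bounded by that of any δ-power multiple of it. This makes β independent
  -- of x, y and n.
  have h2 : ∀ m, content b (X.frobAK (i x k)) ≤ content b (δ ^ m * X.frobAK (i x k)) := by
    intro m
    induction m with
    | zero => rw [pow_zero, one_mul]
    | succ m ih =>
      rw [pow_succ', mul_assoc]
      exact ih.trans (content_le_content_mul b h hb _)
  have h3 := h2 (N + n) (contract_mem_content b j (X.frobAK (i x k)))
  rw [key x y n hxy, ← h1] at h3
  -- β clears the matrix entries, so each term becomes a coordinate of y times an element of A ⊗ A,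
  -- and such a factor does not enlarge the content.
  have h4 : content b ((∑ l, i y l * v l k) * (1 ⊗ₜ algebraMap X.A X.K β)) ≤ V := by
    rw [Finset.sum_mul]
    refine content_sum_le b _ _ fun l _ => ?_
    obtain ⟨w, hw⟩ := hβ (l, k)
    have e : i y l * v l k * (1 ⊗ₜ algebraMap X.A X.K β) = i y l * inclTensor F X.A X.K w := by
      rw [mul_assoc, mul_comm (v l k)]
      exact congrArg (i y l * ·) hw.symm
    rw [e]
    exact (content_mul_inclTensor_le b _ w).trans (content_le_vecContent b _ l)
  have h5 : ∀ c ∈ content b (∑ l, i y l * v l k), algebraMap X.A X.K β * c ∈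
      content b ((∑ l, i y l * v l k) * (1 ⊗ₜ algebraMap X.A X.K β)) := by
    intro c hc
    induction hc using Submodule.span_induction with
    | mem c hc =>
      obtain ⟨j, rfl⟩ := hc
      change algebraMap X.A X.K β * contract (b.coord j) _ ∈ _
      rw [mul_comm (algebraMap X.A X.K β), ← contract_mul]
      exact contract_mem_content b j _
    | zero => rw [mul_zero]; exact zero_mem _
    | add c d _ _ hc hd => rw [mul_add]; exact add_mem hc hd
    | smul a c _ hc =>
      rw [mul_smul_comm]
      exact Submodule.smul_mem _ _ hc
  exact h4 (h5 _ h3)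

end AMotive

/-! ### Existence of the maximal integral model -/

namespace AMotive

variable {F : Type u} [Field F] [Fintype F] {X : PointedCurve F} (E : AMotive X)

theorem smul_eq_algebraMap_smul (w : X.AA) (m : E.M) : w • m = algebraMap X.AA X.AK w • m := rfl

theorem toGeneric_smul (w : X.AA) (m : E.M) :
    toGeneric X.AK E.M (w • m) = w • toGeneric X.AK E.M m :=
  ((toGeneric X.AK E.M).restrictScalars X.AA).map_smul w m

theorem exists_pow_diff_smul {L : Submodule X.AA E.M} (hL : E.IsIntegralModel L) (h : X.A)
    {x : E.M} (hx : x ∈ L) : ∃ y ∈ L, ∃ n : ℕ,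
      toGeneric X.AK E.M y = algebraMap X.AA X.AK (X.diff h) ^ n • E.τSemi x := by
  obtain ⟨n, hn⟩ := hL.stable (Submodule.subset_span ⟨x, hx, rfl⟩)
  obtain ⟨y, hy, hyn⟩ := hn _ (Ideal.pow_mem_pow (X.diff_mem_jA h) n)
  refine ⟨y, hy, n, ?_⟩
  rw [← map_pow, ← algebraMap_smul_toGeneric]
  exact hyn

/-- Finitely generated submodules have bounded denominators. -/
theorem exists_right_mul_of_fg {L : Submodule X.AA E.M} (hL : L.FG) {r : ℕ}
    (i : E.M →ₗ[X.AK] (Fin r → X.AK)) : ∃ d : X.A, d ≠ 0 ∧ ∀ x ∈ L, ∀ k, ∃ w : X.AA,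
      algebraMap X.AA X.AK w = algebraMap X.AA X.AK (X.right d) * i x k := by
  obtain ⟨T, rfl⟩ := hL
  obtain ⟨d, hd, h⟩ := X.exists_right_mul_eq_of_finite fun p : T × Fin r => i p.1 p.2
  refine ⟨d, hd, fun x hx k => ?_⟩
  induction hx using Submodule.span_induction with
  | mem x hx => exact h (⟨x, hx⟩, k)
  | zero => exact ⟨0, by simp⟩
  | add x y _ _ hx hy =>
    obtain ⟨w, hw⟩ := hx
    obtain ⟨w', hw'⟩ := hy
    exact ⟨w + w', by rw [map_add, hw, hw', map_add, Pi.add_apply, mul_add]⟩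
  | smul a x _ hx =>
    obtain ⟨w, hw⟩ := hx
    refine ⟨a * w, ?_⟩
    rw [smul_eq_algebraMap_smul, map_smul, map_mul, hw, Pi.smul_apply, smul_eq_mul]
    ring

/-- The lattice of the elements whose coordinates have denominator `β`. -/
noncomputable def boundingLattice (β : X.A) {r : ℕ} (i : E.M →ₗ[X.AK] (Fin r → X.AK)) :
    Submodule X.AA E.M where
  carrier := {x | ∀ k, ∃ w : X.AA,
    algebraMap X.AA X.AK w = algebraMap X.AA X.AK (X.right β) * i x k}
  zero_mem' k := ⟨0, by simp⟩
  add_mem' {x y} hx hy k := by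
    obtain ⟨w, hw⟩ := hx k
    obtain ⟨w', hw'⟩ := hy k
    exact ⟨w + w', by rw [map_add, hw, hw', map_add, Pi.add_apply, mul_add]⟩
  smul_mem' a x hx k := by
    obtain ⟨w, hw⟩ := hx k
    refine ⟨a * w, ?_⟩
    rw [smul_eq_algebraMap_smul, map_smul, map_mul, hw, Pi.smul_apply, smul_eq_mul]
    ring

/-- Multiplication of the coordinates by β embeds the lattice in a finite free module over the
Noetherian ring A ⊗ A. -/
theorem isNoetherian_boundingLattice {β : X.A} (hβ : β ≠ 0) {r : ℕ}
    (i : E.M →ₗ[X.AK] (Fin r → X.AK)) (hi : Function.Injective i) :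
    IsNoetherian X.AA (E.boundingLattice β i) := by
  choose w hw using fun x : E.boundingLattice β i => x.2
  let g : E.boundingLattice β i →ₗ[X.AA] (Fin r → X.AA) :=
    { toFun := w
      map_add' := fun x y => by
        ext k
        apply X.inclTensor_injective
        change algebraMap X.AA X.AK _ = algebraMap X.AA X.AK _
        rw [hw, Pi.add_apply, map_add, hw, hw, Submodule.coe_add, map_add, Pi.add_apply, mul_add]
      map_smul' := fun a x => by
        ext k
        apply X.inclTensor_injective
        change algebraMap X.AA X.AK _ = algebraMap X.AA X.AK _
        rw [hw, RingHom.id_apply, Pi.smul_apply, smul_eq_mul, map_mul, hw, Submodule.coe_smul,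
          smul_eq_algebraMap_smul, map_smul, Pi.smul_apply, smul_eq_mul]
        ring }
  refine isNoetherian_of_injective g fun x y hxy => Subtype.ext (hi (funext fun k => ?_))
  have h1 : algebraMap X.AA X.AK (X.right β) * i x k =
      algebraMap X.AA X.AK (X.right β) * i y k := by
    rw [← hw, ← hw]
    exact congrArg _ (congrFun hxy k)
  exact (X.isUnit_algebraMap_right hβ).mul_left_cancel h1

/-- The bound β comes from the motive, whereas the denominator d depends on L. All powers (β
c)^(q^m) have the same denominator d, so β c is integral over the integrally closed ring `A`, and d
disappears from the conclusion. -/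
theorem IsIntegralModel.le_boundingLattice {h : X.A} {s r : ℕ}
    (b : Module.Basis (ℕ × Fin s) F X.A) (i : E.M →ₗ[X.AK] (Fin r → X.AK))
    {β : X.A} (hβ0 : β ≠ 0) (hβ : ∀ (x y : E.M) (n : ℕ),
      toGeneric X.AK E.M y = algebraMap X.AA X.AK (X.diff h) ^ n • E.τSemi x →
      ∀ c ∈ vecContent b (i x), algebraMap X.A X.K β * c ^ Fintype.card F ∈ vecContent b (i y))
    {L : Submodule X.AA E.M} (hL : E.IsIntegralModel L) : L ≤ E.boundingLattice β i := by
  have hq : 1 < Fintype.card F := Fintype.one_lt_card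
  obtain ⟨d, hd0, hd⟩ := E.exists_right_mul_of_fg hL.fg i
  have hdA : ∀ x ∈ L, ∀ c ∈ vecContent b (i x), ∃ a, algebraMap X.A X.K d * c =
      algebraMap X.A X.K a := by
    intro x hx c hc
    let N : Submodule X.A X.K := (LinearMap.range (Algebra.linearMap X.A X.K)).comap
      (LinearMap.lsmul X.A X.K d)
    have : vecContent b (i x) ≤ N := vecContent_le b fun k j => by
      obtain ⟨w, hw⟩ := hd x hx k
      have h1 := content_inclTensor_le (K := X.K) b w (contract_mem_content b j _)
      have h2 : inclTensor F X.A X.K w = i x k * (1 ⊗ₜ algebraMap X.A X.K d) :=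
        hw.trans (mul_comm _ _)
      rw [h2, contract_mul, mul_comm, ← Algebra.smul_def] at h1
      exact h1
    obtain ⟨a, ha⟩ := this hc
    exact ⟨a, ((Algebra.smul_def _ _).symm.trans ha.symm)⟩
  have hpow : ∀ m : ℕ, ∀ x ∈ L, ∀ c ∈ vecContent b (i x), ∃ y ∈ L, ∃ e ∈ vecContent b (i y),
      (algebraMap X.A X.K β * c) ^ Fintype.card F ^ m = algebraMap X.A X.K β * e := by
    intro m
    induction m with
    | zero => exact fun x hx c hc => ⟨x, hx, c, hc, by rw [pow_zero, pow_one]⟩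
    | succ m ih =>
      intro x hx c hc
      obtain ⟨y, hy, e, he, hce⟩ := ih x hx c hc
      obtain ⟨y', hy', n, hn⟩ := E.exists_pow_diff_smul hL h hy
      -- From (β e)^q = β · (β^(q-2) · (β e^q)): one β is kept for the shape of the induction, one
      -- is spent on the estimate, and q ≥ 2 leaves the rest as a coefficient.
      refine ⟨y', hy', β ^ (Fintype.card F - 2) • (algebraMap X.A X.K β * e ^ Fintype.card F),
        Submodule.smul_mem _ _ (hβ y y' n hn e he), ?_⟩
      rw [pow_succ, pow_mul, hce, mul_pow, Algebra.smul_def, map_pow, ← mul_assoc, ← mul_assoc,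
        ← pow_succ', ← pow_succ]
      congr 2
      omega
  have hint : ∀ x ∈ L, ∀ c ∈ vecContent b (i x), ∃ a, algebraMap X.A X.K a =
      algebraMap X.A X.K β * c := fun x hx c hc => by
    refine IsIntegrallyClosed.isIntegral_iff.mp (isIntegral_of_mul_pow_mem hq (d := d)
      (fun h0 => hd0 (IsFractionRing.injective X.A X.K (h0.trans (map_zero _).symm))) fun m => ?_)
    obtain ⟨y, hy, e, he, hce⟩ := hpow m x hx c hc
    obtain ⟨a, ha⟩ := hdA y hy e he
    exact ⟨β * a, by rw [hce, mul_left_comm, ha, map_mul]⟩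
  intro x hx k
  have : content b (i x k * (1 ⊗ₜ algebraMap X.A X.K β)) ≤
      LinearMap.range (Algebra.linearMap X.A X.K) := by
    refine Submodule.span_le.mpr ?_
    rintro _ ⟨j, rfl⟩
    obtain ⟨a, ha⟩ := hint x hx _ (content_le_vecContent b (i x) k (contract_mem_content b j _))
    exact ⟨a, ha.trans ((mul_comm _ _).trans (contract_mul _ _ _).symm)⟩
  obtain ⟨w, hw⟩ := mem_range_inclTensor b _ this
  exact ⟨w, hw.trans (mul_comm _ _)⟩

theorem _root_.ShtukaModels.PointedCurve.algebraMap_mem_jK (X : PointedCurve F) {w : X.AA}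
    (hw : w ∈ X.jA) : algebraMap X.AA X.AK w ∈ X.jK := by
  have h : (Algebra.TensorProduct.productMap X.inclK (AlgHom.id F X.K)).comp
      (inclTensor F X.A X.K) = X.inclK.comp
        (Algebra.TensorProduct.productMap (AlgHom.id F X.A) (AlgHom.id F X.A)) := by
    ext a
    · simp
    · simp [PointedCurve.inclK]
  rw [PointedCurve.jK, RingHom.mem_ker]
  rw [PointedCurve.jA, RingHom.mem_ker] at hw
  exact congr($h w).trans ((congrArg X.inclK hw).trans (map_zero _))

theorem _root_.ShtukaModels.PointedCurve.algebraMap_mem_jK_pow (X : PointedCurve F) {w : X.AA}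
    {n : ℕ} (hw : w ∈ X.jA ^ n) : algebraMap X.AA X.AK w ∈ X.jK ^ n := by
  have h1 : X.jA.map (algebraMap X.AA X.AK) ≤ X.jK :=
    Ideal.map_le_iff_le_comap.mpr fun w hw => X.algebraMap_mem_jK hw
  have h2 := Ideal.mem_map_of_mem (algebraMap X.AA X.AK) hw
  rw [Ideal.map_pow] at h2
  exact Ideal.pow_right_mono h1 n h2

/-- The endomorphism `a ⊗ b ↦ a ⊗ b ^ q` of `A ⊗ A`. -/
noncomputable def _root_.ShtukaModels.PointedCurve.frobAA (X : PointedCurve F) : X.AA →ₐ[F] X.AA :=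
  Algebra.TensorProduct.map (AlgHom.id F X.A) (FiniteField.frobeniusAlgHom F X.A)

theorem _root_.ShtukaModels.PointedCurve.frobAK_algebraMap (X : PointedCurve F) (w : X.AA) :
    X.frobAK (algebraMap X.AA X.AK w) = algebraMap X.AA X.AK (X.frobAA w) := by
  have h : (Algebra.TensorProduct.map (AlgHom.id F X.A) (FiniteField.frobeniusAlgHom F X.K)).comp
      (inclTensor F X.A X.K) = (inclTensor F X.A X.K).comp X.frobAA := by
    ext a
    · simp [PointedCurve.frobAA]
    · simp [PointedCurve.frobAA]
  exact congr($h w)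

theorem τSemi_smul_AA (w : X.AA) (m : E.M) : E.τSemi (w • m) = X.frobAA w • E.τSemi m := by
  rw [smul_eq_algebraMap_smul, τSemi_smul, X.frobAK_algebraMap, ← algebraMap_smul_toGeneric]

theorem frobAA_right (c : X.A) : X.frobAA (X.right c) = X.right c ^ Fintype.card F := by
  simp [PointedCurve.frobAA, PointedCurve.right, Algebra.TensorProduct.tmul_pow]

/-- A submodule is an integral model as soon as `τ` maps generators to elements with poles. -/
theorem τLattice_span_le {T : Set E.M} {L : Submodule X.AA E.M} 
    (h : ∀ x ∈ T, E.τSemi x ∈ E.latticePoles L) :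
    E.τLattice (Submodule.span X.AA T) ≤ E.latticePoles L := by
  refine Submodule.span_le.mpr ?_
  rintro _ ⟨x, hx, rfl⟩
  induction hx using Submodule.span_induction with
  | mem x hx => exact h x hx
  | zero => rw [τSemi_zero]; exact zero_mem _
  | add x y _ _ hx hy => rw [τSemi_add]; exact add_mem hx hy
  | smul a x _ hx => rw [τSemi_smul_AA]; exact Submodule.smul_mem _ _ hx

theorem exists_pow_jA_smul (m : E.M) : ∃ n : ℕ, ∀ w ∈ X.jA ^ n, ∃ y : E.M,
    toGeneric X.AK E.M y = w • E.τSemi m := by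
  obtain ⟨n, hn⟩ := (E.τ ⟨toGeneric X.AK _ (frobUnit X.frobAK E.M m),
    le_poles _ _ (LinearMap.mem_range_self _ _)⟩).2
  refine ⟨n, fun w hw => ?_⟩
  obtain ⟨y, hy⟩ := hn _ (X.algebraMap_mem_jK_pow hw)
  exact ⟨y, hy.trans (E.algebraMap_smul_toGeneric w _).symm⟩

/-- Generators m_k of M are scaled by a denominator b. Since τ(b m_k) = b^q τ(m_k) with q ≥ 2, the
scaling gains enough powers of b to absorb the denominators of τ_M. -/
theorem exists_isIntegralModel : ∃ L, E.IsIntegralModel L := by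
  classical
  obtain ⟨r, m, hm⟩ := Module.Finite.exists_fin (R := X.AK) (M := E.M)
  choose n hn using fun k => E.exists_pow_jA_smul (m k)
  have hfg : ∀ k, ∃ T : Finset X.AA, Ideal.span (T : Set X.AA) = X.jA ^ n k := fun k =>
    (isNoetherianRing_iff_ideal_fg X.AA).mp inferInstance _
  choose T hT using hfg
  have hy : ∀ (k : Fin r) (w : T k), ∃ c : Fin r → X.AK,
      toGeneric X.AK E.M (∑ l, c l • m l) = w.1 • E.τSemi (m k) := fun k w => by
    obtain ⟨y, hy⟩ := hn k w.1 (hT k ▸ Ideal.subset_span w.2)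
    obtain ⟨c, hc⟩ := (Submodule.mem_span_range_iff_exists_fun X.AK).mp
      (hm.ge (Submodule.mem_top (x := y)))
    exact ⟨c, by rw [hc, hy]⟩
  choose c hc using hy
  obtain ⟨b, hb0, hb⟩ := X.exists_right_mul_eq_of_finite
    fun p : (Σ k : Fin r, T k) × Fin r => c p.1.1 p.1.2 p.2
  choose w hw using hb
  let L := Submodule.span X.AA (Set.range fun k => X.right b • m k)
  refine ⟨L, Submodule.fg_span (Set.finite_range _), ?_, τLattice_span_le E ?_⟩
  · rw [eq_top_iff, ← hm]
    refine Submodule.span_le.mpr ?_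
    rintro _ ⟨k, rfl⟩
    obtain ⟨u, hu⟩ := X.isUnit_algebraMap_right hb0
    have h1 : m k = (↑u⁻¹ : X.AK) • (X.right b • m k) := by
      rw [smul_eq_algebraMap_smul, ← hu, smul_smul, Units.inv_mul, one_smul]
    rw [h1]
    exact Submodule.smul_mem _ _ (Submodule.subset_span (Submodule.subset_span ⟨k, rfl⟩))
  · rintro _ ⟨k, rfl⟩
    refine ⟨n k, fun t ht => ?_⟩
    rw [← hT k] at ht
    induction ht using Submodule.span_induction with
    | zero => rw [zero_smul]; exact zero_mem _
    | add x y _ _ hx hy => rw [add_smul]; exact add_mem hx hy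
    | smul a x _ hx =>
      rw [smul_eq_mul, mul_smul]
      exact Submodule.smul_mem _ _ hx
    | mem t ht =>
      obtain ⟨e, he⟩ : ∃ e, Fintype.card F = e + 2 :=
        ⟨Fintype.card F - 2, (Nat.sub_add_cancel Fintype.one_lt_card).symm⟩
      -- Of the q factors b, one clears the coefficient c, one belongs to the generator b m_l, and
      -- the remaining e = q - 2 go into the coefficient.
      refine ⟨∑ l, (X.right b ^ (e) * w (⟨k, ⟨t, ht⟩⟩, l)) • (X.right b • m l),
        sum_mem fun l _ => Submodule.smul_mem _ _ (Submodule.subset_span ⟨l, rfl⟩), ?_⟩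
      have h1 : ∑ l, (X.right b ^ (e) * w (⟨k, ⟨t, ht⟩⟩, l)) • (X.right b • m l) =
          X.right b ^ Fintype.card F • ∑ l, c k ⟨t, ht⟩ l • m l := by
        rw [Finset.smul_sum]
        refine Finset.sum_congr rfl fun l _ => ?_
        simp only [smul_eq_algebraMap_smul, smul_smul, map_mul, hw]
        congr 1
        rw [he, map_pow, map_pow]
        ring
      rw [h1]
      change toGeneric X.AK E.M _ = _
      rw [toGeneric_smul, hc, smul_comm, τSemi_smul_AA, frobAA_right]

/-- Every `A`-motive has a maximal integral model. -/
theorem exists_isMaximalIntegralModel : ∃ L, E.IsMaximalIntegralModel L := by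
  obtain ⟨h, s, b, hb⟩ := X.exists_basis
  obtain ⟨r, i, p, hip⟩ := E.exists_retract
  obtain ⟨β, hβ0, hβ⟩ := E.exists_denominator b hb i p hip
  have hi : Function.Injective i := fun x y hxy => by
    have := congr(p $hxy)
    rw [← LinearMap.comp_apply, ← LinearMap.comp_apply, hip] at this
    exact this
  have := E.isNoetherian_boundingLattice hβ0 i hi
  obtain ⟨L₀, hL₀⟩ := E.exists_isIntegralModel
  let D := E.boundingLattice β i
  have hle : ∀ L, E.IsIntegralModel L → L ≤ D := fun L hL => 
    IsIntegralModel.le_boundingLattice E b i hβ0 hβ hL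
  -- All models lie in the Noetherian module `D`, so a model with maximal trace on `D` exists; for
  -- submodules of `D`, inclusion of traces is inclusion.
  obtain ⟨N, ⟨L, hL, rfl⟩, hmax⟩ := WellFounded.has_min (wellFounded_gt (α := Submodule X.AA D))
    ((fun L => L.comap D.subtype) '' {L | E.IsIntegralModel L}) ⟨_, L₀, hL₀, rfl⟩
  refine ⟨L, hL, fun L' hL' hLL' => ?_⟩
  have h1 := hmax _ ⟨L', hL', rfl⟩
  have h2 : L.comap D.subtype = L'.comap D.subtype := by
    by_contra hne
    exact h1 (lt_of_le_of_ne (Submodule.comap_mono hLL') hne)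
  intro x hx
  have : (⟨x, hle L' hL' hx⟩ : D) ∈ L.comap D.subtype := h2 ▸ hx
  exact this

end AMotive

/-! ### Function fields and dominant morphisms -/

section FunctionField

variable {S S' : Scheme.{u}} [IsIntegral S] [IsIntegral S'] (f : S ⟶ S')
  (hf : f (genericPoint S) = genericPoint S')

/-- The homomorphism of function fields induced by a dominant morphism. -/
noncomputable def functionFieldMap : S'.functionField →+* S.functionField :=
  (S'.presheaf.stalkSpecializes (specializes_of_eq hf) ≫ f.stalkMap (genericPoint S)).hom

theorem functionFieldMap_germ {V : S'.Opens} (p : genericPoint S' ∈ V)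
    (p' : genericPoint S ∈ f ⁻¹ᵁ V) (r : Γ(S', V)) :
    functionFieldMap f hf (S'.presheaf.germ V (genericPoint S') p r) =
      S.presheaf.germ (f ⁻¹ᵁ V) (genericPoint S) p' (f.app V r) := by
  have h : S'.presheaf.germ V (genericPoint S') p ≫ S'.presheaf.stalkSpecializes
      (specializes_of_eq hf) ≫ f.stalkMap (genericPoint S) = f.app V ≫ S.presheaf.germ _ _ p' := by
    rw [TopCat.Presheaf.germ_stalkSpecializes_assoc]
    exact Scheme.Hom.germ_stalkMap f V (genericPoint S) p'
  exact congr($h r)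

theorem functionFieldMap_mem_localRing {x : S} {a : S'.functionField} (ha : a ∈ localRing (f x)) :
    functionFieldMap f hf a ∈ localRing x := by
  obtain ⟨V, hx, r, rfl⟩ := mem_localRing_iff.mp ha
  rw [functionFieldMap_germ f hf _ (genericPoint_mem (V := f ⁻¹ᵁ V) hx)]
  exact germ_mem_localRing (V := f ⁻¹ᵁ V) hx _ _

end FunctionField

/-! ### The affine part of the surface as the spectrum of A ⊗ A -/

namespace PointedCurve

variable {F : Type u} [Field F] (X : PointedCurve F)

instance : IsAffineHom X.pr₂ :=
  isAffineHom_isStableUnderBaseChange.of_isPullback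
    (IsPullback.of_hasPullback (Spec.map (CommRingCat.ofHom (algebraMap F X.A))) X.π) inferInstance

theorem mem_preimage_pr₂ {V : X.C.Opens} {x : X.C} (hx : x ∈ V) :
    genericPoint X.surface ∈ X.pr₂ ⁻¹ᵁ V := by
  obtain ⟨y, rfl⟩ := X.pr₂.surjective x
  exact genericPoint_mem (V := X.pr₂ ⁻¹ᵁ V) hx

/-- The projection is surjective, so the generic point of the curve has a preimage. The generic
point of the surface specializes to it, and so does its image. -/
theorem pr₂_genericPoint : X.pr₂ (genericPoint X.surface) = genericPoint X.C := by
  obtain ⟨y, hy⟩ := X.pr₂.surjective (genericPoint X.C)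
  have h' : genericPoint X.C ⤳ X.pr₂ (genericPoint X.surface) := genericPoint_specializes _
  refine (Specializes.antisymm ?_ h').eq
  have h : genericPoint X.surface ⤳ y := genericPoint_specializes y
  rw [← hy]
  exact h.map X.pr₂.continuous

theorem isAffineOpen_affineOpen : IsAffineOpen X.affineOpen :=
  X.isAffineOpen_affinePart.preimage X.pr₂

theorem genericPoint_mem_affineOpen : genericPoint X.surface ∈ X.affineOpen :=
  X.mem_preimage_pr₂ X.genericPoint_mem_affinePart

theorem isPushout_sections {V : X.C.Opens} (hV : IsAffineOpen V) : IsPushout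
    ((Spec.map (CommRingCat.ofHom (algebraMap F X.A))).appLE ⊤ ⊤ le_top) (X.π.appLE ⊤ V le_top)
    (X.pr₁.appLE ⊤ (X.pr₂ ⁻¹ᵁ V) le_top) (X.pr₂.appLE V (X.pr₂ ⁻¹ᵁ V) le_rfl) := by
  have H : IsPullback X.pr₁ X.pr₂ (Spec.map (CommRingCat.ofHom (algebraMap F X.A))) X.π :=
    IsPullback.of_hasPullback _ _
  have hUY : X.pr₂ ⁻¹ᵁ V = X.pr₁ ⁻¹ᵁ ⊤ ⊓ X.pr₂ ⁻¹ᵁ V := (top_inf_eq _).symm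
  exact (isIso_pushoutSection_iff H (US := ⊤) (UX := ⊤) (UT := V) le_top le_top hUY).mp
    (isIso_pushoutSection_of_isAffineOpen H le_top le_top hUY (isAffineOpen_top _) hV
      (isAffineOpen_top _))

theorem isPushout_tensorSections : IsPushout
    (CommRingCat.ofHom (algebraMap F X.A)) (CommRingCat.ofHom (algebraMap F X.A))
    ((Scheme.ΓSpecIso (CommRingCat.of X.A)).inv ≫ X.pr₁.appLE ⊤ X.affineOpen le_top)
    (X.pr₂.appLE X.affinePart X.affineOpen le_rfl) := by
  refine (X.isPushout_sections X.isAffineOpen_affinePart).of_iso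
    (Scheme.ΓSpecIso (CommRingCat.of F)) (Scheme.ΓSpecIso (CommRingCat.of X.A)) (Iso.refl _)
    (Iso.refl _) ?_ ?_ ?_ ?_
  · exact (congrArg (· ≫ _) (Category.comp_id _)).trans (Scheme.ΓSpecIso_naturality _)
  · rw [Iso.refl_hom, Category.comp_id]
    change _ = _ ≫ CommRingCat.ofHom (structureHom X.π X.affinePart)
    simp [structureHom, Scheme.Hom.appLE]
  · exact (Category.comp_id _).trans (Iso.hom_inv_id_assoc _ _).symm
  · exact (Category.comp_id _).trans (Category.id_comp _).symm

/-- The identification of `A ⊗ A` with the functions on `Spec A × (C ∖ {∞})`. -/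
noncomputable def tensorEquiv : X.AA ≃+* Γ(X.surface, X.affineOpen) :=
  ((CommRingCat.isPushout_tensorProduct F X.A X.A).isoIsPushout _ _
    X.isPushout_tensorSections).commRingCatIsoToRingEquiv

theorem tensorEquiv_tmul (a b : X.A) : X.tensorEquiv (a ⊗ₜ b) = X.tensorSection a b := by
  have h1 := (CommRingCat.isPushout_tensorProduct F X.A X.A).inl_isoIsPushout_hom _ _
    X.isPushout_tensorSections
  have h2 := (CommRingCat.isPushout_tensorProduct F X.A X.A).inr_isoIsPushout_hom _ _
    X.isPushout_tensorSections
  have h3 : (a ⊗ₜ b : X.AA) = a ⊗ₜ 1 * 1 ⊗ₜ b := by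
    rw [Algebra.TensorProduct.tmul_mul_tmul, mul_one, one_mul]
  rw [h3, map_mul]
  exact congrArg₂ _ congr($h1 a) congr($h2 b)

/-- The inclusion of `A ⊗ A` in the function field of the surface. -/
noncomputable def tensorGerm : X.AA →+* X.surface.functionField :=
  (X.surface.presheaf.germ X.affineOpen (genericPoint X.surface)
    X.genericPoint_mem_affineOpen).hom.comp X.tensorEquiv.toRingHom

theorem tensorGerm_apply (w : X.AA) : X.tensorGerm w =
    X.surface.presheaf.germ X.affineOpen (genericPoint X.surface)
      X.genericPoint_mem_affineOpen (X.tensorEquiv w) := rfl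

theorem tensorGerm_mem_localRing (w : X.AA) {x : X.surface} (hx : x ∈ X.affineOpen) :
    X.tensorGerm w ∈ localRing x :=
  germ_mem_localRing hx _ _

theorem tensorGerm_injective : Function.Injective X.tensorGerm :=
  (germ_genericPoint_injective _).comp X.tensorEquiv.injective

instance : IsDomain X.AA := X.tensorGerm_injective.isDomain X.tensorGerm

/-- The pullback of rational functions on `C` to the surface. -/
noncomputable def pullbackFun : X.C.functionField →+* X.surface.functionField :=
  functionFieldMap X.pr₂ X.pr₂_genericPoint

theorem pullbackFun_germ {V : X.C.Opens} (p : genericPoint X.C ∈ V)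
    (p' : genericPoint X.surface ∈ X.pr₂ ⁻¹ᵁ V) (r : Γ(X.C, V)) :
    X.pullbackFun (X.C.presheaf.germ V (genericPoint X.C) p r) =
      X.surface.presheaf.germ (X.pr₂ ⁻¹ᵁ V) (genericPoint X.surface) p' (X.pr₂.app V r) :=
  functionFieldMap_germ _ _ _ _ _

theorem pullbackFun_mem_localRing {x : X.surface} {a : X.C.functionField}
    (ha : a ∈ localRing (X.pr₂ x)) : X.pullbackFun a ∈ localRing x :=
  functionFieldMap_mem_localRing _ _ ha

theorem tensorGerm_right (b : X.A) : X.tensorGerm (X.right b) =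
    X.pullbackFun (X.C.presheaf.germ X.affinePart _ X.genericPoint_mem_affinePart b) := by
  rw [X.pullbackFun_germ _ X.genericPoint_mem_affineOpen, tensorGerm_apply, right,
    tensorEquiv_tmul, tensorSection, map_one, map_one, one_mul]
  have h : X.pr₂.appLE X.affinePart X.affineOpen le_rfl = X.pr₂.app X.affinePart :=
    Scheme.Hom.appLE_eq_app X.pr₂
  exact congrArg _ congr($h b)

/-- The elements `a ⊗ 1` are regular everywhere on the surface. -/
theorem tensorGerm_left_mem (a : X.A) (x : X.surface) :
    X.tensorGerm (a ⊗ₜ 1) ∈ localRing x := by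
  rw [tensorGerm_apply, tensorEquiv_tmul, tensorSection, map_one, mul_one]
  let s : Γ(X.surface, ⊤) := X.pr₁.appTop ((Scheme.ΓSpecIso (CommRingCat.of X.A)).inv.hom a)
  have h : X.pr₁.appLE ⊤ X.affineOpen le_top ((Scheme.ΓSpecIso (CommRingCat.of X.A)).inv.hom a) =
      X.surface.presheaf.map (homOfLE (le_top : X.affineOpen ≤ ⊤)).op s := rfl
  change X.surface.presheaf.germ X.affineOpen (genericPoint X.surface)
    X.genericPoint_mem_affineOpen (X.pr₁.appLE ⊤ X.affineOpen le_top
      ((Scheme.ΓSpecIso (CommRingCat.of X.A)).inv.hom a)) ∈ _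
  rw [h, germ_res (V' := op X.affineOpen) (homOfLE _).op]
  exact germ_mem_localRing (V := ⊤) trivial _ s

theorem tmul_eq_mul_right (a b : X.A) : (a ⊗ₜ b : X.AA) = a ⊗ₜ 1 * X.right b := by
  rw [right, Algebra.TensorProduct.tmul_mul_tmul, mul_one, one_mul]

end PointedCurve

/-! ### The divisor at infinity -/

/-- The kernel of the base change of a surjective homomorphism with principal kernel. -/
theorem ker_eq_span_of_isPushout {R T B P : CommRingCat.{u}} {f : R ⟶ B} {g : R ⟶ T} {f' : B ⟶ P}
    {g' : T ⟶ P} (h : IsPushout f g f' g') (hg : Function.Surjective g) {ϖ : R}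
    (hϖ : ∀ r, g r = 0 ↔ ϖ ∣ r) : RingHom.ker f'.hom = Ideal.span {f ϖ} := by
  apply le_antisymm
  · let π : B ⟶ CommRingCat.of (B ⧸ Ideal.span {f ϖ}) := CommRingCat.ofHom (Ideal.Quotient.mk _)
    have hπ : ∀ b, π b = 0 ↔ b ∈ Ideal.span {f ϖ} := fun b => Ideal.Quotient.eq_zero_iff_mem
    have hker : ∀ r ∈ RingHom.ker g.hom, (f ≫ π).hom r = 0 := by
      intro r hr
      obtain ⟨c, rfl⟩ := (hϖ r).mp hr
      change π (f (ϖ * c)) = 0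
      rw [hπ, map_mul]
      exact Ideal.mul_mem_right _ _ (Ideal.mem_span_singleton_self _)
    let k : T ⟶ CommRingCat.of (B ⧸ Ideal.span {f ϖ}) :=
      CommRingCat.ofHom (RingHom.liftOfSurjective g.hom hg ⟨(f ≫ π).hom, hker⟩)
    have hk : f ≫ π = g ≫ k := by
      ext r
      exact (RingHom.liftOfRightInverse_comp_apply g.hom (Function.surjInv hg)
        (Function.rightInverse_surjInv hg) ⟨(f ≫ π).hom, hker⟩ r).symm
    intro b hb
    rw [← hπ, ← h.inl_desc π k hk]
    change h.desc π k hk (f' b) = 0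
    rw [show f' b = 0 from hb, map_zero]
  · rw [Ideal.span_le, Set.singleton_subset_iff]
    change (f ≫ f') ϖ = 0
    rw [h.w]
    change g' (g ϖ) = 0
    rw [(hϖ ϖ).mpr dvd_rfl, map_zero]

namespace PointedCurve

variable {F : Type u} [Field F] (X : PointedCurve F)

instance : IsClosedImmersion (X.C.fromSpecResidueField X.inf) :=
  isClosed_singleton_iff_isClosedImmersion.mp X.isClosed_inf

theorem isPullback_infDivisor : IsPullback X.infDivisor
    (Limits.pullback.snd X.pr₂ (X.C.fromSpecResidueField X.inf)) X.pr₂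
    (X.C.fromSpecResidueField X.inf) :=
  IsPullback.of_hasPullback _ _

instance : IsClosedImmersion X.infDivisor :=
  IsClosedImmersion.isStableUnderBaseChange.of_isPullback X.isPullback_infDivisor.flip inferInstance

theorem fromSpecResidueField_app_eq_zero {V : X.C.Opens} (r : Γ(X.C, V)) :
    (X.C.fromSpecResidueField X.inf).app V r = 0 ↔ X.inf ∉ X.C.basicOpen r := by
  rw [← basicOpen_eq_bot_iff, ← Scheme.preimage_basicOpen]
  constructor
  · intro h hx
    have : (⊤ : (Spec (X.C.residueField X.inf)).Opens) ≤ ⊥ := by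
      rw [← h]
      intro y _
      change X.C.fromSpecResidueField X.inf y ∈ X.C.basicOpen r
      rwa [Scheme.fromSpecResidueField_apply]
    exact this (x := IsLocalRing.closedPoint _) trivial
  · intro hx
    rw [eq_bot_iff]
    intro y hy
    change X.C.fromSpecResidueField X.inf y ∈ X.C.basicOpen r at hy
    rw [Scheme.fromSpecResidueField_apply] at hy
    exact hx hy

/-- The divisor is the base change of the closed point, whose ideal on `V` is generated by ϖ; the
kernel of a surjection with principal kernel stays principal under base change, with the pulled-back
generator. -/
theorem ker_infDivisor {V : X.C.Opens} (hV : IsAffineOpen V) {ϖ : Γ(X.C, V)}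
    (hϖ : ∀ r : Γ(X.C, V), X.inf ∉ X.C.basicOpen r ↔ ϖ ∣ r) :
    RingHom.ker (X.infDivisor.app (X.pr₂ ⁻¹ᵁ V)).hom = Ideal.span {X.pr₂.app V ϖ} := by
  let i := X.C.fromSpecResidueField X.inf
  have hUT : IsAffineOpen (i ⁻¹ᵁ V) := hV.preimage i
  have hUY : X.infDivisor ⁻¹ᵁ (X.pr₂ ⁻¹ᵁ V) = X.infDivisor ⁻¹ᵁ (X.pr₂ ⁻¹ᵁ V) ⊓
      Limits.pullback.snd X.pr₂ i ⁻¹ᵁ (i ⁻¹ᵁ V) := by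
    rw [left_eq_inf, ← Scheme.Hom.comp_preimage, ← Scheme.Hom.comp_preimage,
      X.isPullback_infDivisor.w]
  have h := (isIso_pushoutSection_iff X.isPullback_infDivisor (US := V) le_rfl le_rfl hUY).mp
    (isIso_pushoutSection_of_isAffineOpen _ _ _ _ hV hUT (hV.preimage X.pr₂))
  have h1 := ker_eq_span_of_isPushout h ?_ (ϖ := ϖ) ?_
  · rw [Scheme.Hom.appLE_eq_app, Scheme.Hom.appLE_eq_app] at h1
    exact h1
  · rw [Scheme.Hom.appLE_eq_app]
    exact i.app_surjective V hV
  · rw [Scheme.Hom.appLE_eq_app]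
    exact fun r => (X.fromSpecResidueField_app_eq_zero r).trans (hϖ r)

/-- A coordinate chart at infinity. -/
theorem exists_chart : ∃ (h : X.A) (V : X.C.Opens) (_ : X.inf ∈ V) (_ : IsAffineOpen V)
    (hξ : genericPoint X.C ∈ V) (ϖ t : Γ(X.C, V)),
    (∀ r : Γ(X.C, V), X.inf ∉ X.C.basicOpen r ↔ ϖ ∣ r) ∧ X.inf ∉ X.C.basicOpen t ∧
    X.C.presheaf.germ X.affinePart _ X.genericPoint_mem_affinePart h *
      X.C.presheaf.germ V _ hξ t = 1 := by
  obtain ⟨h, -, -, -, hh⟩ := X.exists_finite_aeval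
  set u := X.C.presheaf.germ X.affinePart _ X.genericPoint_mem_affinePart h with hu
  obtain ⟨V, hle, hinf, hV, ϖ, hϖ⟩ := X.exists_uniformizer (V₀ := regularOpen u⁻¹)
    (mem_regularOpen.mpr (inv_mem_localRing hh))
  obtain ⟨t, ht⟩ := exists_section_of_mem_localRing (genericPoint_mem hinf) u⁻¹
    fun x hx => mem_regularOpen.mp (hle hx)
  have hu0 : u ≠ 0 := fun h0 => hh (by rw [h0]; exact zero_mem _)
  refine ⟨h, V, hinf, hV, genericPoint_mem hinf, ϖ, t, hϖ, fun h1 => hh ?_, ?_⟩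
  · have := inv_germ_mem_localRing (genericPoint_mem hinf) h1
    rwa [ht, inv_inv] at this
  · rw [ht, mul_inv_cancel₀ hu0]

theorem infDivisor_app_affineOpen (f : Γ(X.surface, X.affineOpen)) :
    X.infDivisor.app X.affineOpen f = 0 := by
  have h : X.infDivisor ⁻¹ᵁ X.affineOpen = ⊥ := by
    rw [eq_bot_iff]
    intro z hz
    have h1 : X.pr₂ (X.infDivisor z) ∈ X.affinePart := hz
    have h2 : X.pr₂ (X.infDivisor z) = X.inf := by
      rw [← Scheme.Hom.comp_apply, X.isPullback_infDivisor.w, Scheme.Hom.comp_apply,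
        Scheme.fromSpecResidueField_apply]
    exact absurd h2 h1
  have h0 : ∀ {Z : Scheme.{u}} (U : Z.Opens), U = ⊥ → ∀ a b : Γ(Z, U), a = b := by
    rintro Z _ rfl a b
    exact Subsingleton.elim _ _
  exact h0 _ h _ _

/-- Off the divisor the ideal is the unit ideal, and near it the pullback of a uniformizer
generates. Passing to basic open sets yields arbitrarily small neighbourhoods. -/
theorem isLocallyPrincipal_infDivisor : IsLocallyPrincipal X.infDivisor := by
  suffices H : ∀ x : X.surface, ∃ (U : X.surface.Opens) (f : Γ(X.surface, U)), IsAffineOpen U ∧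
      x ∈ U ∧ RingHom.ker (X.infDivisor.app U).hom = Ideal.span {f} ∧ f ≠ 0 by
    intro x U hx
    obtain ⟨V, f, hV, hxV, hf, hf0⟩ := H x
    obtain ⟨g, hg, hxg⟩ := hV.exists_basicOpen_le ⟨x, hx⟩ hxV
    have h1 := X.infDivisor.ker.map_ideal (U := ⟨_, hV.basicOpen g⟩) (V := ⟨V, hV⟩)
      (X.surface.basicOpen_le g)
    rw [Scheme.Hom.ker_apply, Scheme.Hom.ker_apply, hf, Ideal.map_span, Set.image_singleton] at h1
    refine ⟨_, _, hg, hxg, h1.symm, fun p => ?_⟩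
    change X.surface.presheaf.germ _ _ _ (X.surface.presheaf.map (homOfLE _).op f) ≠ 0
    rw [germ_res (V' := op (X.surface.basicOpen g)) (homOfLE _).op]
    exact (map_ne_zero_iff _ (germ_genericPoint_injective _)).mpr hf0
  intro x
  by_cases hx : x ∈ X.affineOpen
  · have h10 : (1 : Γ(X.surface, X.affineOpen)) ≠ 0 := fun h0 =>
      one_ne_zero (α := X.AA) (by rw [← X.tensorEquiv.symm.map_one, h0, map_zero])
    refine ⟨X.affineOpen, 1, X.isAffineOpen_affineOpen, hx, ?_, h10⟩
    rw [Ideal.span_singleton_one, Ideal.eq_top_iff_one]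
    exact X.infDivisor_app_affineOpen 1
  · obtain ⟨h, V, hinf, hV, hξ, ϖ, t, hϖ, ht, hht⟩ := X.exists_chart
    have hxV : x ∈ X.pr₂ ⁻¹ᵁ V := by
      have : X.pr₂ x = X.inf := by
        by_contra h
        exact hx h
      change X.pr₂ x ∈ V
      rwa [this]
    refine ⟨X.pr₂ ⁻¹ᵁ V, X.pr₂.app V ϖ, hV.preimage X.pr₂, hxV, X.ker_infDivisor hV hϖ, ?_⟩
    -- ϖ divides t, and t is inverse to h in the function field, so the pullback of ϖ cannot vanish.
    intro h0
    have h1 := congrArg (X.surface.presheaf.germ _ _ (X.mem_preimage_pr₂ hξ)) h0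
    rw [← X.pullbackFun_germ hξ, map_zero, map_eq_zero] at h1
    obtain ⟨c, rfl⟩ := (hϖ t).mp ht
    rw [map_mul, h1, zero_mul, mul_zero] at hht
    exact zero_ne_one hht

end PointedCurve

theorem appLE_appLE_apply {X Y Z : Scheme.{u}} {f : X ⟶ Y} {g : Y ⟶ Z} {k : X ⟶ Z} (hk : f ≫ g = k)
    {U : Z.Opens} {V : Y.Opens} {W : X.Opens} (e₁ : V ≤ g ⁻¹ᵁ U) (e₂ : W ≤ f ⁻¹ᵁ V)
    (e₃ : W ≤ k ⁻¹ᵁ U) (s : Γ(Z, U)) :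
    f.appLE V W e₂ (g.appLE U V e₁ s) = k.appLE U W e₃ s := by
  subst hk
  exact congr($(Scheme.Hom.appLE_comp_appLE f g U V W e₁ e₂) s)

/-! ### The diagonal and the Frobenius on the surface -/

namespace PointedCurve

variable {F : Type u} [Field F] (X : PointedCurve F)

/-- The morphism whose range is the diagonal. -/
noncomputable def diagonalHom : (X.affinePart : Scheme.{u}) ⟶ X.surface :=
  Limits.pullback.lift (f := Spec.map (CommRingCat.ofHom (algebraMap F X.A))) (g := X.π)
    X.affinePart.toSpecΓ X.affinePart.ι X.diagonal_condition

theorem diagonalHom_pr₁ : X.diagonalHom ≫ X.pr₁ = X.affinePart.toSpecΓ :=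
  Limits.pullback.lift_fst _ _ _

theorem diagonalHom_pr₂ : X.diagonalHom ≫ X.pr₂ = X.affinePart.ι :=
  Limits.pullback.lift_snd _ _ _

instance : IsSeparated X.pr₁ := inferInstanceAs (IsSeparated (Limits.pullback.fst _ _))

/-- Its composite with the separated projection to Spec A is the isomorphism of the affine part with
Spec A. Hence the diagonal is closed in the whole surface, including along ∞_A. -/
instance : IsClosedImmersion X.diagonalHom := by
  have h : IsIso X.affinePart.toSpecΓ := by
    rw [← X.isAffineOpen_affinePart.isoSpec_hom]
    infer_instance
  have : IsClosedImmersion (X.diagonalHom ≫ X.pr₁) := by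
    rw [X.diagonalHom_pr₁]
    infer_instance
  exact IsClosedImmersion.of_comp X.diagonalHom X.pr₁

theorem isClosed_diagonal : IsClosed X.diagonal :=
  X.diagonalHom.isClosedEmbedding.isClosed_range

theorem preimage_diagonalHom : X.diagonalHom ⁻¹ᵁ X.affineOpen = ⊤ := by
  have : X.diagonalHom ⁻¹ᵁ X.affineOpen = (X.diagonalHom ≫ X.pr₂) ⁻¹ᵁ X.affinePart := rfl
  rw [this, diagonalHom_pr₂, Scheme.Opens.ι_preimage_self]

theorem diagonalHom_appLE (w : X.AA) :
    X.diagonalHom.appLE X.affineOpen ⊤ X.preimage_diagonalHom.ge (X.tensorEquiv w) =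
      X.affinePart.topIso.inv
        (Algebra.TensorProduct.productMap (AlgHom.id F X.A) (AlgHom.id F X.A) w) := by
  induction w using TensorProduct.induction_on with
  | zero => simp only [map_zero]
  | add x y hx hy => simp only [map_add, hx, hy]
  | tmul a b =>
    rw [tensorEquiv_tmul, tensorSection, map_mul, Algebra.TensorProduct.productMap_apply_tmul,
      map_mul]
    congr 1
    · refine (appLE_appLE_apply X.diagonalHom_pr₁ (U := ⊤) le_top _ le_top _).trans ?_
      have h : (Scheme.ΓSpecIso (CommRingCat.of X.A)).inv ≫ X.affinePart.toSpecΓ.appLE ⊤ ⊤ le_top =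
          X.affinePart.topIso.inv := by
        have := Scheme.Opens.toSpecΓ_appTop X.affinePart
        rw [← Iso.inv_comp_eq] at this
        rw [← this]
        exact congrArg _ (Scheme.Hom.appLE_eq_app X.affinePart.toSpecΓ)
      exact congr($h a)
    · refine (appLE_appLE_apply X.diagonalHom_pr₂ le_rfl _
        X.affinePart.ι_preimage_self.ge b).trans ?_
      have h : X.affinePart.ι.appLE X.affinePart ⊤ X.affinePart.ι_preimage_self.ge =
          X.affinePart.topIso.inv := by
        rw [Scheme.Opens.ι_appLE]
        rfl
      exact congr($h b)

/-- Choose a function nonvanishing at x whose basic open set misses the diagonal. Its restriction to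
the diagonal vanishes at every point, hence is zero as the diagonal is reduced; this restriction is
the multiplication map A ⊗ A → A. -/
theorem exists_mem_jA_of_notMem_diagonal {x : X.surface} (hx : x ∈ X.affineOpen)
    (hxd : x ∉ X.diagonal) : ∃ w ∈ X.jA, x ∈ X.surface.basicOpen (X.tensorEquiv w) := by
  obtain ⟨r, hr, hxr⟩ := X.isAffineOpen_affineOpen.exists_basicOpen_le
    (V := ⟨X.diagonalᶜ, X.isClosed_diagonal.isOpen_compl⟩) ⟨x, hxd⟩ hx
  refine ⟨X.tensorEquiv.symm r, ?_, by rwa [RingEquiv.apply_symm_apply]⟩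
  have h := X.diagonalHom_appLE (X.tensorEquiv.symm r)
  rw [RingEquiv.apply_symm_apply] at h
  have h0 : X.diagonalHom.appLE X.affineOpen ⊤ X.preimage_diagonalHom.ge r = 0 := by
    rw [← basicOpen_eq_bot_iff, eq_bot_iff]
    intro y hy
    rw [Scheme.basicOpen_appLE] at hy
    exact hr hy.2 ⟨y, rfl⟩
  rw [h0] at h
  rw [jA, RingHom.mem_ker]
  exact (map_eq_zero_iff _ (ConcreteCategory.bijective_of_isIso X.affinePart.topIso.inv).1).mp h.symm

section Frobenius

variable [Fintype F]

theorem frob_pr₁ : X.frob ≫ X.pr₁ = X.pr₁ := Limits.pullback.lift_fst _ _ _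

theorem frob_pr₂ : X.frob ≫ X.pr₂ = X.pr₂ ≫ absoluteFrobenius X.π := Limits.pullback.lift_snd _ _ _

theorem frob_appLE (w : X.AA) :
    X.frob.appLE X.affineOpen X.affineOpen X.affineOpen_le_frob (X.tensorEquiv w) =
      X.tensorEquiv (X.frobAA w) := by
  induction w using TensorProduct.induction_on with
  | zero => simp only [map_zero]
  | add x y hx hy => simp only [map_add, hx, hy]
  | tmul a b =>
    have e : X.frobAA (a ⊗ₜ b) = a ⊗ₜ (b ^ Fintype.card F) := by
      simp [frobAA]
    rw [e, tensorEquiv_tmul, tensorEquiv_tmul, tensorSection, tensorSection, map_mul]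
    congr 1
    · exact appLE_appLE_apply X.frob_pr₁ (U := ⊤) le_top _ le_top _
    · refine (appLE_appLE_apply X.frob_pr₂ le_rfl _ le_rfl b).trans ?_
      refine (appLE_appLE_apply (f := X.pr₂) (g := absoluteFrobenius X.π) rfl
        (V := X.affinePart) le_rfl le_rfl le_rfl b).symm.trans ?_
      exact congrArg (X.pr₂.appLE X.affinePart X.affineOpen le_rfl)
        congr($(Scheme.Hom.appLE_eq_app (absoluteFrobenius X.π)) b)

theorem mem_basicOpen_tensorEquiv (w : X.AA) :
    genericPoint X.surface ∈ X.surface.basicOpen (X.tensorEquiv w) ↔ w ≠ 0 := by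
  rw [X.surface.mem_basicOpen _ _ X.genericPoint_mem_affineOpen]
  change IsUnit (X.tensorGerm w) ↔ _
  rw [isUnit_iff_ne_zero, map_ne_zero_iff _ X.tensorGerm_injective]

theorem frobAA_injective : Function.Injective X.frobAA := by
  have h : X.frobAA.toLinearMap =
      (FiniteField.frobeniusAlgHom F X.A).toLinearMap.lTensor X.A := by
    ext a b
    simp [frobAA]
  have := Module.Flat.lTensor_preserves_injective_linearMap (M := X.A)
    (FiniteField.frobeniusAlgHom F X.A).toLinearMap 
    ((injective_iff_map_eq_zero _).mpr fun x hx => (pow_eq_zero_iff Fintype.card_ne_zero).mp hx)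
  rw [← h] at this
  exact this

/-- Every neighbourhood of the generic point contains a nonempty basic open set inside the affine
part, and τ is injective on A ⊗ A, so the pullback of its defining function is again nonzero. -/
theorem frob_genericPoint : X.frob (genericPoint X.surface) = genericPoint X.surface := by
  have h' : genericPoint X.surface ⤳ X.frob (genericPoint X.surface) := genericPoint_specializes _
  refine (Specializes.antisymm ?_ h').eq
  rw [specializes_iff_forall_open]
  intro s hs hξ
  obtain ⟨f, hf, hξf⟩ := X.isAffineOpen_affineOpen.exists_basicOpen_le (V := ⟨s, hs⟩) ⟨_, hξ⟩
    X.genericPoint_mem_affineOpen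
  refine hf ?_
  obtain ⟨w, rfl⟩ := X.tensorEquiv.surjective f
  have h1 : genericPoint X.surface ∈ X.surface.basicOpen (X.frob.appLE X.affineOpen X.affineOpen
      X.affineOpen_le_frob (X.tensorEquiv w)) := by
    rw [frob_appLE, mem_basicOpen_tensorEquiv, ← map_zero X.frobAA, X.frobAA_injective.ne_iff,
      ← mem_basicOpen_tensorEquiv]
    exact hξf
  rw [Scheme.basicOpen_appLE] at h1
  exact h1.2

theorem functionFieldMap_frob (w : X.AA) :
    functionFieldMap X.frob X.frob_genericPoint (X.tensorGerm w) = X.tensorGerm (X.frobAA w) := by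
  rw [tensorGerm_apply, functionFieldMap_germ _ _ _ (X.affineOpen_le_frob X.genericPoint_mem_affineOpen),
    tensorGerm_apply, ← frob_appLE]
  exact (germ_res (V' := op X.affineOpen) (homOfLE X.affineOpen_le_frob).op _ _).symm

end Frobenius

end PointedCurve

/-! ### Extension of τ_M to the generic fibre -/

/-- The extension of a semilinear map `M → M ⊗ Quot(R)` to `M ⊗ Quot(R)`. -/
theorem exists_semilinear_extension {R : Type u} [CommRing R] [IsDomain R] {τ : R →+* R}
    (hτ : Function.Injective τ) {M : Type u} [AddCommGroup M] [Module R M] (s : M → Generic R M)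
    (hadd : ∀ m n, s (m + n) = s m + s n) (hs : ∀ r m, s (r • m) = τ r • s m) :
    ∃ (τQ : FractionRing R →+* FractionRing R) (T : Generic R M →+ Generic R M),
      (∀ r, τQ (algebraMap R _ r) = algebraMap R _ (τ r)) ∧ (∀ m, T (toGeneric R M m) = s m) ∧
      ∀ (q : FractionRing R) y, T (q • y) = τQ q • T y := by
  let g : R →+* FractionRing R := (algebraMap R (FractionRing R)).comp τ
  have hg : Function.Injective g := (IsFractionRing.injective R (FractionRing R)).comp hτ
  let τQ : FractionRing R →+* FractionRing R := IsFractionRing.lift hg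
  have hτQ : ∀ r, τQ (algebraMap R _ r) = algebraMap R _ (τ r) := IsFractionRing.lift_algebraMap hg
  let s' : M →+ Generic R M := AddMonoidHom.mk' s hadd
  let T : Generic R M →+ Generic R M := TensorProduct.liftAddHom
    (AddMonoidHom.mk' (fun q : FractionRing R => (DistribSMul.toAddMonoidHom _ (τQ q)).comp s')
      (fun a b => by ext m; simp [add_smul])) (fun r q m => by
        change τQ (r • q) • s m = τQ q • s (r • m)
        rw [hs, Algebra.smul_def, map_mul, hτQ, mul_comm, mul_smul, algebraMap_smul])
  have hT : ∀ q m, T (q ⊗ₜ m) = τQ q • s m := fun _ _ => rfl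
  refine ⟨τQ, T, hτQ, fun m => (hT 1 m).trans (by rw [map_one, one_smul]), fun q y => ?_⟩
  induction y using TensorProduct.induction_on with
  | zero => rw [smul_zero, map_zero, smul_zero]
  | add x y hx hy => rw [smul_add, map_add, hx, hy, map_add, smul_add]
  | tmul p m => rw [TensorProduct.smul_tmul', hT, hT, smul_eq_mul, map_mul, mul_smul]

namespace PointedCurve

variable {F : Type u} [Field F] (X : PointedCurve F)

instance : IsDomain X.AK := by
  have : Nontrivial X.AK := X.inclTensor_injective.nontrivial
  have : NoZeroDivisors X.AK := ⟨fun {a b} hab => by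
    obtain ⟨c, hc, w, hw⟩ := X.exists_right_mul_eq a
    obtain ⟨c', hc', w', hw'⟩ := X.exists_right_mul_eq b
    have h : w * w' = 0 := by
      apply X.inclTensor_injective
      rw [← X.algebraMap_AK, map_mul, hw, hw', map_zero, mul_mul_mul_comm, hab, mul_zero]
    rcases mul_eq_zero.mp h with rfl | rfl
    · left
      rw [map_zero] at hw
      exact (X.isUnit_algebraMap_right hc).mul_right_eq_zero.mp hw.symm
    · right
      rw [map_zero] at hw'
      exact (X.isUnit_algebraMap_right hc').mul_right_eq_zero.mp hw'.symm⟩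
  exact NoZeroDivisors.to_isDomain _

instance : Nonempty X.affineOpen := ⟨⟨_, X.genericPoint_mem_affineOpen⟩⟩

instance : IsFractionRing Γ(X.surface, X.affineOpen) X.surface.functionField :=
  functionField_isFractionRing_of_isAffineOpen _ _ X.isAffineOpen_affineOpen

theorem toFractionRing_aux : Function.Injective (((algebraMap X.AK (FractionRing X.AK)).comp
    (algebraMap X.AA X.AK)).comp X.tensorEquiv.symm.toRingHom) :=
  ((IsFractionRing.injective X.AK (FractionRing X.AK)).comp X.inclTensor_injective).comp
    X.tensorEquiv.symm.injective

/-- The function field of the surface as a subfield of `Quot(A ⊗ K)`. -/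
noncomputable def toFractionRing : X.surface.functionField →+* FractionRing X.AK :=
  IsFractionRing.lift (A := Γ(X.surface, X.affineOpen)) X.toFractionRing_aux

theorem toFractionRing_tensorGerm (w : X.AA) :
    X.toFractionRing (X.tensorGerm w) = algebraMap X.AK _ (algebraMap X.AA X.AK w) := by
  refine (IsFractionRing.lift_algebraMap X.toFractionRing_aux (X.tensorEquiv w)).trans ?_
  change algebraMap X.AK _ (algebraMap X.AA X.AK (X.tensorEquiv.symm (X.tensorEquiv w))) = _
  rw [RingEquiv.symm_apply_apply]

theorem functionField_hom_ext {R : Type*} [CommRing R] {f g : X.surface.functionField →+* R}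
    (h : ∀ w, f (X.tensorGerm w) = g (X.tensorGerm w)) : f = g := by
  refine IsLocalization.ringHom_ext (nonZeroDivisors Γ(X.surface, X.affineOpen)) ?_
  ext r
  obtain ⟨w, rfl⟩ := X.tensorEquiv.surjective r
  exact h w

theorem frobAK_injective [Fintype F] : Function.Injective X.frobAK := by
  have h : (Algebra.TensorProduct.map (AlgHom.id F X.A)
      (FiniteField.frobeniusAlgHom F X.K)).toLinearMap =
      (FiniteField.frobeniusAlgHom F X.K).toLinearMap.lTensor X.A := by
    ext a b
    simp
  have := Module.Flat.lTensor_preserves_injective_linearMap (M := X.A)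
    (FiniteField.frobeniusAlgHom F X.K).toLinearMap (RingHom.injective _)
  rw [← h] at this
  exact this

end PointedCurve

namespace AMotive

variable {F : Type u} [Field F] [Fintype F] {X : PointedCurve F} (E : AMotive X)

noncomputable instance : Module X.surface.functionField (Generic X.AK E.M) :=
  Module.compHom _ X.toFractionRing

theorem functionField_smul (a : X.surface.functionField) (y : Generic X.AK E.M) :
    a • y = X.toFractionRing a • y := rfl

theorem tensorGerm_smul (w : X.AA) (y : Generic X.AK E.M) : X.tensorGerm w • y = w • y := by
  rw [functionField_smul, X.toFractionRing_tensorGerm, E.algebraMap_smul_toGeneric]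
  exact algebraMap_smul _ _ _

/-- The extension of `τ_M` to a semilinear endomorphism of `M ⊗ Quot(A ⊗ K)`. -/
theorem exists_τ_extension : ∃ T : Generic X.AK E.M →+ Generic X.AK E.M,
    IsSemilinear X.frob T ∧ ∀ m, T (toGeneric X.AK E.M m) = E.τSemi m := by
  obtain ⟨τQ, T, h1, h2, h3⟩ :=
    exists_semilinear_extension X.frobAK_injective E.τSemi E.τSemi_add E.τSemi_smul
  refine ⟨T, fun V p p' r w => ?_, h2⟩
  have h : X.toFractionRing.comp (functionFieldMap X.frob X.frob_genericPoint) =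
      τQ.comp X.toFractionRing := by
    refine X.functionField_hom_ext fun w => ?_
    rw [RingHom.comp_apply, RingHom.comp_apply, X.functionFieldMap_frob,
      X.toFractionRing_tensorGerm, X.toFractionRing_tensorGerm, h1, X.frobAK_algebraMap]
  rw [functionField_smul, h3, functionField_smul, ← functionFieldMap_germ X.frob X.frob_genericPoint p]
  exact congrArg (· • T w) congr($h _).symm

end AMotive

/-! ### Finiteness of N_A -/

theorem smul_frobUnit {R : Type u} [CommRing R] (τ : R →+* R) (M : Type u) [AddCommGroup M]
    [Module R M] (a : R) (x : M) : a • frobUnit τ M x =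
      TensorProduct.tmul R (M := (ModuleCat.restrictScalars τ).obj (ModuleCat.of R R)) a x :=
  (ModuleCat.ExtendScalars.smul_tmul (M := ModuleCat.of R M) τ a (1 : R) x).trans
    (congrArg (fun c : (ModuleCat.restrictScalars τ).obj (ModuleCat.of R R) =>
      TensorProduct.tmul R c x) (mul_one a))

theorem eq_zero_of_smul_eq_zero {L W : Type*} [Field L] [AddCommGroup W] [Module L W] {a : L}
    (ha : a ≠ 0) {z : W} (hz : a • z = 0) : z = 0 :=
  (smul_eq_zero.mp hz).resolve_left ha

theorem fg_of_smul_mem {R M V : Type*} [CommRing R] [AddCommGroup M] [Module R M] [AddCommGroup V]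
    [Module R V] (ι : M →ₗ[R] V) (hι : Function.Injective ι) (B : Submodule R M) [IsNoetherian R B]
    {N : Submodule R V} (a : R) (ha : ∀ v : V, a • v = 0 → v = 0)
    (h : ∀ z ∈ N, ∃ y ∈ B, ι y = a • z) : N.FG := by
  have h1 : N.map (LinearMap.lsmul R V a) ≤ B.map ι := by
    rintro _ ⟨z, hz, rfl⟩
    exact h z hz
  have h2 : IsNoetherian R (B.map ι) :=
    isNoetherian_of_linearEquiv (Submodule.equivMapOfInjective ι hι B)
  exact Submodule.fg_of_fg_map_injective _
    ((injective_iff_map_eq_zero (LinearMap.lsmul R V a)).mpr ha) (isNoetherian_submodule.mp h2 _ h1)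

namespace PointedCurve

variable {F : Type u} [Field F] (X : PointedCurve F)

/-- The content of z is bounded by that of δ^m z, which lies in `A`. So a denominator from `K`
cannot be cleared by δ. -/
theorem mem_range_of_diff_pow_mul {h : X.A} {s : ℕ} (b : Module.Basis (ℕ × Fin s) F X.A)
    (hb : ∀ i j, h * b (i, j) = b (i + 1, j)) {z : X.AK} {m : ℕ} {w : X.AA}
    (hw : algebraMap X.AA X.AK w = algebraMap X.AA X.AK (X.diff h) ^ m * z) :
    ∃ w', algebraMap X.AA X.AK w' = z := by
  refine mem_range_inclTensor b z (le_trans ?_ (content_inclTensor_le (K := X.K) b w))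
  rw [← X.algebraMap_AK, hw]
  clear hw
  induction m with
  | zero => rw [pow_zero, one_mul]
  | succ m ih =>
    rw [pow_succ', mul_assoc]
    exact ih.trans (content_le_content_mul b h hb _)

/-- If δ were zero, the content of 1 would lie in the content of 0, so all coordinates of 1 would
vanish. -/
theorem diff_ne_zero {h : X.A} {s : ℕ} (b : Module.Basis (ℕ × Fin s) F X.A)
    (hb : ∀ i j, h * b (i, j) = b (i + 1, j)) : X.diff h ≠ 0 := by
  intro h0
  obtain ⟨t, -, ht⟩ := exists_eq_sum_tmul b (1 : X.AK)
  have h1 : ∀ i, contract (b.coord i) (1 : X.AK) = 0 := fun i => by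
    have h2 := content_le_content_mul (K := X.K) b h hb 1 (contract_mem_content b i 1)
    change _ ∈ content b (inclTensor F X.A X.K (X.diff h) * 1) at h2
    rw [h0, map_zero, zero_mul] at h2
    have h3 : content b (0 : X.AK) ≤ ⊥ := Submodule.span_le.mpr (by
      rintro _ ⟨j, rfl⟩
      simp)
    exact (Submodule.mem_bot _).mp (h3 h2)
  refine one_ne_zero (α := X.AK) (ht.trans (Finset.sum_eq_zero fun i _ => ?_))
  rw [h1, TensorProduct.tmul_zero]

end PointedCurve

namespace AMotive

variable {F : Type u} [Field F] [Fintype F] {X : PointedCurve F} (E : AMotive X)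

theorem exists_pow_jA_smul_of_mem_sup : ∃ n : ℕ, ∀ w ∈ X.jA ^ n,
    ∀ z ∈ LinearMap.range (toGeneric X.AK E.M) ⊔ LinearMap.range E.τLin,
      w • z ∈ LinearMap.range (toGeneric X.AK E.M) := by
  obtain ⟨r, m, hm⟩ := Module.Finite.exists_fin (R := X.AK) (M := E.M)
  choose n hn using fun k => E.exists_pow_jA_smul (m k)
  refine ⟨∑ k, n k, fun w hw z hz => ?_⟩
  let P : Submodule X.AK (Generic X.AK E.M) := 
    (LinearMap.range (toGeneric X.AK E.M)).comap (LinearMap.lsmul X.AK _ (algebraMap X.AA X.AK w))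
  have hP : ∀ z, z ∈ P ↔ w • z ∈ LinearMap.range (toGeneric X.AK E.M) := fun z => by
    rw [E.algebraMap_smul_toGeneric]
    rfl
  rw [← hP]
  suffices h : LinearMap.range (toGeneric X.AK E.M) ⊔ LinearMap.range E.τLin ≤ P from h hz
  refine sup_le ?_ ?_
  · rintro _ ⟨y, rfl⟩
    rw [hP, ← E.toGeneric_smul]
    exact ⟨_, rfl⟩
  · have h1 : ∀ x : E.M, E.τSemi x ∈ P := by
      intro x
      have hx : x ∈ Submodule.span X.AK (Set.range m) := hm ▸ Submodule.mem_top
      induction hx using Submodule.span_induction with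
      | zero => rw [τSemi_zero]; exact zero_mem _
      | add x y _ _ hx hy => rw [τSemi_add]; exact add_mem hx hy
      | smul a x _ hx => rw [τSemi_smul]; exact Submodule.smul_mem _ _ hx
      | mem x hx =>
        obtain ⟨k, rfl⟩ := hx
        rw [hP]
        exact hn k w (Ideal.pow_le_pow_right (Finset.single_le_sum (fun _ _ => Nat.zero_le _)
          (Finset.mem_univ k)) hw)
    rintro _ ⟨t, rfl⟩
    induction t using TensorProduct.induction_on with
    | zero => exact (map_zero E.τLin).symm ▸ zero_mem P
    | add x y hx hy => exact (map_add E.τLin x y).symm ▸ add_mem hx hy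
    | tmul a x =>
      have h2 : (a ⊗ₜ x : FrobPullback X.frobAK E.M) =
          (show X.AK from a) • frobUnit X.frobAK E.M x := (smul_frobUnit _ _ _ _).symm
      have h3 : E.τLin (a ⊗ₜ x) = (show X.AK from a) • E.τSemi x :=
        (congrArg E.τLin h2).trans (map_smul _ _ _)
      exact h3 ▸ Submodule.smul_mem _ _ (h1 x)

/-- `N_A` is finitely generated. -/
theorem N_A_fg {L : Submodule X.AA E.M} (hL : E.IsIntegralModel L) : (E.N_A L).FG := by
  obtain ⟨h, s, b, hb⟩ := X.exists_basis
  obtain ⟨r, i, p, hip⟩ := E.exists_retract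
  obtain ⟨β, hβ0, hβ⟩ := E.exists_denominator b hb i p hip
  have hi : Function.Injective i := fun x y hxy => by
    have := congr(p $hxy)
    rw [← LinearMap.comp_apply, ← LinearMap.comp_apply, hip] at this
    exact this
  have := E.isNoetherian_boundingLattice hβ0 i hi
  have hLB : L ≤ E.boundingLattice β i := IsIntegralModel.le_boundingLattice E b i hβ0 hβ hL
  obtain ⟨n, hn⟩ := E.exists_pow_jA_smul_of_mem_sup
  have hδ : X.diff h ^ n ∈ X.jA ^ n := Ideal.pow_mem_pow (X.diff_mem_jA h) n
  have hf : ∀ z : E.N_A L, ∃ y ∈ E.boundingLattice β i, toGeneric X.AK E.M y =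
      X.diff h ^ n • z.1 := by
    rintro ⟨z, hz1, hz2⟩
    obtain ⟨y, hy⟩ := hn _ hδ z hz1
    -- Here y = δ^n z, and some δ^m z lies in L, hence in the bounding lattice. So δ^m times the
    -- β-scaled coordinates of y lie in A ⊗ A, and division by δ^m keeps them there. The exponent m
    -- may depend on z, but n does not.
    refine ⟨y, fun k => ?_, hy⟩
    obtain ⟨m, hm⟩ := hz2
    obtain ⟨y', hy', hyy'⟩ := hm _ (Ideal.pow_mem_pow (X.diff_mem_jA h) m)
    have h1 : X.diff h ^ m • y = X.diff h ^ n • y' := by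
      apply toGeneric_injective (R := X.AK) E.M
      rw [E.toGeneric_smul, E.toGeneric_smul, hy, smul_smul, mul_comm, mul_smul]
      exact congrArg _ hyy'.symm
    obtain ⟨w, hw⟩ := (E.boundingLattice β i).smul_mem (X.diff h ^ n) (hLB hy') k
    refine X.mem_range_of_diff_pow_mul b hb (m := m) (w := w) ?_
    rw [hw, ← h1, smul_eq_algebraMap_smul, map_smul, Pi.smul_apply, smul_eq_mul, map_pow]
    ring
  refine fg_of_smul_mem ((toGeneric X.AK E.M).restrictScalars X.AA)
    (toGeneric_injective (R := X.AK) E.M) (E.boundingLattice β i) (X.diff h ^ n)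
    (fun z hz => ?_) fun z hz => hf ⟨z, hz⟩
  rw [← E.tensorGerm_smul] at hz
  refine eq_zero_of_smul_eq_zero ?_ hz
  exact (map_ne_zero_iff _ X.tensorGerm_injective).mpr (pow_ne_zero _ (X.diff_ne_zero b hb))

theorem exists_pow_smul_N_A_le {L : Submodule X.AA E.M} (hL : E.IsIntegralModel L) {w : X.AA}
    (hw : w ∈ X.jA) : ∃ n : ℕ, ∀ z ∈ E.N_A L,
      w ^ n • z ∈ L.map ((toGeneric X.AK E.M).restrictScalars X.AA) := by
  obtain ⟨T, hT⟩ := E.N_A_fg hL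
  have hTN : ∀ z : T, z.1 ∈ E.N_A L := fun z => hT ▸ Submodule.subset_span z.2
  choose n hn using fun z : T => (hTN z).2
  refine ⟨∑ z, n z, fun z hz => ?_⟩
  rw [← hT] at hz
  induction hz using Submodule.span_induction with
  | zero => rw [smul_zero]; exact zero_mem _
  | add x y _ _ hx hy => rw [smul_add]; exact add_mem hx hy
  | smul a x _ hx => rw [smul_comm]; exact Submodule.smul_mem _ _ hx
  | mem z hz =>
    refine hn ⟨z, hz⟩ _ (Ideal.pow_le_pow_right (Finset.single_le_sum (fun _ _ => Nat.zero_le _)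
      (Finset.mem_univ (⟨z, hz⟩ : T))) (Ideal.pow_mem_pow hw _))

theorem τSemi_mem_N_A {L : Submodule X.AA E.M} (hL : E.IsIntegralModel L) {m : E.M} (hm : m ∈ L) :
    E.τSemi m ∈ E.N_A L :=
  ⟨Submodule.mem_sup_right ⟨_, rfl⟩, hL.stable (Submodule.subset_span ⟨m, hm, rfl⟩)⟩

theorem toGeneric_mem_N_A {L : Submodule X.AA E.M} {m : E.M} (hm : m ∈ L) :
    toGeneric X.AK E.M m ∈ E.N_A L :=
  ⟨Submodule.mem_sup_left ⟨_, rfl⟩, le_poles _ _ ⟨m, hm, rfl⟩⟩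

end AMotive

/-! ### A chart along the divisor at infinity -/

namespace PointedCurve

variable {F : Type u} [Field F] (X : PointedCurve F)

/-- An affine neighbourhood of the divisor at infinity on which `1 ⊗ h` has an inverse `t` that
vanishes on the divisor, and on which `t * (h ⊗ 1 - 1 ⊗ h)` is invertible. -/
theorem exists_surface_chart : ∃ (h : X.A) (U : X.surface.Opens) (_ : IsAffineOpen U)
    (hξ : genericPoint X.surface ∈ U) (t : Γ(X.surface, U)),
    (∀ x, x ∉ X.affineOpen → x ∈ U) ∧ X.infDivisor.app U t = 0 ∧
    X.tensorGerm (X.right h) * X.surface.presheaf.germ U _ hξ t = 1 ∧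
    X.tensorGerm (X.diff h) ≠ 0 ∧
    (∀ x ∈ U, (X.surface.presheaf.germ U _ hξ t * X.tensorGerm (X.diff h))⁻¹ ∈ localRing x) ∧
    ∀ w, ∃ c : ℕ, ∀ x ∈ U,
      X.surface.presheaf.germ U _ hξ t ^ c * X.tensorGerm w ∈ localRing x := by
  obtain ⟨h, V, hinf, hV, hξ, ϖ, t, hϖ, ht, hht⟩ := X.exists_chart
  have hξ' := X.mem_preimage_pr₂ hξ
  obtain ⟨a, ha⟩ : ∃ a : Γ(X.surface, X.pr₂ ⁻¹ᵁ V),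
      X.surface.presheaf.germ _ _ hξ' a = X.tensorGerm (h ⊗ₜ 1) :=
    exists_section_of_mem_localRing hξ' _ fun x _ => X.tensorGerm_left_mem h x
  let t' := X.pr₂.app V t
  -- This is θ (h ⊗ 1 - 1 ⊗ h), because θ (1 ⊗ h) = 1. As `t'` vanishes on the divisor and h ⊗ 1 is
  -- regular there, g is congruent to -1; on its basic open set the chart also avoids the zeros of
  -- δ.
  let g := t' * a - 1
  have hθ : X.tensorGerm (X.right h) * X.surface.presheaf.germ _ _ hξ' t' = 1 := by
    rw [← X.pullbackFun_germ hξ, X.tensorGerm_right, ← map_mul, hht, map_one]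
  have hg : X.surface.presheaf.germ _ _ hξ' g =
      X.surface.presheaf.germ _ _ hξ' t' * X.tensorGerm (X.diff h) := by
    rw [map_sub, map_mul, map_one, ha, diff, map_sub X.tensorGerm, mul_sub, ← hθ,
      mul_comm (X.tensorGerm (X.right h))]
  have hle : X.surface.basicOpen g ≤ X.pr₂ ⁻¹ᵁ V := X.surface.basicOpen_le g
  have hinfg : ∀ x, x ∉ X.affineOpen → x ∈ X.surface.basicOpen g := by
    intro x hx
    have hxV : X.pr₂ x = X.inf := by
      by_contra h
      exact hx h
    have hx1 : x ∈ X.pr₂ ⁻¹ᵁ V := by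
      change X.pr₂ x ∈ V
      rwa [hxV]
    have hx2 : x ∉ X.surface.basicOpen (t' * a) := by
      rw [Scheme.basicOpen_mul]
      intro h1
      have h2 := h1.1
      rw [← Scheme.preimage_basicOpen] at h2
      change X.pr₂ x ∈ X.C.basicOpen t at h2
      exact ht (hxV ▸ h2)
    rw [X.surface.mem_basicOpen _ _ hx1] at hx2 ⊢
    rw [map_sub, map_one]
    have := IsLocalRing.isUnit_one_sub_self_of_mem_nonunits _ hx2
    rw [← neg_sub]
    exact this.neg
  have hξg : genericPoint X.surface ∈ X.surface.basicOpen g := by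
    obtain ⟨x, hx⟩ := X.pr₂.surjective X.inf
    exact genericPoint_mem (hinfg x fun h1 => h1 hx)
  refine ⟨h, X.surface.basicOpen g, (hV.preimage X.pr₂).basicOpen g, hξg,
    X.surface.presheaf.map (homOfLE hle).op t', hinfg, ?_, ?_, ?_, ?_, ?_⟩
  · have h1 : X.infDivisor.app (X.pr₂ ⁻¹ᵁ V) t' = 0 := by
      have : t' ∈ RingHom.ker (X.infDivisor.app (X.pr₂ ⁻¹ᵁ V)).hom := by
        rw [X.ker_infDivisor hV hϖ, Ideal.mem_span_singleton]
        exact map_dvd _ ((hϖ t).mp ht)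
      exact this
    exact (idealSubmodule X.infDivisor).map (homOfLE hle).op h1
  · rw [germ_res (V' := op (X.surface.basicOpen g)) (homOfLE hle).op]
    exact hθ
  · exact right_ne_zero_of_mul (hg ▸ germ_ne_zero_of_mem_basicOpen hξ' hξg)
  · intro x hx
    rw [germ_res (V' := op (X.surface.basicOpen g)) (homOfLE hle).op]
    change (X.surface.presheaf.germ _ _ hξ' t' * _)⁻¹ ∈ _
    rw [← hg]
    exact inv_germ_mem_localRing hξ' hx
  · intro w
    rw [germ_res (V' := op (X.surface.basicOpen g)) (homOfLE hle).op]
    change ∃ c : ℕ, ∀ x ∈ X.surface.basicOpen g,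
      X.surface.presheaf.germ _ _ hξ' t' ^ c * X.tensorGerm w ∈ localRing x
    set θ := X.surface.presheaf.germ _ _ hξ' t' with hθdef
    have hθm : ∀ x ∈ X.surface.basicOpen g, θ ∈ localRing x := fun x hx =>
      germ_mem_localRing (hle hx) _ _
    induction w using TensorProduct.induction_on with
    | zero => exact ⟨0, fun x hx => by rw [map_zero, mul_zero]; exact zero_mem _⟩
    | add w w' hw hw' =>
      obtain ⟨c, hc⟩ := hw
      obtain ⟨c', hc'⟩ := hw'
      refine ⟨c + c', fun x hx => ?_⟩
      have e : θ ^ (c + c') * X.tensorGerm (w + w') = θ ^ c' * (θ ^ c * X.tensorGerm w) +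
          θ ^ c * (θ ^ c' * X.tensorGerm w') := by
        rw [map_add]; ring
      rw [e]
      exact add_mem (mul_mem (pow_mem (hθm x hx) _) (hc x hx))
        (mul_mem (pow_mem (hθm x hx) _) (hc' x hx))
    | tmul a b =>
      -- The factor b can have a pole only at ∞, where t vanishes, so a power of t removes it; a ⊗ 1
      -- has no poles.
      obtain ⟨c, hc⟩ := X.exists_pow_mul_mem_reg hV hξ (v := X.C.presheaf.germ V _ hξ t)
        (d := X.C.presheaf.germ X.affinePart _ X.genericPoint_mem_affinePart b)
        (fun x hx => germ_mem_localRing hx hξ t) fun x hx hxu => by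
          refine germ_mem_localRing ?_ _ b
          rintro rfl
          obtain ⟨r, hr⟩ := hxu
          refine ht ((X.C.mem_basicOpen t _ hx).mpr (IsUnit.of_mul_eq_one r ?_))
          apply IsFractionRing.injective (X.C.presheaf.stalk X.inf) X.C.functionField
          rw [map_mul, hr, algebraMap_germ_genericPoint hx hξ, map_one]
          exact mul_inv_cancel₀ (right_ne_zero_of_mul_eq_one hht)
      refine ⟨c, fun x hx => ?_⟩
      rw [X.tmul_eq_mul_right, map_mul, mul_left_comm]
      refine mul_mem (X.tensorGerm_left_mem a x) ?_
      rw [X.tensorGerm_right, hθdef, ← X.pullbackFun_germ hξ, ← map_pow, ← map_mul]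
      exact X.pullbackFun_mem_localRing (hc _ (hle hx))

end PointedCurve

/-! ### Spans over the local rings -/

section Span

variable {L W : Type*} [Field L] [AddCommGroup W] [Module L W] {O : Subring L} {T : Set W} {a : L}
  {w : W}

theorem smul_mem_span_of_mem (ha : a ∈ O) (hw : w ∈ Submodule.span O T) :
    a • w ∈ Submodule.span O T :=
  Submodule.smul_mem _ (⟨a, ha⟩ : O) hw

theorem smul_mem_span_image (hw : w ∈ Submodule.span O T) :
    a • w ∈ Submodule.span O ((fun v => a • v) '' T) := by
  induction hw using Submodule.span_induction with
  | mem v hv => exact Submodule.subset_span ⟨v, hv, rfl⟩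
  | zero => rw [smul_zero]; exact zero_mem _
  | add v v' _ _ hv hv' => rw [smul_add]; exact add_mem hv hv'
  | smul c v _ hv =>
    have e : a • c • v = c • a • v := smul_comm a (c : L) v
    rw [e]
    exact Submodule.smul_mem _ c hv

theorem mem_span_of_smul_mem (ha : a⁻¹ ∈ O) (ha0 : a ≠ 0) (hw : a • w ∈ Submodule.span O T) :
    w ∈ Submodule.span O T := by
  have := smul_mem_span_of_mem ha hw
  rwa [smul_smul, inv_mul_cancel₀ ha0, one_smul] at this

/-- Multiplying the generators by a unit does not change the span. -/
theorem span_image_smul (ha : a ∈ O) (ha' : a⁻¹ ∈ O) (ha0 : a ≠ 0) :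
    Submodule.span O ((fun v => a • v) '' T) = Submodule.span O T := by
  apply le_antisymm
  · refine Submodule.span_le.mpr ?_
    rintro _ ⟨v, hv, rfl⟩
    exact smul_mem_span_of_mem ha (Submodule.subset_span hv)
  · refine Submodule.span_le.mpr fun v hv => mem_span_of_smul_mem ha' ha0 ?_
    exact Submodule.subset_span ⟨v, hv, rfl⟩

end Span

section

variable {S : Scheme.{u}} [IsIntegral S] {W : Type u} [AddCommGroup W] [Module S.functionField W]

theorem fracHom_app_surjective {G G' : S → Set W}
    (h : ∀ x, ∀ w ∈ G x, w ∈ Submodule.span (localRing x) (G' x)) {V : S.Opens}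
    (h' : ∀ x ∈ V, ∀ w ∈ G' x, w ∈ Submodule.span (localRing x) (G x)) :
    Function.Surjective ((fracHom h).app V) := by
  intro f
  by_cases hξ : genericPoint S ∈ V
  · refine ⟨fracMk G V (fracVal G' hξ f) fun x hx =>
      Submodule.span_le.mpr (h' x hx) (fracVal_mem hξ f hx), frac_ext fun p => ?_⟩
    rw [fracVal_fracHom, fracVal_fracMk]
  · exact ⟨0, frac_ext fun p => absurd p hξ⟩

end

/-! ### From local generators to a shtuka model -/

namespace AMotive

variable {F : Type u} [Field F] [Fintype F] {X : PointedCurve F} (E : AMotive X)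

theorem mem_span_localRing {x : X.surface} (hx : x ∈ X.affineOpen) {T : Set (Generic X.AK E.M)}
    {w : Generic X.AK E.M} (hw : w ∈ Submodule.span X.AA T) :
    w ∈ Submodule.span (localRing x) T := by
  induction hw using Submodule.span_induction with
  | mem v hv => exact Submodule.subset_span hv
  | zero => exact zero_mem _
  | add v v' _ _ hv hv' => exact add_mem hv hv'
  | smul c v _ hv =>
    rw [← E.tensorGerm_smul]
    exact smul_mem_span_of_mem (X.tensorGerm_mem_localRing c hx) hv

theorem mem_of_mem_span_sectionRing {P : Submodule X.AA (Generic X.AK E.M)}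
    {w : Generic X.AK E.M}
    (hw : w ∈ Submodule.span (sectionRing X.affineOpen X.genericPoint_mem_affineOpen)
      (P : Set (Generic X.AK E.M))) : w ∈ P := by
  induction hw using Submodule.span_induction with
  | mem v hv => exact hv
  | zero => exact zero_mem _
  | add v v' _ _ hv hv' => exact add_mem hv hv'
  | smul c v _ hv =>
    obtain ⟨_, r, rfl⟩ := c
    obtain ⟨a, rfl⟩ := X.tensorEquiv.surjective r
    change X.tensorGerm a • v ∈ P
    rw [E.tensorGerm_smul]
    exact P.smul_mem a hv

/-- The sections over `Spec (A ⊗ A)` of the sheaf defined by an `A ⊗ A`-module. -/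
theorem exists_sectionsEquiv {G : X.surface → Set (Generic X.AK E.M)}
    {P : Submodule X.AA (Generic X.AK E.M)} (hG : ∀ x ∈ X.affineOpen, G x = P) :
    ∃ e : Γ(fracSheaf G, X.affineOpen) ≃+ P,
      (∀ s, (e s : Generic X.AK E.M) = fracVal G X.genericPoint_mem_affineOpen s) ∧
      ∀ (a b : X.A) (s : Γ(fracSheaf G, X.affineOpen)),
        e (X.tensorSection a b • s) = (a ⊗ₜ[F] b : X.AA) • e s := by
  let v := fracVal G X.genericPoint_mem_affineOpen
  have hv : ∀ s, v s ∈ P := fun s => E.mem_of_mem_span_sectionRing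
    (mem_span_sectionRing X.isAffineOpen_affineOpen X.genericPoint_mem_affineOpen _ _ fun y hy => by
      rw [← hG y hy]
      exact fracVal_mem _ s hy)
  let e : Γ(fracSheaf G, X.affineOpen) ≃+ P := AddEquiv.ofBijective
    ({ toFun := fun s => ⟨v s, hv s⟩
       map_zero' := Subtype.ext (map_zero v)
       map_add' := fun s s' => Subtype.ext (map_add v s s') } : Γ(fracSheaf G, X.affineOpen) →+ P)
    ⟨fun s s' h => fracVal_injective X.genericPoint_mem_affineOpen (congrArg Subtype.val h),
      fun w => ⟨fracMk G _ w.1 fun x hx => Submodule.subset_span (by rw [hG x hx]; exact w.2), rfl⟩⟩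
  refine ⟨e, fun s => rfl, fun a b s => Subtype.ext ?_⟩
  change v (X.tensorSection a b • s) = (a ⊗ₜ[F] b : X.AA) • v s
  rw [← E.tensorGerm_smul, X.tensorGerm_apply, X.tensorEquiv_tmul]
  exact fracVal_smul _ _ _

end AMotive

section Span

variable {L W : Type*} [Field L] [AddCommGroup W] [Module L W] {O : Subring L} {T : Set W} {a : L}
  {w : W}

theorem pow_smul_mem_span (ha : a ∈ O) {m n : ℕ} (hmn : m ≤ n)
    (hw : a ^ m • w ∈ Submodule.span O T) : a ^ n • w ∈ Submodule.span O T := by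
  obtain ⟨k, rfl⟩ := Nat.exists_eq_add_of_le' hmn
  rw [pow_add, mul_smul]
  exact smul_mem_span_of_mem (pow_mem ha k) hw

theorem pow_smul_smul_mem_span {b : L} {m n : ℕ} (hb : a ^ m * b ∈ O)
    (hw : a ^ n • w ∈ Submodule.span O T) : a ^ (m + n) • b • w ∈ Submodule.span O T := by
  have e : a ^ (m + n) • b • w = (a ^ m * b) • a ^ n • w := by
    rw [smul_smul, smul_smul, pow_add]
    congr 1
    ring
  rw [e]
  exact smul_mem_span_of_mem hb hw

end Span

namespace AMotive

variable {F : Type u} [Field F] [Fintype F] {X : PointedCurve F} (E : AMotive X)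

/-- Elements of A ⊗ A have poles of bounded order along ∞_A, and a vector of the span involves
finitely many of them. One power of θ works at all points of the chart. -/
theorem exists_pow_smul_mem_span_localRing {θ : X.surface.functionField} {U : Set X.surface}
    (hθ : ∀ x ∈ U, θ ∈ localRing x)
    (hw : ∀ w, ∃ c : ℕ, ∀ x ∈ U, θ ^ c * X.tensorGerm w ∈ localRing x)
    {T : Set (Generic X.AK E.M)} {y : Generic X.AK E.M} (hy : y ∈ Submodule.span X.AA T) :
    ∃ c : ℕ, ∀ n ≥ c, ∀ x ∈ U, θ ^ n • y ∈ Submodule.span (localRing x) T := by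
  induction hy using Submodule.span_induction with
  | mem v hv =>
    exact ⟨0, fun n hn x hx => smul_mem_span_of_mem (pow_mem (hθ x hx) n) (Submodule.subset_span hv)⟩
  | zero => exact ⟨0, fun n hn x hx => by rw [smul_zero]; exact zero_mem _⟩
  | add v v' _ _ hv hv' =>
    obtain ⟨c, hc⟩ := hv
    obtain ⟨c', hc'⟩ := hv'
    refine ⟨c + c', fun n hn x hx => ?_⟩
    rw [smul_add]
    exact add_mem (hc n (by omega) x hx) (hc' n (by omega) x hx)
  | smul a v _ hv =>
    obtain ⟨c, hc⟩ := hv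
    obtain ⟨c', hc'⟩ := hw a
    refine ⟨c' + c, fun n hn x hx => ?_⟩
    rw [← E.tensorGerm_smul]
    exact pow_smul_mem_span (hθ x hx) hn (pow_smul_smul_mem_span (hc' x hx) (hc c le_rfl x hx))

/-- The absolute Frobenius is the identity on the points of the curve, so τ preserves the divisor at
infinity and its complement. -/
theorem frob_mem_affineOpen {x : X.surface} : X.frob x ∈ X.affineOpen ↔ x ∈ X.affineOpen := by
  have h : (X.frob ≫ X.pr₂) x = (X.pr₂ ≫ absoluteFrobenius X.π) x := by rw [X.frob_pr₂]
  have h1 : X.pr₂ (X.frob x) = X.pr₂ x := h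
  change X.pr₂ (X.frob x) ∈ X.affinePart ↔ X.pr₂ x ∈ X.affinePart
  rw [h1]

variable {L : Submodule X.AA E.M} {GM GN : X.surface → Set (Generic X.AK E.M)}

/-- A pair of families of local generators defines a `C`-shtuka model. -/
theorem nonempty_cShtukaModel_of_generators
    (hGM : ∀ x ∈ X.affineOpen, GM x = (L.map ((toGeneric X.AK E.M).restrictScalars X.AA) : Set _))
    (hGN : ∀ x ∈ X.affineOpen, GN x = (E.N_A L : Set _))
    (hGMfg : IsLocallyFG GM) (hGNfg : IsLocallyFG GN)
    (hMN : ∀ x, ∀ w ∈ GM x, w ∈ Submodule.span (localRing x) (GN x))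
    (hNM : ∀ x ∉ X.diagonal, ∃ V : X.surface.Opens, x ∈ V ∧
      ∀ y ∈ V, ∀ w ∈ GN y, w ∈ Submodule.span (localRing y) (GM y))
    {T : Generic X.AK E.M →+ Generic X.AK E.M} (hT : IsSemilinear X.frob T)
    (hTτ : ∀ m, T (toGeneric X.AK E.M m) = E.τSemi m)
    (H : ∀ x : X.surface, ∃ (V : X.surface.Opens) (hx : x ∈ V) (s : Γ(X.surface, V)),
      X.infDivisor.app V s = 0 ∧ ∀ w ∈ GM (X.frob x), ∃ z ∈ Submodule.span (localRing x) (GN x),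
        T w = X.surface.presheaf.germ V (genericPoint X.surface) (genericPoint_mem hx) s • z) :
    Nonempty (E.CShtukaModel L) := by
  have h : ∀ x, ∀ w ∈ GM (X.frob x), T w ∈ Submodule.span (localRing x) (GN x) := by
    intro x w hw
    obtain ⟨V, hx, s, -, hs⟩ := H x
    obtain ⟨z, hz, hzw⟩ := hs w hw
    rw [hzw]
    exact germ_smul_mem_span hx _ _ hz
  obtain ⟨τ, hτ⟩ := exists_twist_of_semilinear X.infDivisor X.isLocallyPrincipal_infDivisor hGNfg
    T hT X.frob_genericPoint h H
  obtain ⟨eN, heN, heN'⟩ := E.exists_sectionsEquiv hGN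
  obtain ⟨eP, heP, heP'⟩ := E.exists_sectionsEquiv hGM
  let ι := (toGeneric X.AK E.M).restrictScalars X.AA
  let eL : L ≃ₗ[X.AA] L.map ι :=
    Submodule.equivMapOfInjective ι (toGeneric_injective (R := X.AK) E.M) L
  have heL : ∀ p : L.map ι, toGeneric X.AK E.M (eL.symm p : E.M) = p := fun p =>
    congrArg Subtype.val (eL.apply_symm_apply p)
  have hM : ∀ s, toGeneric X.AK E.M (eL.symm (eP s) : E.M) =
      fracVal GM X.genericPoint_mem_affineOpen s := fun s => (heL (eP s)).trans (heP s)
  refine ⟨{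
    N := fracSheaf GN
    N_coherent := hGNfg.isCoherent
    sectionsN := eN
    sectionsN_smul := heN'
    M := fracSheaf GM
    M_coherent := hGMfg.isCoherent
    ι := fracHom hMN
    mono := inferInstance
    sectionsM := eP.trans eL.symm.toAddEquiv
    sectionsM_smul := fun a b s => ?_
    sections_ι := fun s => ?_
    support_subset := fun x hx => ?_
    τ := τ
    sections_τ := fun s => ?_ }⟩
  · exact (congrArg eL.symm (heP' a b s)).trans (map_smul eL.symm _ _)
  · exact (heN _).trans (hM s).symm
  · by_contra hxd
    obtain ⟨V, hxV, hV⟩ := hNM x hxd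
    exact not_mem_moduleSupport_cokernel _ hxV
      (fun V' hV' => fracHom_app_surjective hMN fun y hy => hV y (hV' hy)) hx
  · rw [hτ]
    refine (heN _).trans ?_
    refine Eq.trans ?_ (hTτ _)
    exact (fracVal_fracPushforward T hT X.frob_genericPoint h X.genericPoint_mem_affineOpen
      (X.affineOpen_le_frob X.genericPoint_mem_affineOpen) s).trans (congrArg T (hM s).symm)

end AMotive

theorem exists_piecewise {α β : Type*} (s : Set α) (a b : β) :
    ∃ f : α → β, (∀ x ∈ s, f x = a) ∧ ∀ x ∉ s, f x = b := by
  classical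
  exact ⟨s.piecewise (fun _ => a) fun _ => b, fun x hx => s.piecewise_eq_of_mem _ _ hx,
    fun x hx => s.piecewise_eq_of_notMem _ _ hx⟩

section Span

variable {L W : Type*} [Field L] [AddCommGroup W] [Module L W] {O : Subring L} {T : Set W}

/-- Since θδ is a unit in the direction needed, the pole of w along δ is traded for a power of θ:
θ^e w = (θδ)^(-n) θ^(e+n) δ^n w. -/
theorem pow_smul_mem_span_image {θ δ : L} (hθ : θ ≠ 0) (hδ : δ ≠ 0) (h : (θ * δ)⁻¹ ∈ O) {e n : ℕ}
    (k : ℕ) {w : W} (hw : θ ^ (e + n) • δ ^ n • w ∈ Submodule.span O T) :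
    θ ^ (k + e) • w ∈ Submodule.span O ((fun v => θ ^ k • v) '' T) := by
  have e : θ ^ (k + e) • w = θ ^ k • (θ * δ)⁻¹ ^ n • θ ^ (e + n) • δ ^ n • w := by
    simp only [smul_smul]
    congr 1
    rw [pow_add, pow_add, inv_pow, mul_pow]
    field_simp
  rw [e]
  exact smul_mem_span_image (smul_mem_span_of_mem (pow_mem h n) hw)

end Span

/-! ### Extension across infinity and construction of the model -/

namespace PointedCurve

variable {F : Type u} [Field F] [Fintype F] (X : PointedCurve F)

theorem functionFieldMap_frob_of_mul_eq_one {h : X.A} {θ : X.surface.functionField}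
    (hθ : X.tensorGerm (X.right h) * θ = 1) :
    functionFieldMap X.frob X.frob_genericPoint θ = θ ^ Fintype.card F := by
  have h1 : θ = (X.tensorGerm (X.right h))⁻¹ := eq_inv_of_mul_eq_one_right hθ
  have h2 : X.frobAA (X.right h) = X.right h ^ Fintype.card F := by
    simp [frobAA, right, Algebra.TensorProduct.tmul_pow]
  rw [h1, map_inv₀, X.functionFieldMap_frob, h2, map_pow, inv_pow]

end PointedCurve

namespace AMotive

variable {F : Type u} [Field F] [Fintype F] {X : PointedCurve F} (E : AMotive X)

theorem span_localRing_eq {x : X.surface} (hx : x ∈ X.affineOpen) {T : Set (Generic X.AK E.M)}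
    {P : Submodule X.AA (Generic X.AK E.M)} (hT : Submodule.span X.AA T = P) :
    Submodule.span (localRing x) (P : Set (Generic X.AK E.M)) =
      Submodule.span (localRing x) T := by
  subst hT
  exact le_antisymm (Submodule.span_le.mpr fun w hw => E.mem_span_localRing hx hw)
    (Submodule.span_mono Submodule.subset_span)

theorem tensorGerm_pow_smul (w : X.AA) (n : ℕ) (z : Generic X.AK E.M) :
    X.tensorGerm w ^ n • z = w ^ n • z := by
  rw [← map_pow, E.tensorGerm_smul]

theorem exists_uniform_pole_bound {θ : X.surface.functionField} {U : Set X.surface}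
    (hθ : ∀ x ∈ U, θ ∈ localRing x)
    (hw : ∀ w, ∃ c : ℕ, ∀ x ∈ U, θ ^ c * X.tensorGerm w ∈ localRing x)
    {T : Set (Generic X.AK E.M)} {Z : Set (Generic X.AK E.M)} (hZ : Z.Finite)
    (hZT : ∀ z ∈ Z, z ∈ Submodule.span X.AA T) :
    ∃ c : ℕ, ∀ z ∈ Z, ∀ n ≥ c, ∀ x ∈ U, θ ^ n • z ∈ Submodule.span (localRing x) T := by
  have := hZ.fintype
  choose c hc using fun z : Z => E.exists_pow_smul_mem_span_localRing hθ hw (hZT z z.2)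
  exact ⟨∑ z, c z, fun z hz n hn => hc ⟨z, hz⟩ n
    ((Finset.single_le_sum (fun _ _ => Nat.zero_le _) (Finset.mem_univ (⟨z, hz⟩ : Z))).trans hn)⟩

theorem span_localRing_smul_eq {x : X.surface} (hx : x ∈ X.affineOpen)
    {T : Set (Generic X.AK E.M)} {P : Submodule X.AA (Generic X.AK E.M)}
    (hT : Submodule.span X.AA T = P) {a : X.surface.functionField} (ha : a ∈ localRing x)
    (ha' : a⁻¹ ∈ localRing x) (ha0 : a ≠ 0) :
    Submodule.span (localRing x) (P : Set (Generic X.AK E.M)) =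
      Submodule.span (localRing x) ((fun v => a • v) '' T) := by
  rw [E.span_localRing_eq hx hT]
  exact (span_image_smul ha ha' ha0).symm

theorem span_localRing_eq_of_pow_smul_mem {x : X.surface}
    {P N : Set (Generic X.AK E.M)} (hPN : P ⊆ N) {δ : X.surface.functionField}
    (hδ : δ⁻¹ ∈ localRing x) (hδ0 : δ ≠ 0) {n : ℕ} (hN : ∀ z ∈ N, δ ^ n • z ∈ P) :
    Submodule.span (localRing x) N = Submodule.span (localRing x) P := by
  refine le_antisymm (Submodule.span_le.mpr fun z hz => ?_) (Submodule.span_mono hPN)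
  refine mem_span_of_smul_mem (a := δ ^ n) ?_ (pow_ne_zero n hδ0)
    (Submodule.subset_span (hN z hz))
  rw [← inv_pow]
  exact pow_mem hδ n

theorem map_germ_pow_smul {f : Generic X.AK E.M →+ Generic X.AK E.M}
    (hf : IsSemilinear X.frob f) {U : X.surface.Opens} (hξ : genericPoint X.surface ∈ U)
    (t : Γ(X.surface, U)) (k : ℕ) (w : Generic X.AK E.M) :
    f (X.surface.presheaf.germ U _ hξ t ^ k • w) = functionFieldMap X.frob X.frob_genericPoint
      (X.surface.presheaf.germ U _ hξ t ^ k) • f w := by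
  have hξ' : genericPoint X.surface ∈ X.frob ⁻¹ᵁ U := by
    change X.frob _ ∈ U
    rwa [X.frob_genericPoint]
  rw [← map_pow, hf U hξ hξ', functionFieldMap_germ X.frob X.frob_genericPoint hξ hξ']

-- On the chart δ is invertible, so M_A and N_A generate the same lattices on its finite part and
-- may be extended by the same one across ∞_A. That lattice is scaled by θ^k, with k chosen so that
-- the Frobenius power of the scaling beats the pole of τ_M.
set_option maxHeartbeats 1600000 in
theorem nonempty_cShtukaModel {L : Submodule X.AA E.M} (hL : E.IsIntegralModel L) :
    Nonempty (E.CShtukaModel L) := by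
  classical
  obtain ⟨h, U, hU, hξ, t, hUinf, ht, hth, hδ0, hδ, hpole⟩ := X.exists_surface_chart
  set θ := X.surface.presheaf.germ U _ hξ t with hθdef
  set δ := X.tensorGerm (X.diff h) with hδdef
  have hθ : ∀ x ∈ U, θ ∈ localRing x := fun x hx => germ_mem_localRing hx _ _
  have hθ0 : θ ≠ 0 := right_ne_zero_of_mul_eq_one hth
  have hθinv : ∀ x ∈ X.affineOpen, θ⁻¹ ∈ localRing x := fun x hx => by
    rw [inv_eq_of_mul_eq_one_left hth]
    exact X.tensorGerm_mem_localRing _ hx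
  have hδinv : ∀ x ∈ U, δ⁻¹ ∈ localRing x := fun x hx => by
    have e : δ⁻¹ = θ * (θ * δ)⁻¹ := by field_simp
    rw [e]
    exact mul_mem (hθ x hx) (hδ x hx)
  let ι := (toGeneric X.AK E.M).restrictScalars X.AA
  let P := L.map ι
  let N := E.N_A L
  have hPN : ∀ w ∈ P, w ∈ N := by
    rintro _ ⟨m, hm, rfl⟩
    exact E.toGeneric_mem_N_A hm
  obtain ⟨T₀, hT₀⟩ := hL.fg
  let T : Set (Generic X.AK E.M) := ι '' T₀
  have hTfin : T.Finite := T₀.finite_toSet.image ι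
  have hTP : Submodule.span X.AA T = P := by
    rw [Submodule.span_image, hT₀]
  obtain ⟨TN, hTN⟩ := E.N_A_fg hL
  obtain ⟨n, hn⟩ := E.exists_pow_smul_N_A_le hL (X.diff_mem_jA h)
  have hnN : ∀ z ∈ N, δ ^ n • z ∈ P := fun z hz => by
    rw [hδdef, E.tensorGerm_pow_smul]
    exact hn z hz
  obtain ⟨c, hc⟩ := E.exists_uniform_pole_bound (U := U) hθ hpole (T := T)
    (T₀.finite_toSet.image fun m => δ ^ n • E.τSemi m) (by
      rintro _ ⟨m, hm, rfl⟩
      rw [hTP]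
      exact hnN _ (E.τSemi_mem_N_A hL (hT₀ ▸ Submodule.subset_span hm)))
  -- With k = c + 1 the exponent qk splits as 1 + (k + e): one factor θ for the twist, k for the
  -- lattice at infinity, and e = (q - 1)(c + 1) - 1 ≥ c to absorb the pole, since q ≥ 2.
  obtain ⟨k, e, hk, he⟩ : ∃ k e, k * Fintype.card F = 1 + (k + e) ∧ c ≤ e + n := by
    have hq : 2 ≤ Fintype.card F := Fintype.one_lt_card
    refine ⟨c + 1, (c + 1) * Fintype.card F - 1 - (c + 1), ?_, ?_⟩ <;>
    nlinarith [Nat.sub_add_cancel (show 1 + (c + 1) ≤ (c + 1) * Fintype.card F by nlinarith),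
      Nat.sub_sub ((c + 1) * Fintype.card F) 1 (c + 1)]
  obtain ⟨T', hT'⟩ : ∃ T' : Set (Generic X.AK E.M), T' = (fun v => θ ^ k • v) '' T := ⟨_, rfl⟩
  have hT'fin : T'.Finite := hT' ▸ hTfin.image _
  obtain ⟨GM, hGM, hGM'⟩ := exists_piecewise (X.affineOpen : Set X.surface) (P : Set _) T'
  obtain ⟨GN, hGN, hGN'⟩ := exists_piecewise (X.affineOpen : Set X.surface) (N : Set _) T'
  -- θ is a unit on the finite part of the chart, so scaling by θ^k changes nothing there and the
  -- piecewise definition glues.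
  have hGMU : ∀ x ∈ U, Submodule.span (localRing x) (GM x) = Submodule.span (localRing x) T' := by
    intro x hxU
    by_cases hx : x ∈ X.affineOpen
    · rw [hGM x hx, hT']
      exact E.span_localRing_smul_eq hx hTP (pow_mem (hθ x hxU) k)
        (inv_pow θ k ▸ pow_mem (hθinv x hx) k) (pow_ne_zero k hθ0)
    · rw [hGM' x hx]
  have hGNU : ∀ x ∈ U, Submodule.span (localRing x) (GN x) = Submodule.span (localRing x) T' := by
    intro x hxU
    by_cases hx : x ∈ X.affineOpen
    · rw [← hGMU x hxU, hGM x hx, hGN x hx]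
      exact E.span_localRing_eq_of_pow_smul_mem hPN (hδinv x hxU) hδ0 hnN
    · rw [hGN' x hx]
  obtain ⟨f, hf, hfT⟩ := E.exists_τ_extension
  refine E.nonempty_cShtukaModel_of_generators hGM hGN (fun x => ?_) (fun x => ?_)
    (fun x w hw => ?_) (fun x hxd => ?_) hf hfT fun x => ?_
  · by_cases hx : x ∈ X.affineOpen
    · exact ⟨X.affineOpen, T, X.isAffineOpen_affineOpen, hx, hTfin, fun y hy => by
        rw [hGM y hy, E.span_localRing_eq hy hTP]⟩
    · exact ⟨U, T', hU, hUinf x hx, hT'fin, hGMU⟩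
  · by_cases hx : x ∈ X.affineOpen
    · exact ⟨X.affineOpen, TN, X.isAffineOpen_affineOpen, hx, TN.finite_toSet, fun y hy => by
        rw [hGN y hy, E.span_localRing_eq hy hTN]⟩
    · exact ⟨U, T', hU, hUinf x hx, hT'fin, hGNU⟩
  · by_cases hx : x ∈ X.affineOpen
    · rw [hGM x hx] at hw
      rw [hGN x hx]
      exact Submodule.subset_span (hPN w hw)
    · rw [hGM' x hx] at hw
      rw [hGN' x hx]
      exact Submodule.subset_span hw
  · by_cases hx : x ∈ X.affineOpen
    · obtain ⟨w, hw, hxw⟩ := X.exists_mem_jA_of_notMem_diagonal hx hxd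
      obtain ⟨n', hn'⟩ := E.exists_pow_smul_N_A_le hL hw
      refine ⟨_, hxw, fun y hy z hz => ?_⟩
      have hyU : y ∈ X.affineOpen := X.surface.basicOpen_le _ hy
      rw [hGN y hyU] at hz
      rw [hGM y hyU]
      refine mem_span_of_smul_mem (a := X.tensorGerm w ^ n') ?_ (pow_ne_zero n' ?_)
        (Submodule.subset_span ?_)
      · rw [← inv_pow]
        exact pow_mem (inv_germ_mem_localRing X.genericPoint_mem_affineOpen hy) n'
      · exact germ_ne_zero_of_mem_basicOpen X.genericPoint_mem_affineOpen hy
      · rw [E.tensorGerm_pow_smul]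
        exact hn' z hz
    · refine ⟨U, hUinf x hx, fun y hy z hz => ?_⟩
      rw [hGMU y hy, ← hGNU y hy]
      exact Submodule.subset_span hz
  · by_cases hx : x ∈ X.affineOpen
    · refine ⟨X.affineOpen, hx, 1, X.infDivisor_app_affineOpen 1, fun w hw => ⟨f w, ?_, ?_⟩⟩
      · rw [hGM _ (frob_mem_affineOpen.mpr hx)] at hw
        obtain ⟨m, hm, rfl⟩ := hw
        rw [hGN x hx]
        refine Submodule.subset_span ?_
        have e : f (ι m) = E.τSemi m := hfT m
        rw [e]
        exact E.τSemi_mem_N_A hL hm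
      · rw [map_one, one_smul]
    -- On the divisor τ(θ^k m) = θ^(qk) τ_M(m) = θ · θ^(k+e) τ_M(m). The first θ is the germ of `t`,
    -- a section of the ideal of ∞_A, and the other factor lies in the lattice generated by θ^k T.
    · refine ⟨U, hUinf x hx, t, ht, fun w hw => ?_⟩
      rw [hGM' _ (frob_mem_affineOpen.not.mpr hx)] at hw
      rw [hT'] at hw
      obtain ⟨_, ⟨m, hm, rfl⟩, rfl⟩ := hw
      rw [hGN' x hx, hT']
      refine ⟨θ ^ (k + e) • E.τSemi m, pow_smul_mem_span_image hθ0 hδ0 (hδ x (hUinf x hx)) k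
        (hc _ ⟨m, hm, rfl⟩ _ he x (hUinf x hx)), ?_⟩
      have hφ : functionFieldMap X.frob X.frob_genericPoint (θ ^ k) = θ * θ ^ (k + e) := by
        rw [map_pow, X.functionFieldMap_frob_of_mul_eq_one hth, ← pow_mul, mul_comm, hk, pow_add,
          pow_one]
      have e : f (ι m) = E.τSemi m := hfT m
      refine (E.map_germ_pow_smul hf hξ t k (ι m)).trans ?_
      rw [hφ, e]
      exact mul_smul _ _ _

end AMotive

end ShtukaModels

theorem mainTheorem12 {F : Type u} [Field F] [Fintype F] (X : ShtukaModels.PointedCurve F)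
    (E : ShtukaModels.AMotive X) :
    ∃ M_A : Submodule X.AA E.M, E.IsMaximalIntegralModel M_A ∧ Nonempty (E.CShtukaModel M_A) := by
  obtain ⟨M_A, hM⟩ := E.exists_isMaximalIntegralModel
  exact ⟨M_A, hM, E.nonempty_cShtukaModel hM.1⟩
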